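/- **Model.** Fix constants $\lambda_B,\lambda_u,A_B,A_D,P_B,P_0,P_d,\beta>0$, $\alpha_B,\alpha_D>2$, $\sigma_B,\sigma_D\ge 0$, $\varepsilon\in(0,1]$, $\eta_d\ge 0$, and put $\kappa=-\ln 10/10$. A link with shadowing $\xi$ (in dB) has fading coefficient $\mathcal H=e^{\kappa\xi}$, where $\xi\sim N(0,\sigma_B^2)$ for cellular links and $\xi\sim N(0,\sigma_D^2)$ for D2D links; a link of length $R$ has equivalent distance $\overline R=\mathcal H^{-1/\alpha}R$, with $\alpha=\alpha_B$ or $\alpha_D$ respectively. All marks mentioned below are i.i.d. over the points and independent of the points. *Mode selection.* Base stations form a homogeneous Poisson point process (PPP) of intensity $\lambda_B$ in $\mathbb R^2$, with i.i.d. shadowings to a typical user at the origin. The typical user is in cellular mode if the largest received power $P^*=\max_b A_BP_B\mathcal H_B(b)R_b^{-\alpha_B}$ exceeds $\beta$; let $q=\Pr[P^*>\beta]$, and let $\overline R_i$ be its equivalent distance to the strongest base station, conditioned on cellular mode. With $t=(\beta/(A_BP_B))^{-1/\alpha_B}$ and $e_B=\exp(2\kappa^2\sigma_B^2/\alpha_B^2)$,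 $$q=1-\exp\!\Big(-\pi\lambda_B\big(\tfrac{A_BP_B}{\beta}\big)^{2/\alpha_B}e_B\Big),\qquad f_{\overline R_i}(\rho)=\frac{2\pi\lambda_Be_B\,\rho\,e^{-\pi\lambda_Be_B\rho^2}}{q}\quad(0<\rho<t).$$ *Interferers.* The active cellular users form a PPP $\phi_c$ of intensity $\lambda_B$; the $i$-th one has a cellular shadowing to the origin and, independently, an equivalent distance $\rho_i$ to its own base station distributed as $\overline R_i$, and transmits with power $P_{c_i}=P_0(\rho_i^{\alpha_B}/A_B)^{\varepsilon}$. The D2D users form a PPP of intensity $(1-q)\lambda_u$, independent (with its marks) of $\phi_c$ (with its marks); each has a D2D shadowing to the origin and is, by a fair coin independent of its shadowing, a transmitter (of power $P_d$) or a receiver. *SINR.* A typical D2D receiver at the origin is served by the D2D transmitter that it receives with the largest power; $\overline R_d$ is the equivalent distance of that link. With $R_{B,i},R_{D,j}$ the distances to the origin, $$\mathrm{SINR}=\frac{P_dA_D\overline R_d^{-\alpha_D}}{\sum_{i\in\phi_c}P_{c_i}A_B\mathcal H_i^BR_{B,i}^{-\alpha_B}+\sum_{j}P_dA_D\mathcal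 H_j^DR_{D,j}^{-\alpha_D}+\eta_d},$$ the second sum being over the D2D transmitters other than the serving one. **Lemma 5.** Let $e_D=\exp(2\kappa^2\sigma_D^2/\alpha_D^2)$. The distribution function of $\overline R_d$ is differentiable on $(0,\infty)$, and its derivative $f_{\overline R_d}(r)=\frac{d}{dr}\Pr[\overline R_d\le r]$ is the density of $\overline R_d$. For every real $\omega$ the conditional characteristic function of $1/\mathrm{SINR}$ is $\mathbb E[e^{-i\omega/\mathrm{SINR}}\mid\overline R_d]=\mathcal F(\omega,\overline R_d)$ almost surely, where for $r>0$ $$\begin{aligned}\mathcal F(\omega,r)=&\exp\Big\{-2\pi\lambda_Be_B\int_0^\infty\Big(1-\int_0^t\exp\Big(-\frac{i\omega\,P_0A_B^{1-\varepsilon}\rho^{\alpha_B\varepsilon}\tau^{-\alpha_B}}{P_dA_Dr^{-\alpha_D}}\Big)f_{\overline R_i}(\rho)\,d\rho\Big)\tau\,d\tau\Big\}\\&\times\exp\Big\{-\pi(1-q)\lambda_ue_D\int_r^\infty\Big(1-\exp\Big(-\frac{i\omega L^{-\alpha_D}}{r^{-\alpha_D}}\Big)\Big)L\,dL\Big\}\times\exp\Big(-\frac{i\omega\eta_d}{P_dA_Dr^{-\alpha_D}}\Big).\end{aligned}$$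 For every $T>0$, $$\Pr[\mathrm{SINR}>T]=\int_0^\infty\Big(\int_{-\infty}^\infty\frac{e^{i\omega/T}-1}{2\pi i\omega}\,\mathcal F(\omega,r)\,d\omega\Big)f_{\overline R_d}(r)\,dr,$$ where the inner integral converges absolutely for every $r>0$ and the outer one converges absolutely. -/

import Mathlib

open MeasureTheory ProbabilityTheory Set
open scoped ENNReal NNReal

noncomputable section

namespace D2D

/-- The plane in which base stations (BSs) and user equipments (UEs) live. -/
abbrev Plane : Type := EuclideanSpace ℝ (Fin 2)

/-! ### Marked Poisson point processes, enumerated as sequences of random points -/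

/-- The number of points of the configuration `X 0 ω, X 1 ω, …` in the set `B`. -/
def pointCount {Ω E : Type*} (X : ℕ → Ω → E) (B : Set E) (ω : Ω) : ℝ≥0∞ :=
  ∑' i, B.indicator (fun _ => (1 : ℝ≥0∞)) (X i ω)

/-- The random points `X 0, X 1, …` form a Poisson point process with intensity measure `ν`. -/
structure IsPoissonProcess {Ω E : Type*} [MeasurableSpace Ω] [MeasurableSpace E]
    (X : ℕ → Ω → E) (ν : Measure E) (μ : Measure Ω) : Prop where
  measurable : ∀ i, Measurable (X i)
  law_count : ∀ B : Set E, MeasurableSet B → ν B < ∞ → ∀ n : ℕ,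
    μ {ω | pointCount X B ω = n} = poissonMeasure (ν B).toNNReal {n}
  indep_count : ∀ (m : ℕ) (B : Fin m → Set E), (∀ k, MeasurableSet (B k)) →
    Pairwise (Function.onFun Disjoint B) → iIndepFun (fun k => pointCount X (B k)) μ

/-- `X` is a Poisson point process with intensity `ν`, whose points carry i.i.d. marks `M i` of
law `κ`, independent of the points. -/
structure IsMarkedPoisson {Ω E F : Type*} [MeasurableSpace Ω] [MeasurableSpace E]
    [MeasurableSpace F] (X : ℕ → Ω → E) (M : ℕ → Ω → F) (ν : Measure E) (κ : Measure F)
    (μ : Measure Ω) : Prop where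
  poisson : IsPoissonProcess X ν μ
  measurable_mark : ∀ i, Measurable (M i)
  law_mark : ∀ i, μ.map (M i) = κ
  indep_marks : iIndepFun M μ
  indep_points : IndepFun (fun ω i => X i ω) (fun ω i => M i ω) μ

/-! ### The network -/

/-- The constants of the network. Shadowing standard deviations are in dB. -/
structure Params where
  /-- intensity of the base stations (and of the active cellular UEs) -/
  lamB : ℝ
  /-- intensity of the UEs -/
  lamU : ℝ
  /-- path loss constants of cellular and of D2D links -/
  AB : ℝ
  AD : ℝ
  /-- path loss exponents of cellular and of D2D links -/
  alphaB : ℝ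
  alphaD : ℝ
  /-- shadowing standard deviations, in dB, of cellular and of D2D links -/
  sigmaB : ℝ≥0
  sigmaD : ℝ≥0
  /-- transmit power of a BS, receiver sensitivity, transmit power of a D2D transmitter -/
  PB : ℝ
  P0 : ℝ
  Pd : ℝ
  /-- fractional path loss compensation -/
  eps : ℝ
  /-- mode selection threshold -/
  beta : ℝ
  /-- noise power at a D2D receiver -/
  eta : ℝ
  lamB_pos : 0 < lamB
  lamU_pos : 0 < lamU
  AB_pos : 0 < AB
  AD_pos : 0 < AD
  two_lt_alphaB : 2 < alphaB
  two_lt_alphaD : 2 < alphaD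
  PB_pos : 0 < PB
  P0_pos : 0 < P0
  Pd_pos : 0 < Pd
  eps_pos : 0 < eps
  eps_le_one : eps ≤ 1
  beta_pos : 0 < beta
  eta_nonneg : 0 ≤ eta

/-- The constant `κ = -ln 10 / 10` that converts dB. -/
def kappa : ℝ := -Real.log 10 / 10

/-- The lognormal fading coefficient `exp (κ ξ)` of a link whose shadowing is `ξ` dB. -/
def fading (xi : ℝ) : ℝ := Real.exp (kappa * xi)

/-- The equivalent distance `H ^ (-1/α) * R` of a link from the origin to `x` with shadowing `ξ`. -/
def equivDist (alpha : ℝ) (x : Plane) (xi : ℝ) : ℝ := fading xi ^ (-1 / alpha) * ‖x‖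

/-- The index of the largest value of a sequence (the first one if there are several). -/
def strongest (v : ℕ → ℝ) : ℕ := sInf {j | ∀ k, v k ≤ v j}

variable {Ω : Type*} [MeasurableSpace Ω]

/-! ### Mode selection of a typical UE at the origin; `Y` are the BSs, `xi` their shadowings -/

/-- Power received from the `k`-th BS. -/
def rxBS (p : Params) (Y : ℕ → Ω → Plane) (xi : ℕ → Ω → ℝ) (ω : Ω) (k : ℕ) : ℝ :=
  p.AB * p.PB * fading (xi k ω) * ‖Y k ω‖ ^ (-p.alphaB)

/-- The event that the typical UE operates in cellular mode: the power received from the strongest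
BS exceeds the threshold. -/
def cellularMode (p : Params) (Y : ℕ → Ω → Plane) (xi : ℕ → Ω → ℝ) : Set Ω :=
  {ω | p.beta < rxBS p Y xi ω (strongest (rxBS p Y xi ω))}

/-- The equivalent distance from the typical UE to its strongest BS. -/
def servingDist (p : Params) (Y : ℕ → Ω → Plane) (xi : ℕ → Ω → ℝ) (ω : Ω) : ℝ :=
  let k := strongest (rxBS p Y xi ω)
  equivDist p.alphaB (Y k ω) (xi k ω)

/-- The law of the equivalent distance from a cellular UE to its BS. -/
def cellularDistLaw (p : Params) (Y : ℕ → Ω → Plane) (xi : ℕ → Ω → ℝ) (μ : Measure Ω) :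
    Measure ℝ :=
  (cond μ (cellularMode p Y xi)).map (servingDist p Y xi)

/-- The intensity `(1 - q) λ_u` of the D2D UEs, where `q` is the probability of cellular mode. -/
def lamD2D (p : Params) (Y : ℕ → Ω → Plane) (xi : ℕ → Ω → ℝ) (μ : Measure Ω) : ℝ :=
  (1 - μ.real (cellularMode p Y xi)) * p.lamU

/-- The homogeneous intensity measure of density `lam` on the plane. -/
def homogeneous (lam : ℝ) : Measure Plane := ENNReal.ofReal lam • volume

/-- Law of a dB shadowing of standard deviation `σ`. -/
def shadowLaw (σ : ℝ≥0) : Measure ℝ := gaussianReal 0 (σ ^ 2)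

/-- A fair coin. -/
def fairCoin : Measure Bool := (PMF.uniformOfFintype Bool).toMeasure

/-! ### SINR of a typical D2D receiver at the origin

`C` are the active cellular UEs. The mark of a cellular UE is the pair of its shadowing towards
the origin and of the equivalent distance to its own BS. `D` are the (other) D2D UEs. The mark of
a D2D UE is the pair of its shadowing towards the origin and of the coin that decides
whether it is a transmitter (`true`) or a receiver (`false`). -/

/-- Transmit power of a cellular UE at equivalent distance `ρ` from its BS. -/
def txCellular (p : Params) (ρ : ℝ) : ℝ := p.P0 * (ρ ^ p.alphaB / p.AB) ^ p.eps

/-- Power received from the `i`-th cellular UE. -/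
def rxCellular (p : Params) (C : ℕ → Ω → Plane) (M : ℕ → Ω → ℝ × ℝ) (ω : Ω) (i : ℕ) : ℝ :=
  txCellular p (M i ω).2 * p.AB * fading (M i ω).1 * ‖C i ω‖ ^ (-p.alphaB)

/-- Power received from the `j`-th D2D UE; it is zero if that UE is not a transmitter. -/
def rxD2D (p : Params) (D : ℕ → Ω → Plane) (N : ℕ → Ω → ℝ × Bool) (ω : Ω) (j : ℕ) : ℝ :=
  if (N j ω).2 then p.Pd * p.AD * fading (N j ω).1 * ‖D j ω‖ ^ (-p.alphaD) else 0

/-- The serving transmitter: the D2D transmitter that is received with the largest power. -/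
def serving (p : Params) (D : ℕ → Ω → Plane) (N : ℕ → Ω → ℝ × Bool) (ω : Ω) : ℕ :=
  strongest (rxD2D p D N ω)

/-- The equivalent distance of the typical D2D link. -/
def linkDist (p : Params) (D : ℕ → Ω → Plane) (N : ℕ → Ω → ℝ × Bool) (ω : Ω) : ℝ :=
  equivDist p.alphaD (D (serving p D N ω) ω) (N (serving p D N ω) ω).1

/-- Interference from the cellular UEs. -/
def interfC (p : Params) (C : ℕ → Ω → Plane) (M : ℕ → Ω → ℝ × ℝ) (ω : Ω) : ℝ≥0∞ :=
  ∑' i, ENNReal.ofReal (rxCellular p C M ω i)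

/-- Interference from the D2D transmitters other than the serving one. -/
def interfD (p : Params) (D : ℕ → Ω → Plane) (N : ℕ → Ω → ℝ × Bool) (ω : Ω) : ℝ≥0∞ :=
  ∑' j, if j = serving p D N ω then 0 else ENNReal.ofReal (rxD2D p D N ω j)

/-- The signal to interference plus noise ratio of the typical D2D receiver. -/
def sinr (p : Params) (C : ℕ → Ω → Plane) (M : ℕ → Ω → ℝ × ℝ) (D : ℕ → Ω → Plane)
    (N : ℕ → Ω → ℝ × Bool) (ω : Ω) : ℝ≥0∞ :=
  ENNReal.ofReal (rxD2D p D N ω (serving p D N ω)) /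
    (interfC p C M ω + interfD p D N ω + ENNReal.ofReal p.eta)

/-- The derivative of the distribution function of the equivalent distance of the D2D link. -/
def linkDensity (p : Params) (D : ℕ → Ω → Plane) (N : ℕ → Ω → ℝ × Bool) (μ : Measure Ω)
    (r : ℝ) : ℝ :=
  deriv (fun x => μ.real {ω | linkDist p D N ω ≤ x}) r

/-! ### The explicit expressions -/

/-- The fading factor `E[H ^ (2/α)] = exp (2 (κ σ)² / α²)`. -/
def fadingFactor (σ : ℝ≥0) (alpha : ℝ) : ℝ := Real.exp (2 * (kappa * σ) ^ 2 / alpha ^ 2)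

/-- The largest equivalent distance at which a UE is in cellular mode. -/
def tMax (p : Params) : ℝ := (p.beta / (p.AB * p.PB)) ^ (-1 / p.alphaB)

/-- The probability of cellular mode in closed form. -/
def qCellular (p : Params) : ℝ :=
  1 - Real.exp (-(Real.pi * p.lamB * (p.AB * p.PB / p.beta) ^ (2 / p.alphaB) *
    fadingFactor p.sigmaB p.alphaB))

/-- The density on `(0, tMax)` of the equivalent distance from a cellular UE to its BS. -/
def fCellular (p : Params) (ρ : ℝ) : ℝ :=
  2 * Real.pi * p.lamB * fadingFactor p.sigmaB p.alphaB * ρ *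
    Real.exp (-(Real.pi * p.lamB * ρ ^ 2 * fadingFactor p.sigmaB p.alphaB)) / qCellular p

/-- The signal power at equivalent distance `r`. -/
def signal (p : Params) (r : ℝ) : ℝ := p.Pd * p.AD * r ^ (-p.alphaD)

/-- The factor of the conditional characteristic function due to the cellular UEs. -/
def charC (p : Params) (w r : ℝ) : ℂ :=
  Complex.exp (-(2 * Real.pi * p.lamB * fadingFactor p.sigmaB p.alphaB : ℝ) *
    ∫ τ in Ioi (0 : ℝ),
      (1 - ∫ ρ in Ioo 0 (tMax p),
        Complex.exp (-(Complex.I * w *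
          (p.P0 * p.AB ^ (1 - p.eps) * ρ ^ (p.alphaB * p.eps) * τ ^ (-p.alphaB) /
            signal p r : ℝ))) * (fCellular p ρ : ℂ)) * (τ : ℂ))

/-- The factor of the conditional characteristic function due to the D2D transmitters. -/
def charD (p : Params) (w r : ℝ) : ℂ :=
  Complex.exp (-(Real.pi * (1 - qCellular p) * p.lamU * fadingFactor p.sigmaD p.alphaD : ℝ) *
    ∫ L in Ioi r,
      (1 - Complex.exp (-(Complex.I * w * (L ^ (-p.alphaD) / r ^ (-p.alphaD) : ℝ)))) * (L : ℂ))

/-- The conditional characteristic function of `1 / SINR`, at a D2D link of equivalent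
distance `r`. -/
def charInvSinr (p : Params) (w r : ℝ) : ℂ :=
  charC p w r * charD p w r * Complex.exp (-(Complex.I * w * (p.eta / signal p r : ℝ)))

/-- The integrand of the inversion integral. -/
def inversionIntegrand (p : Params) (T r w : ℝ) : ℂ :=
  (Complex.exp (Complex.I * w / T) - 1) / (2 * Real.pi * Complex.I * w) * charInvSinr p w r

end D2D

end

/-! The D2D link is longer than `a` exactly when there is no D2D transmitter within equivalent
distance `a`. On this void event the total received power, which does not depend on which
transmitter is the serving one, is shot noise of the Poisson process of transmitters beyond `a`;
its characteristic function comes from the generating functional. Differentiating in `a` gives the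
conditional characteristic function of the total power given the length `r` of the link, and that
of `1 / SINR` follows since the power of the serving transmitter is a function of `r`.

As a function of `ω`, the latter is bounded by a multiple of `|ω| ^ (-2 / α_D)`, because the
interferers at distance about `r |ω| ^ (1 / α_D)` turn the phase by about one radian. As
`2 / α_D < 1`, this bound does not make it integrable, but it does make its product with the
kernel `(e^{iω / T} - 1) / (2πiω)` integrable. The inversion formula on `(0, 1 / T)` holds for the
law smoothed by a small Gaussian and passes to the limit; integrability makes the limit continuous
in `1 / T`, which leaves no room for an atom at the end point. -/

noncomputable section

namespace D2D

open Filter Topology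

/-! ### Poisson distributions and Poisson counts -/

section Poisson

theorem lintegral_natCast_poissonMeasure (r : ℝ≥0) :
    ∫⁻ n, (n : ℝ≥0∞) ∂(poissonMeasure r) = r := by
  have mul_singleton_succ (n : ℕ) :
      ((n + 1 : ℕ) : ℝ≥0∞) * poissonMeasure r {n + 1} = poissonMeasure r {n} * r := by
    rw [poissonMeasure_singleton, poissonMeasure_singleton, ← ENNReal.ofReal_natCast,
      ← ENNReal.ofReal_mul (by positivity), ← ENNReal.ofReal_coe_nnreal,
      ← ENNReal.ofReal_mul (by positivity), Nat.factorial_succ]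
    congr 1
    push_cast
    field_simp
    ring
  calc ∫⁻ n, (n : ℝ≥0∞) ∂(poissonMeasure r)
      = ∑' n : ℕ, ((n + 1 : ℕ) : ℝ≥0∞) * poissonMeasure r {n + 1} := by
        rw [lintegral_countable', tsum_eq_zero_add' ENNReal.summable, Nat.cast_zero, zero_mul,
          zero_add]
    _ = poissonMeasure r univ * r := by
        simp_rw [mul_singleton_succ, ENNReal.tsum_mul_right]
        rw [← Measure.tsum_indicator_apply_singleton _ _ .univ]
        simp only [indicator_univ]
    _ = r := by rw [measure_univ, one_mul]

theorem integral_pow_poissonMeasure (r : ℝ≥0) (c : ℂ) :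
    ∫ n, c ^ n ∂(poissonMeasure r) = Complex.exp (-(r * (1 - c))) := by
  calc ∫ n, c ^ n ∂(poissonMeasure r)
      = ∑' n : ℕ, (Real.exp (-r) : ℂ) * ((r * c) ^ n / n.factorial) := by
        rw [integral_poissonMeasure r]
        refine tsum_congr fun n => ?_
        rw [Complex.real_smul, mul_pow]
        push_cast
        ring
    _ = (Real.exp (-r) : ℂ) * Complex.exp (r * c) := by
        rw [tsum_mul_left, (NormedSpace.expSeries_div_hasSum_exp (r * c : ℂ)).tsum_eq,
          Complex.exp_eq_exp_ℂ]
    _ = Complex.exp (-(r * (1 - c))) := by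
        rw [Complex.ofReal_exp, ← Complex.exp_add]
        push_cast
        ring_nf

variable {Ω E : Type*} [MeasurableSpace Ω] [MeasurableSpace E] {X : ℕ → Ω → E} {ν : Measure E}
  {μ : Measure Ω}

theorem measurable_pointCount (hX : ∀ i, Measurable (X i)) {B : Set E} (hB : MeasurableSet B) :
    Measurable (pointCount X B) :=
  Measurable.tsum fun i => (measurable_const.indicator hB).comp (hX i)

theorem lintegral_pointCount_eq_sum_map (hX : ∀ i, Measurable (X i)) {B : Set E}
    (hB : MeasurableSet B) :
    ∫⁻ ω, pointCount X B ω ∂μ = Measure.sum (fun i => μ.map (X i)) B := by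
  have hm (i : ℕ) : Measurable fun ω => B.indicator (fun _ => (1 : ℝ≥0∞)) (X i ω) :=
    (measurable_const.indicator hB).comp (hX i)
  rw [Measure.sum_apply _ hB]
  refine (lintegral_tsum fun i => (hm i).aemeasurable).trans (tsum_congr fun i => ?_)
  rw [Measure.map_apply (hX i) hB, ← lintegral_indicator_one (hX i hB)]
  rfl

theorem IsPoissonProcess.iIndepFun_pointCount {ι : Type*} [Finite ι] (h : IsPoissonProcess X ν μ)
    {B : ι → Set E} (hB : ∀ k, MeasurableSet (B k)) (hd : Pairwise (Function.onFun Disjoint B)) :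
    iIndepFun (fun k => pointCount X (B k)) μ := by
  obtain ⟨n, ⟨e⟩⟩ := Finite.exists_equiv_fin ι
  have hind := h.indep_count _ (fun k => B (e.symm k)) (fun k => hB _)
    fun _ _ hij => hd (e.symm.injective.ne hij)
  simpa only [Equiv.symm_apply_apply] using hind.precomp e.injective

variable [IsProbabilityMeasure μ]

theorem IsPoissonProcess.map_pointCount (h : IsPoissonProcess X ν μ) {B : Set E}
    (hB : MeasurableSet B) (hfin : ν B < ∞) :
    μ.map (pointCount X B) = (poissonMeasure (ν B).toNNReal).map (Nat.cast : ℕ → ℝ≥0∞) := by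
  have hN := measurable_pointCount h.measurable hB
  have hcast : Measurable (Nat.cast : ℕ → ℝ≥0∞) := .of_discrete
  have := Measure.isProbabilityMeasure_map (μ := μ) hN.aemeasurable
  have := Measure.isProbabilityMeasure_map (μ := poissonMeasure (ν B).toNNReal) hcast.aemeasurable
  refine (Measure.eq_of_le_of_isProbabilityMeasure (Measure.le_iff.2 fun S hS => ?_)).symm
  rw [Measure.map_apply hcast hS, Measure.map_apply hN hS]
  calc poissonMeasure (ν B).toNNReal (Nat.cast ⁻¹' S)
      = ∑' n : (Nat.cast ⁻¹' S : Set ℕ), μ {ω | pointCount X B ω = (n : ℕ)} := by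
        simp_rw [h.law_count B hB hfin]
        rw [← measure_biUnion (to_countable _)
          (fun _ _ _ _ => disjoint_singleton.2) fun _ _ => measurableSet_singleton _,
          biUnion_of_singleton]
    _ = μ (⋃ n ∈ (Nat.cast ⁻¹' S : Set ℕ), {ω | pointCount X B ω = (n : ℕ)}) :=
        (measure_biUnion (to_countable _)
          (fun _ _ _ _ hne => disjoint_left.2 fun _ h₁ h₂ =>
            hne (Nat.cast_injective (h₁.symm.trans h₂)))
          fun _ _ => hN (measurableSet_singleton _)).symm
    _ ≤ μ (pointCount X B ⁻¹' S) := by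
        refine measure_mono (iUnion₂_subset fun n hn ω hω => ?_)
        rw [mem_preimage, show pointCount X B ω = n from hω]
        exact hn

theorem IsPoissonProcess.lintegral_pointCount (h : IsPoissonProcess X ν μ) {B : Set E}
    (hB : MeasurableSet B) (hfin : ν B < ∞) : ∫⁻ ω, pointCount X B ω ∂μ = ν B := by
  rw [← lintegral_map (f := fun x => x) measurable_id' (measurable_pointCount h.measurable hB),
    h.map_pointCount hB hfin, lintegral_map measurable_id' .of_discrete,
    lintegral_natCast_poissonMeasure, ENNReal.coe_toNNReal hfin.ne]

theorem IsPoissonProcess.ae_pointCount_ne_top (h : IsPoissonProcess X ν μ) {B : Set E}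
    (hB : MeasurableSet B) (hfin : ν B < ∞) : ∀ᵐ ω ∂μ, pointCount X B ω ≠ ∞ := by
  have hN := measurable_pointCount h.measurable hB
  have hint := h.lintegral_pointCount hB hfin
  filter_upwards [ae_lt_top hN (hint ▸ hfin.ne)] with ω hω using hω.ne

theorem IsPoissonProcess.integral_pow_pointCount (h : IsPoissonProcess X ν μ) {B : Set E}
    (hB : MeasurableSet B) (hfin : ν B < ∞) (c : ℂ) :
    ∫ ω, c ^ ⌊(pointCount X B ω).toReal⌋₊ ∂μ = Complex.exp (-(ν.real B * (1 - c))) := by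
  have hf : Measurable fun x : ℝ≥0∞ => c ^ ⌊x.toReal⌋₊ :=
    (Measurable.of_discrete (f := fun n : ℕ => c ^ n)).comp
      (Nat.measurable_floor.comp ENNReal.measurable_toReal)
  rw [← integral_map (f := fun x : ℝ≥0∞ => c ^ ⌊x.toReal⌋₊)
    (measurable_pointCount h.measurable hB).aemeasurable hf.aestronglyMeasurable,
    h.map_pointCount hB hfin,
    integral_map (Measurable.of_discrete).aemeasurable hf.aestronglyMeasurable]
  simp_rw [ENNReal.toReal_natCast, Nat.floor_natCast]
  exact integral_pow_poissonMeasure _ c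

/-- Campbell's formula. -/
theorem IsPoissonProcess.sum_map [SigmaFinite ν] (h : IsPoissonProcess X ν μ) :
    Measure.sum (fun i => μ.map (X i)) = ν := by
  refine (Measure.ext_iff_of_iUnion_eq_univ (iUnion_spanningSets ν)).2 fun n => ?_
  ext B hB
  have hfin : ν (B ∩ spanningSets ν n) < ∞ :=
    (measure_mono inter_subset_right).trans_lt (measure_spanningSets_lt_top ν n)
  have hBn := hB.inter (measurableSet_spanningSets ν n)
  rw [Measure.restrict_apply hB, Measure.restrict_apply hB,
    ← lintegral_pointCount_eq_sum_map h.measurable hBn, h.lintegral_pointCount hBn hfin]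

end Poisson

/-! ### Probability generating functionals -/

section GeneratingFunctional

theorem norm_prod_le_one {ι : Type*} (s : Finset ι) {f : ι → ℂ} (h : ∀ i, ‖f i‖ ≤ 1) :
    ‖∏ i ∈ s, f i‖ ≤ 1 := by
  rw [norm_prod]
  exact Finset.prod_le_one (fun i _ => norm_nonneg _) fun i _ => h i

theorem norm_prod_range_sub_prod_range_le {f g : ℕ → ℂ} (hf : ∀ i, ‖f i‖ ≤ 1)
    (hg : ∀ i, ‖g i‖ ≤ 1) (n : ℕ) :
    ‖∏ i ∈ Finset.range n, f i - ∏ i ∈ Finset.range n, g i‖ ≤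
      ∑ i ∈ Finset.range n, ‖f i - g i‖ := by
  induction n with
  | zero => simp
  | succ n ih =>
    rw [Finset.prod_range_succ, Finset.prod_range_succ, Finset.sum_range_succ]
    calc ‖(∏ i ∈ Finset.range n, f i) * f n - (∏ i ∈ Finset.range n, g i) * g n‖
        = ‖(∏ i ∈ Finset.range n, f i - ∏ i ∈ Finset.range n, g i) * f n +
          (∏ i ∈ Finset.range n, g i) * (f n - g n)‖ := by ring_nf
      _ ≤ ‖∏ i ∈ Finset.range n, f i - ∏ i ∈ Finset.range n, g i‖ * ‖f n‖ +
          ‖∏ i ∈ Finset.range n, g i‖ * ‖f n - g n‖ := by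
        rw [← norm_mul, ← norm_mul]
        exact norm_add_le _ _
      _ ≤ ∑ i ∈ Finset.range n, ‖f i - g i‖ + ‖f n - g n‖ :=
        add_le_add ((mul_le_of_le_one_right (norm_nonneg _) (hf n)).trans ih)
          (mul_le_of_le_one_left (norm_nonneg _) (norm_prod_le_one _ hg))

theorem tsum_indicator_one_eq_card_filter {ι E : Type*} {x : ι → E} {B : Set E} {S : Finset ι}
    [DecidablePred fun i => x i ∈ B] (hS : ∀ i, x i ∈ B → i ∈ S) :
    ∑' i, B.indicator (fun _ => (1 : ℝ≥0∞)) (x i) = (S.filter fun i => x i ∈ B).card := by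
  rw [tsum_eq_sum (s := S) fun i hi => indicator_of_notMem (fun h => hi (hS i h)) _]
  simp [indicator_apply, Finset.sum_boole]

theorem eventually_prod_one_sub_eq_prod_pow {E : Type*} [MeasurableSpace E] (u : SimpleFunc E ℂ)
    {x : ℕ → E} (hfin : ∑' i, (u ⁻¹' {0}ᶜ).indicator (fun _ => (1 : ℝ≥0∞)) (x i) ≠ ∞) :
    ∀ᶠ n in atTop, ∏ i ∈ Finset.range n, (1 - u (x i)) = ∏ c ∈ u.range.erase 0,
      (1 - c) ^ ⌊(∑' i, (u ⁻¹' {c}).indicator (fun _ => (1 : ℝ≥0∞)) (x i)).toReal⌋₊ := by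
  classical
  have hS : {i | u (x i) ≠ 0}.Finite :=
    (ENNReal.finite_const_le_of_tsum_ne_top hfin one_ne_zero).subset fun i hi =>
      (indicator_of_mem (s := u ⁻¹' {0}ᶜ) hi fun _ => (1 : ℝ≥0∞)).ge
  have hmem (i : ℕ) : i ∈ hS.toFinset ↔ u (x i) ≠ 0 := hS.mem_toFinset
  obtain ⟨n₀, hn₀⟩ := hS.toFinset.exists_nat_subset_range
  filter_upwards [eventually_ge_atTop n₀] with n hn
  calc ∏ i ∈ Finset.range n, (1 - u (x i)) = ∏ i ∈ hS.toFinset, (1 - u (x i)) := by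
        refine (Finset.prod_subset (hn₀.trans (Finset.range_mono hn)) fun i _ hi => ?_).symm
        rw [not_not.1 (mt (hmem i).2 hi), sub_zero]
    _ = ∏ c ∈ u.range.erase 0, ∏ i ∈ hS.toFinset with u (x i) = c, (1 - u (x i)) :=
        (Finset.prod_fiberwise_of_maps_to (fun i hi =>
          Finset.mem_erase.2 ⟨(hmem i).1 hi, u.mem_range_self _⟩) _).symm
    _ = _ := by
        refine Finset.prod_congr rfl fun c hc => ?_
        rw [tsum_indicator_one_eq_card_filter (S := hS.toFinset) fun i (hi : u (x i) = c) =>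
          (hmem i).2 (hi ▸ Finset.ne_of_mem_erase hc), ENNReal.toReal_natCast, Nat.floor_natCast]
        exact Finset.prod_eq_pow_card fun i hi => by rw [(Finset.mem_filter.1 hi).2]

variable {Ω E F : Type*} [MeasurableSpace Ω] [MeasurableSpace E] [MeasurableSpace F]
  {X : ℕ → Ω → E} {M : ℕ → Ω → F} {ν : Measure E} {κ : Measure F} {μ : Measure Ω}

/-- The points `Z i` form a Poisson point process of intensity `π`, as seen through Campbell's
formula and its probability generating functional. Unlike independence of the counts, these two
properties pass at once to independent markings and to images. -/
structure HasPoissonFunctional (Z : ℕ → Ω → E) (π : Measure E) (μ : Measure Ω) : Prop where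
  measurable : ∀ i, Measurable (Z i)
  sum_map : Measure.sum (fun i => μ.map (Z i)) = π
  tendsto_integral_prod : ∀ u : E → ℂ, Measurable u → (∀ z, ‖1 - u z‖ ≤ 1) → Integrable u π →
    Tendsto (fun n => ∫ ω, ∏ i ∈ Finset.range n, (1 - u (Z i ω)) ∂μ) atTop
      (𝓝 (Complex.exp (-∫ z, u z ∂π)))

theorem HasPoissonFunctional.map {Z : ℕ → Ω → E} {π : Measure E}
    (h : HasPoissonFunctional Z π μ) {φ : E → F} (hφ : Measurable φ) :
    HasPoissonFunctional (fun i ω => φ (Z i ω)) (π.map φ) μ where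
  measurable i := hφ.comp (h.measurable i)
  sum_map := by
    rw [← h.sum_map, Measure.map_sum hφ.aemeasurable]
    simp_rw [Measure.map_map hφ (h.measurable _)]
    rfl
  tendsto_integral_prod u hum hu hint := by
    rw [integral_map hφ.aemeasurable hum.aestronglyMeasurable]
    exact h.tendsto_integral_prod (u ∘ φ) (hum.comp hφ) (fun z => hu _)
      ((integrable_map_measure hum.aestronglyMeasurable hφ.aemeasurable).1 hint)

theorem IsMarkedPoisson.integral_prod_mark (h : IsMarkedPoisson X M ν κ μ) {f : ℕ → F → ℂ}
    (hf : ∀ i, Measurable (f i)) (n : ℕ) :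
    ∫ ω, ∏ i ∈ Finset.range n, f i (M i ω) ∂μ = ∏ i ∈ Finset.range n, ∫ m, f i m ∂κ := by
  have hind : iIndepFun (fun i : Fin n => M i) μ := h.indep_marks.precomp Fin.val_injective
  simp_rw [Finset.prod_range]
  rw [hind.integral_fun_prod_comp (X := fun i : Fin n => M i) (f := fun i m => f i m)
    (fun i => (h.measurable_mark i).aemeasurable) fun i => (hf i).aestronglyMeasurable]
  refine Finset.prod_congr rfl fun i _ => ?_
  rw [← h.law_mark i, integral_map (h.measurable_mark i).aemeasurable (hf i).aestronglyMeasurable]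

variable [IsProbabilityMeasure μ]

theorem IsPoissonProcess.integral_prod_pow_pointCount (h : IsPoissonProcess X ν μ) {u : E → ℂ}
    (hu : Measurable u) (R : Finset ℂ) (hfin : ∀ c ∈ R, ν (u ⁻¹' {c}) < ∞) :
    ∫ ω, ∏ c ∈ R, (1 - c) ^ ⌊(pointCount X (u ⁻¹' {c}) ω).toReal⌋₊ ∂μ =
      Complex.exp (-∑ c ∈ R, ν.real (u ⁻¹' {c}) * c) := by
  have hB (c : R) : MeasurableSet (u ⁻¹' {(c : ℂ)}) := hu (measurableSet_singleton _)
  have hdisj : Pairwise (Function.onFun Disjoint fun c : R => u ⁻¹' {(c : ℂ)}) :=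
    fun c d hcd => (disjoint_singleton.2 (Subtype.val_injective.ne hcd)).preimage u
  have hind := h.iIndepFun_pointCount hB hdisj
  simp_rw [← Finset.prod_coe_sort R]
  rw [hind.integral_fun_prod_comp (X := fun c : R => pointCount X (u ⁻¹' {(c : ℂ)}))
    (f := fun c x => (1 - (c : ℂ)) ^ ⌊x.toReal⌋₊)
    (fun c => (measurable_pointCount h.measurable (hB c)).aemeasurable)
    fun c => ((Measurable.of_discrete (f := fun n : ℕ => (1 - (c : ℂ)) ^ n)).comp
      (Nat.measurable_floor.comp ENNReal.measurable_toReal)).aestronglyMeasurable]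
  simp_rw [fun c : R => h.integral_pow_pointCount (hB c) (hfin c c.2), sub_sub_cancel]
  rw [Finset.prod_coe_sort R fun c : ℂ => Complex.exp (-(ν.real (u ⁻¹' {c}) * c)),
    ← Complex.exp_sum, Finset.sum_neg_distrib]

theorem IsPoissonProcess.tendsto_integral_prod_simpleFunc (h : IsPoissonProcess X ν μ)
    {u : SimpleFunc E ℂ} (hu : ∀ x, ‖1 - u x‖ ≤ 1) (hint : Integrable u ν) :
    Tendsto (fun n => ∫ ω, ∏ i ∈ Finset.range n, (1 - u (X i ω)) ∂μ) atTop
      (𝓝 (Complex.exp (-∫ x, u x ∂ν))) := by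
  have integral_eq_sum : ∫ x, u x ∂ν = ∑ c ∈ u.range.erase 0, ν.real (u ⁻¹' {c}) * c := by
    rw [u.integral_eq_sum hint, Finset.sum_erase _ (mul_zero _)]
    simp_rw [Complex.real_smul]
  rw [integral_eq_sum, ← h.integral_prod_pow_pointCount u.measurable _ fun c hc =>
    SimpleFunc.measure_preimage_lt_top_of_integrable u hint (Finset.ne_of_mem_erase hc)]
  refine tendsto_integral_of_dominated_convergence (fun _ => 1) (fun n => ?_)
    (integrable_const _) (fun n => .of_forall fun ω => norm_prod_le_one _ fun i => hu _) ?_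
  · exact (Finset.measurable_fun_prod _ fun i _ =>
      (u.measurable.comp (h.measurable i)).const_sub 1).aestronglyMeasurable
  · have hfin : ν (u ⁻¹' {0}ᶜ) < ∞ := SimpleFunc.integrable_iff_finMeasSupp.1 hint
    filter_upwards [h.ae_pointCount_ne_top (u.measurableSet_preimage _) hfin] with ω hω
    exact tendsto_const_nhds.congr' ((eventually_prod_one_sub_eq_prod_pow u hω).mono
      fun n hn => hn.symm)

theorem enorm_integral_prod_sub_integral_prod_le (hX : ∀ i, Measurable (X i)) {f g : E → ℂ}
    (hfm : Measurable f) (hgm : Measurable g) (hf : ∀ x, ‖f x‖ ≤ 1) (hg : ∀ x, ‖g x‖ ≤ 1) (n : ℕ) :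
    ‖∫ ω, ∏ i ∈ Finset.range n, f (X i ω) ∂μ - ∫ ω, ∏ i ∈ Finset.range n, g (X i ω) ∂μ‖ₑ ≤
      ∫⁻ x, ‖f x - g x‖ₑ ∂(Measure.sum fun i => μ.map (X i)) := by
  have integrable_prod {v : E → ℂ} (hvm : Measurable v) (hv : ∀ x, ‖v x‖ ≤ 1) :
      Integrable (fun ω => ∏ i ∈ Finset.range n, v (X i ω)) μ :=
    .of_bound (Finset.measurable_fun_prod _ fun i _ => hvm.comp (hX i)).aestronglyMeasurable 1
      (.of_forall fun ω => norm_prod_le_one _ fun i => hv _)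
  rw [← integral_sub (integrable_prod hfm hf) (integrable_prod hgm hg)]
  calc ‖∫ ω, (∏ i ∈ Finset.range n, f (X i ω) - ∏ i ∈ Finset.range n, g (X i ω)) ∂μ‖ₑ
      ≤ ∫⁻ ω, ∑ i ∈ Finset.range n, ‖f (X i ω) - g (X i ω)‖ₑ ∂μ := by
        refine (enorm_integral_le_lintegral_enorm _).trans (lintegral_mono fun ω => ?_)
        simp_rw [← ofReal_norm]
        rw [← ENNReal.ofReal_sum_of_nonneg fun i _ => norm_nonneg _]
        exact ENNReal.ofReal_le_ofReal (norm_prod_range_sub_prod_range_le (fun i => hf (X i ω))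
          (fun i => hg (X i ω)) n)
    _ = ∑ i ∈ Finset.range n, ∫⁻ x, ‖f x - g x‖ₑ ∂(μ.map (X i)) := by
        rw [lintegral_finsetSum' _ fun i _ => by fun_prop]
        exact Finset.sum_congr rfl fun i _ => (lintegral_map (hfm.sub hgm).enorm (hX i)).symm
    _ ≤ ∫⁻ x, ‖f x - g x‖ₑ ∂(Measure.sum fun i => μ.map (X i)) := by
        rw [lintegral_sum_measure]
        exact ENNReal.sum_le_tsum _

theorem exists_simpleFunc_approx {u : E → ℂ} (hum : Measurable u) (hu : ∀ x, ‖1 - u x‖ ≤ 1)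
    (hint : Integrable u ν) : ∃ s : ℕ → SimpleFunc E ℂ, (∀ m x, ‖1 - s m x‖ ≤ 1) ∧
      (∀ m, Integrable (s m) ν) ∧ Tendsto (fun m => ∫⁻ x, ‖s m x - u x‖ₑ ∂ν) atTop (𝓝 0) := by
  have mem_ball (z : ℂ) : z ∈ Metric.closedBall (1 : ℂ) 1 ↔ ‖1 - z‖ ≤ 1 := by
    rw [mem_closedBall_iff_norm, norm_sub_rev]
  have h0 : (0 : ℂ) ∈ Metric.closedBall (1 : ℂ) 1 := (mem_ball 0).2 (by simp)
  refine ⟨SimpleFunc.approxOn u hum _ 0 h0,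
    fun m x => (mem_ball _).1 (SimpleFunc.approxOn_mem hum h0 m x),
    fun m => SimpleFunc.integrable_approxOn hum hint h0 (integrable_zero _ _ _) m,
    SimpleFunc.tendsto_approxOn_L1_enorm hum h0
      (.of_forall fun x => subset_closure ((mem_ball _).2 (hu x))) ?_⟩
  simpa only [sub_zero] using hint.2

theorem IsPoissonProcess.hasPoissonFunctional [SigmaFinite ν] (h : IsPoissonProcess X ν μ) :
    HasPoissonFunctional X ν μ where
  measurable := h.measurable
  sum_map := h.sum_map
  tendsto_integral_prod u hum hu hint := by
    obtain ⟨s, hs, hsint, hL1⟩ := exists_simpleFunc_approx hum hu hint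
    have hunif : TendstoUniformly (fun m n => ∫ ω, ∏ i ∈ Finset.range n, (1 - s m (X i ω)) ∂μ)
        (fun n => ∫ ω, ∏ i ∈ Finset.range n, (1 - u (X i ω)) ∂μ) atTop := by
      rw [EMetric.tendstoUniformly_iff]
      intro ε hε
      filter_upwards [hL1.eventually (gt_mem_nhds hε)] with m hm n
      rw [edist_eq_enorm_sub]
      refine (enorm_integral_prod_sub_integral_prod_le h.measurable (hum.const_sub 1)
        ((s m).measurable.const_sub 1) hu (hs m) n).trans_lt ?_
      simpa only [sub_sub_sub_cancel_left, h.sum_map] using hm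
    refine hunif.tendsto_of_eventually_tendsto
      (.of_forall fun m => h.tendsto_integral_prod_simpleFunc (hs m) (hsint m)) ?_
    exact (Complex.continuous_exp.tendsto _).comp
      (tendsto_integral_of_L1 _ hint.1 (.of_forall hsint) hL1).neg

theorem IsMarkedPoisson.map_prodMk (h : IsMarkedPoisson X M ν κ μ) (i : ℕ) :
    μ.map (fun ω => (X i ω, M i ω)) = (μ.map (X i)).prod κ := by
  have hind : IndepFun (X i) (M i) μ :=
    h.indep_points.comp (measurable_pi_apply i) (measurable_pi_apply i)
  rw [(indepFun_iff_map_prod_eq_prod_map_map (h.poisson.measurable i).aemeasurable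
    (h.measurable_mark i).aemeasurable).1 hind, h.law_mark i]

variable [IsProbabilityMeasure κ]

theorem IsMarkedPoisson.integral_prod_eq (h : IsMarkedPoisson X M ν κ μ) {g : E × F → ℂ}
    (hgm : Measurable g) (hg : ∀ x, ‖g x‖ ≤ 1) (n : ℕ) :
    ∫ ω, ∏ i ∈ Finset.range n, g (X i ω, M i ω) ∂μ =
      ∫ ω, ∏ i ∈ Finset.range n, (∫ m, g (X i ω, m) ∂κ) ∂μ := by
  let G : (ℕ → E) × (ℕ → F) → ℂ := fun p => ∏ i ∈ Finset.range n, g (p.1 i, p.2 i)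
  have hX : Measurable fun ω i => X i ω := measurable_pi_lambda _ h.poisson.measurable
  have hM : Measurable fun ω i => M i ω := measurable_pi_lambda _ h.measurable_mark
  have hG : Measurable G := Finset.measurable_fun_prod _ fun i _ => hgm.comp (by fun_prop)
  have hg_mean : Measurable fun y => ∫ m, g (y, m) ∂κ :=
    hgm.stronglyMeasurable.integral_prod_right'.measurable
  have := Measure.isProbabilityMeasure_map (μ := μ) hX.aemeasurable
  have := Measure.isProbabilityMeasure_map (μ := μ) hM.aemeasurable
  calc ∫ ω, ∏ i ∈ Finset.range n, g (X i ω, M i ω) ∂μ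
      = ∫ p, G p ∂(μ.map fun ω => ((fun i => X i ω), fun i => M i ω)) := by
        rw [integral_map (hX.prodMk hM).aemeasurable hG.aestronglyMeasurable]
    _ = ∫ x, ∫ m, G (x, m) ∂(μ.map fun ω i => M i ω) ∂(μ.map fun ω i => X i ω) := by
        rw [(indepFun_iff_map_prod_eq_prod_map_map hX.aemeasurable hM.aemeasurable).1
          h.indep_points, integral_prod]
        exact .of_bound hG.aestronglyMeasurable 1
          (.of_forall fun p => norm_prod_le_one _ fun i => hg _)
    _ = ∫ x, ∏ i ∈ Finset.range n, (∫ m, g (x i, m) ∂κ) ∂(μ.map fun ω i => X i ω) := by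
        refine integral_congr_ae (.of_forall fun x => ?_)
        beta_reduce
        rw [integral_map (f := fun m => G (x, m)) hM.aemeasurable
          (hG.comp measurable_prodMk_left).aestronglyMeasurable]
        exact h.integral_prod_mark (fun i => hgm.comp measurable_prodMk_left) n
    _ = _ := by
        have hprod : Measurable fun x : ℕ → E => ∏ i ∈ Finset.range n, ∫ m, g (x i, m) ∂κ :=
          Finset.measurable_fun_prod _ fun i _ => hg_mean.comp (measurable_pi_apply i)
        rw [integral_map hX.aemeasurable hprod.aestronglyMeasurable]

/-- The marking theorem for Poisson processes. -/
theorem IsMarkedPoisson.hasPoissonFunctional [SigmaFinite ν] (h : IsMarkedPoisson X M ν κ μ) :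
    HasPoissonFunctional (fun i ω => (X i ω, M i ω)) (ν.prod κ) μ where
  measurable i := (h.poisson.measurable i).prodMk (h.measurable_mark i)
  sum_map := by
    simp_rw [h.map_prodMk]
    rw [← h.poisson.sum_map, Measure.prod_sum_left]
  tendsto_integral_prod u hum hu hint := by
    have integral_one_sub (x : E) : ∫ m, (1 - u (x, m)) ∂κ = 1 - ∫ m, u (x, m) ∂κ := by
      have hone_sub : Integrable (fun m => 1 - u (x, m)) κ :=
        .of_bound ((hum.comp measurable_prodMk_left).const_sub 1).aestronglyMeasurable 1
          (.of_forall fun m => hu _)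
      have hux : Integrable (fun m => u (x, m)) κ :=
        ((integrable_const 1).sub hone_sub).congr (.of_forall fun m => sub_sub_cancel _ _)
      rw [integral_sub (integrable_const _) hux, integral_const, probReal_univ, one_smul]
    simp_rw [h.integral_prod_eq (hum.const_sub 1) hu]
    rw [integral_prod _ hint]
    simp_rw [integral_one_sub]
    refine h.poisson.hasPoissonFunctional.tendsto_integral_prod _
      hum.stronglyMeasurable.integral_prod_right'.measurable (fun x => ?_) hint.integral_prod_left
    rw [← integral_one_sub]
    refine (norm_integral_le_of_norm_le_const (.of_forall fun m => hu (x, m))).trans ?_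
    rw [probReal_univ, mul_one]

end GeneratingFunctional

/-! ### Shot noise -/

section ShotNoise

variable {Ω E : Type*} [MeasurableSpace Ω] [MeasurableSpace E] {Z : ℕ → Ω → E} {π : Measure E}
  {μ : Measure Ω} {f : E → ℝ}

theorem norm_exp_neg_I_mul_mul (w x : ℝ) : ‖Complex.exp (-(Complex.I * w * x))‖ = 1 := by
  rw [show -(Complex.I * w * x) = ((-(w * x) : ℝ) : ℂ) * Complex.I by push_cast; ring,
    Complex.norm_exp_ofReal_mul_I]

theorem enorm_one_sub_exp_le (w : ℝ) {x : ℝ} (hx : 0 ≤ x) :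
    ‖1 - Complex.exp (-(Complex.I * w * x))‖ₑ ≤
      ENNReal.ofReal (2 + |w|) * min 1 (ENNReal.ofReal x) := by
  have le_two : ‖1 - Complex.exp (-(Complex.I * w * x))‖ ≤ 2 := by
    refine (norm_sub_le _ _).trans ?_
    rw [norm_exp_neg_I_mul_mul, norm_one]
    norm_num
  have le_mul : ‖1 - Complex.exp (-(Complex.I * w * x))‖ ≤ |w| * x := by
    have := Real.norm_exp_I_mul_ofReal_sub_one_le (x := -(w * x))
    rw [norm_sub_rev]
    rwa [norm_neg, norm_mul, Real.norm_eq_abs, Real.norm_of_nonneg hx, Complex.ofReal_neg,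
      Complex.ofReal_mul, mul_neg, ← mul_assoc] at this
  rw [← ENNReal.ofReal_one, ← ENNReal.ofReal_min, ← ENNReal.ofReal_mul (by positivity),
    ← ofReal_norm]
  refine ENNReal.ofReal_le_ofReal ?_
  rcases le_total 1 x with h | h
  · rw [min_eq_left h]
    linarith [abs_nonneg w]
  · rw [min_eq_right h]
    linarith

theorem integrable_one_sub_exp (hf : Measurable f) (hf0 : ∀ᵐ z ∂π, 0 ≤ f z)
    (hint : ∫⁻ z, min 1 (ENNReal.ofReal (f z)) ∂π ≠ ∞) (w : ℝ) :
    Integrable (fun z => 1 - Complex.exp (-(Complex.I * w * (f z : ℝ)))) π := by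
  refine ⟨Measurable.aestronglyMeasurable (by fun_prop), ?_⟩
  refine (lintegral_mono_ae (hf0.mono fun z hz => enorm_one_sub_exp_le w hz)).trans_lt ?_
  rw [lintegral_const_mul _ (measurable_const.min hf.ennreal_ofReal)]
  exact ENNReal.mul_lt_top ENNReal.ofReal_lt_top hint.lt_top

theorem tsum_ne_top_of_tsum_min_one {v : ℕ → ℝ≥0∞} (hv : ∀ i, v i ≠ ∞)
    (h : ∑' i, min 1 (v i) ≠ ∞) : ∑' i, v i ≠ ∞ := by
  classical
  have hS : {i | 1 ≤ min 1 (v i)}.Finite := ENNReal.finite_const_le_of_tsum_ne_top h one_ne_zero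
  have hle (i : ℕ) : v i ≤ min 1 (v i) + if i ∈ hS.toFinset then v i else 0 := by
    by_cases hi : i ∈ hS.toFinset
    · rw [if_pos hi]
      exact le_add_self
    · have : v i < 1 := by simpa using hi
      rw [min_eq_right this.le]
      exact le_self_add
  refine ne_top_of_le_ne_top ?_ (ENNReal.tsum_le_tsum hle)
  rw [ENNReal.tsum_add, tsum_eq_sum (s := hS.toFinset) fun i hi => if_neg hi]
  refine ENNReal.add_ne_top.2 ⟨h, ENNReal.sum_ne_top.2 fun i hi => ?_⟩
  rw [if_pos hi]
  exact hv i

theorem tendsto_prod_exp_tsum {v : ℕ → ℝ} (hv : ∀ i, 0 ≤ v i)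
    (hsum : ∑' i, ENNReal.ofReal (v i) ≠ ∞) (w : ℝ) :
    Tendsto (fun n => ∏ i ∈ Finset.range n, Complex.exp (-(Complex.I * w * v i))) atTop
      (𝓝 (Complex.exp (-(Complex.I * w * (∑' i, ENNReal.ofReal (v i)).toReal)))) := by
  have hs := (ENNReal.hasSum_toReal hsum).tendsto_sum_nat
  rw [← ENNReal.tsum_toReal_eq fun i => ENNReal.ofReal_ne_top] at hs
  simp_rw [ENNReal.toReal_ofReal (hv _)] at hs
  have prod_eq (n : ℕ) : ∏ i ∈ Finset.range n, Complex.exp (-(Complex.I * w * v i)) =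
      Complex.exp (-(Complex.I * w * ((∑ i ∈ Finset.range n, v i : ℝ) : ℂ))) := by
    rw [Complex.ofReal_sum, Finset.mul_sum, ← Finset.sum_neg_distrib, Complex.exp_sum]
  have hcont : Continuous fun x : ℝ => Complex.exp (-(Complex.I * w * x)) := by fun_prop
  simp_rw [prod_eq]
  exact (hcont.tendsto _).comp hs

/-- The shot noise of the random points `Z i` with response `f`: the sum of `f` over the points. -/
def shotNoise (f : E → ℝ) (Z : ℕ → Ω → E) (ω : Ω) : ℝ≥0∞ := ∑' i, ENNReal.ofReal (f (Z i ω))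

@[fun_prop]
theorem measurable_shotNoise (hZ : ∀ i, Measurable (Z i)) (hf : Measurable f) :
    Measurable (shotNoise f Z) :=
  Measurable.tsum fun i => (hf.comp (hZ i)).ennreal_ofReal

namespace HasPoissonFunctional

theorem ae_forall (h : HasPoissonFunctional Z π μ) {P : E → Prop} (hP : ∀ᵐ z ∂π, P z) :
    ∀ᵐ ω ∂μ, ∀ i, P (Z i ω) := by
  rw [← h.sum_map, Measure.ae_sum_iff] at hP
  exact ae_all_iff.2 fun i => ae_of_ae_map (h.measurable i).aemeasurable (hP i)

theorem lintegral_tsum (h : HasPoissonFunctional Z π μ) {g : E → ℝ≥0∞} (hg : Measurable g) :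
    ∫⁻ ω, ∑' i, g (Z i ω) ∂μ = ∫⁻ z, g z ∂π := by
  rw [MeasureTheory.lintegral_tsum (f := fun i ω => g (Z i ω))
    fun i => (hg.comp (h.measurable i)).aemeasurable, ← h.sum_map, lintegral_sum_measure]
  simp_rw [lintegral_map hg (h.measurable _)]

theorem ae_shotNoise_ne_top (h : HasPoissonFunctional Z π μ) (hf : Measurable f)
    (hint : ∫⁻ z, min 1 (ENNReal.ofReal (f z)) ∂π ≠ ∞) : ∀ᵐ ω ∂μ, shotNoise f Z ω ≠ ∞ := by
  have hm : Measurable fun z => min 1 (ENNReal.ofReal (f z)) :=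
    measurable_const.min hf.ennreal_ofReal
  rw [← h.lintegral_tsum hm] at hint
  filter_upwards [ae_lt_top (Measurable.tsum fun i => hm.comp (h.measurable i)) hint] with ω hω
  exact tsum_ne_top_of_tsum_min_one (fun _ => ENNReal.ofReal_ne_top) hω.ne

theorem measurableSet_void (h : HasPoissonFunctional Z π μ) {A : Set E} (hA : MeasurableSet A) :
    MeasurableSet {ω | ∀ i, Z i ω ∉ A} := by
  rw [ofPred_forall]
  exact MeasurableSet.iInter fun i => h.measurable i hA.compl

variable [IsProbabilityMeasure μ]

theorem tendsto_integral_prod_indicator (h : HasPoissonFunctional Z π μ) {A : Set E}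
    (hA : MeasurableSet A) (hf : Measurable f) (hf0 : ∀ᵐ z ∂π, 0 ≤ f z)
    (hint : ∫⁻ z, min 1 (ENNReal.ofReal (f z)) ∂π ≠ ∞) (w : ℝ) :
    Tendsto (fun n => ∫ ω, ∏ i ∈ Finset.range n,
        Aᶜ.indicator (fun z => Complex.exp (-(Complex.I * w * f z))) (Z i ω) ∂μ) atTop
      (𝓝 (∫ ω in {ω | ∀ i, Z i ω ∉ A},
        Complex.exp (-(Complex.I * w * (shotNoise f Z ω).toReal)) ∂μ)) := by
  have hgm : Measurable (Aᶜ.indicator fun z => Complex.exp (-(Complex.I * w * f z))) :=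
    Measurable.indicator (by fun_prop) hA.compl
  rw [← integral_indicator (h.measurableSet_void hA)]
  refine tendsto_integral_of_dominated_convergence (fun _ => 1) (fun n => ?_)
    (integrable_const _) (fun n => .of_forall fun ω => norm_prod_le_one _ fun i =>
      (norm_indicator_le_norm_self _ _).trans (norm_exp_neg_I_mul_mul _ _).le) ?_
  · exact (Finset.measurable_fun_prod _ fun i _ => hgm.comp (h.measurable i)).aestronglyMeasurable
  filter_upwards [h.ae_shotNoise_ne_top hf hint, h.ae_forall hf0] with ω hω hω0
  by_cases hvoid : ∀ i, Z i ω ∉ A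
  · rw [indicator_of_mem (by exact hvoid)]
    refine (tendsto_prod_exp_tsum hω0 hω w).congr fun n => ?_
    refine Finset.prod_congr rfl fun i _ => ?_
    rw [indicator_of_mem (by exact hvoid i)]
  · rw [indicator_of_notMem (by exact hvoid)]
    obtain ⟨i, hi⟩ := not_forall_not.1 hvoid
    refine tendsto_const_nhds.congr' ?_
    filter_upwards [eventually_gt_atTop i] with n hn
    exact (Finset.prod_eq_zero (Finset.mem_range.2 hn)
      (indicator_of_notMem (s := Aᶜ) (not_not.2 hi) _)).symm

theorem setIntegral_void_exp (h : HasPoissonFunctional Z π μ) {A : Set E} (hA : MeasurableSet A)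
    (hAfin : π A ≠ ∞) (hf : Measurable f) (hf0 : ∀ᵐ z ∂π, 0 ≤ f z)
    (hint : ∫⁻ z, min 1 (ENNReal.ofReal (f z)) ∂π ≠ ∞) (w : ℝ) :
    ∫ ω in {ω | ∀ i, Z i ω ∉ A}, Complex.exp (-(Complex.I * w * (shotNoise f Z ω).toReal)) ∂μ =
      Complex.exp (-(π.real A + ∫ z in Aᶜ, (1 - Complex.exp (-(Complex.I * w * f z))) ∂π)) := by
  let u (z : E) : ℂ :=
    A.indicator 1 z + Aᶜ.indicator (fun z => 1 - Complex.exp (-(Complex.I * w * f z))) z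
  have one_sub_u (z : E) :
      1 - u z = Aᶜ.indicator (fun z => Complex.exp (-(Complex.I * w * f z))) z := by
    by_cases hz : z ∈ A <;> simp [u, hz]
  have hu1 : Integrable (A.indicator (1 : E → ℂ)) π :=
    (integrable_indicator_iff hA).2 (integrableOn_const hAfin)
  have hu2 := (integrable_one_sub_exp hf hf0 hint w).indicator hA.compl
  have integral_u : ∫ z, u z ∂π =
      π.real A + ∫ z in Aᶜ, (1 - Complex.exp (-(Complex.I * w * f z))) ∂π := by
    rw [integral_add hu1 hu2, integral_indicator hA.compl, integral_indicator hA]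
    simp
  rw [← integral_u]
  refine tendsto_nhds_unique (h.tendsto_integral_prod_indicator hA hf hf0 hint w) ?_
  simp_rw [← one_sub_u]
  refine h.tendsto_integral_prod u ?_ (fun z => ?_) (hu1.add hu2)
  · exact (measurable_one.indicator hA).add (Measurable.indicator (by fun_prop) hA.compl)
  · rw [one_sub_u]
    exact (norm_indicator_le_norm_self _ _).trans (norm_exp_neg_I_mul_mul _ _).le

theorem integral_exp_shotNoise (h : HasPoissonFunctional Z π μ) (hf : Measurable f)
    (hf0 : ∀ᵐ z ∂π, 0 ≤ f z) (hint : ∫⁻ z, min 1 (ENNReal.ofReal (f z)) ∂π ≠ ∞) (w : ℝ) :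
    ∫ ω, Complex.exp (-(Complex.I * w * (shotNoise f Z ω).toReal)) ∂μ =
      Complex.exp (-∫ z, (1 - Complex.exp (-(Complex.I * w * f z))) ∂π) := by
  simpa using h.setIntegral_void_exp .empty (by simp) hf hf0 hint w

theorem measureReal_void (h : HasPoissonFunctional Z π μ) {A : Set E} (hA : MeasurableSet A)
    (hAfin : π A ≠ ∞) : μ.real {ω | ∀ i, Z i ω ∉ A} = Real.exp (-π.real A) := by
  have := h.setIntegral_void_exp hA hAfin (f := fun _ => 0) measurable_const
    (.of_forall fun _ => le_rfl) (by simp) 0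
  simp only [Complex.ofReal_zero, zero_mul, mul_zero, neg_zero, Complex.exp_zero, sub_self,
    integral_zero, add_zero, setIntegral_const, Complex.real_smul, mul_one] at this
  exact_mod_cast this

end HasPoissonFunctional

end ShotNoise

/-! ### Radial measures -/

section Radial

/-- The image on the half line of a homogeneous planar measure under the distance to the origin:
the measure of density `c * v` on `(0, ∞)`. -/
def radial (c : ℝ) : Measure ℝ :=
  (volume.restrict (Ioi 0)).withDensity fun v => ENNReal.ofReal (c * v)

instance (c : ℝ) : SigmaFinite (radial c) := by
  unfold radial
  exact SigmaFinite.withDensity_ofReal _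

theorem ae_pos_radial (c : ℝ) : ∀ᵐ v ∂(radial c), 0 < v := by
  unfold radial
  exact (withDensity_absolutelyContinuous _ _).ae_le (ae_restrict_mem measurableSet_Ioi)

theorem lintegral_radial (c : ℝ) {f : ℝ → ℝ≥0∞} (hf : Measurable f) :
    ∫⁻ v, f v ∂(radial c) = ∫⁻ v in Ioi 0, ENNReal.ofReal (c * v) * f v := by
  unfold radial
  rw [lintegral_withDensity_eq_lintegral_mul _ (by fun_prop) hf]
  rfl

variable {c : ℝ}

theorem integral_radial (hc : 0 ≤ c) (f : ℝ → ℂ) :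
    ∫ v, f v ∂(radial c) = c * ∫ v in Ioi 0, f v * v := by
  unfold radial
  rw [integral_withDensity_eq_integral_toReal_smul (by fun_prop) (by simp), ← integral_const_mul]
  refine setIntegral_congr_fun measurableSet_Ioi fun v (hv : 0 < v) => ?_
  rw [ENNReal.toReal_ofReal (by positivity), Complex.real_smul]
  push_cast
  ring

theorem integrableOn_of_integrable_radial (hc : 0 < c) {f : ℝ → ℂ}
    (hf : Integrable f (radial c)) : IntegrableOn (fun v => f v * v) (Ioi 0) := by
  unfold radial at hf
  rw [integrable_withDensity_iff_integrable_smul' (by fun_prop) (by simp)] at hf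
  refine (hf.const_mul (c : ℂ)⁻¹).congr ?_
  filter_upwards [ae_restrict_mem measurableSet_Ioi] with v (hv : 0 < v)
  rw [ENNReal.toReal_ofReal (by positivity), Complex.real_smul]
  have : (c : ℂ) ≠ 0 := by exact_mod_cast hc.ne'
  push_cast
  field_simp

theorem lintegral_Ioc_zero_mul (hc : 0 ≤ c) {b : ℝ} (hb : 0 ≤ b) :
    ∫⁻ v in Ioc 0 b, ENNReal.ofReal (c * v) = ENNReal.ofReal (c * b ^ 2 / 2) := by
  have hint : IntegrableOn (fun v : ℝ => c * v) (Ioc 0 b) :=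
    (Continuous.integrableOn_Icc (by fun_prop)).mono_set Ioc_subset_Icc_self
  rw [← ofReal_integral_eq_lintegral_ofReal hint, ← intervalIntegral.integral_of_le hb,
    intervalIntegral.integral_const_mul, integral_id]
  · congr 1
    ring
  · filter_upwards [ae_restrict_mem measurableSet_Ioc] with v hv
    exact mul_nonneg hc hv.1.le

theorem radial_Iic (hc : 0 ≤ c) {v : ℝ} (hv : 0 ≤ v) :
    radial c (Iic v) = ENNReal.ofReal (c * v ^ 2 / 2) := by
  unfold radial
  rw [withDensity_apply _ measurableSet_Iic, Measure.restrict_restrict measurableSet_Iic,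
    inter_comm, Ioi_inter_Iic, lintegral_Ioc_zero_mul hc hv]

theorem radial_Iic_of_nonpos (c : ℝ) {v : ℝ} (hv : v ≤ 0) : radial c (Iic v) = 0 := by
  refine measure_mono_null (fun u hu => ?_) (ae_iff.1 (ae_pos_radial c))
  exact not_lt.2 (le_trans hu hv)

theorem radial_Iic_lt_top (hc : 0 ≤ c) (v : ℝ) : radial c (Iic v) < ∞ := by
  rcases le_total v 0 with hv | hv
  · rw [radial_Iic_of_nonpos c hv]
    exact ENNReal.zero_lt_top
  · rw [radial_Iic hc hv]
    exact ENNReal.ofReal_lt_top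

theorem measureReal_radial_Iic (hc : 0 ≤ c) {v : ℝ} (hv : 0 ≤ v) :
    (radial c).real (Iic v) = c * v ^ 2 / 2 := by
  rw [measureReal_def, radial_Iic hc hv, ENNReal.toReal_ofReal (by positivity)]

theorem lintegral_min_one_rpow_radial_ne_top (hc : 0 ≤ c) (K : ℝ) {alpha : ℝ}
    (halpha : 2 < alpha) : ∫⁻ v, min 1 (ENNReal.ofReal (K * v ^ (-alpha))) ∂(radial c) ≠ ∞ := by
  rw [lintegral_radial _ (by fun_prop), ← Ioc_union_Ioi_eq_Ioi zero_le_one]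
  refine ne_top_of_le_ne_top (ENNReal.add_ne_top.2 ⟨?near, ?far⟩) (lintegral_union_le _ _ _)
  case near =>
    refine ne_top_of_le_ne_top ?_ (lintegral_mono (g := fun v => ENNReal.ofReal (c * v)) fun v =>
      mul_le_of_le_one_right' (min_le_left _ _))
    rw [lintegral_Ioc_zero_mul hc zero_le_one]
    exact ENNReal.ofReal_ne_top
  case far =>
    have hint : IntegrableOn (fun v : ℝ => c * (|K| * v ^ (1 - alpha))) (Ioi 1) :=
      ((integrableOn_Ioi_rpow_of_lt (by linarith) one_pos).const_mul _).const_mul _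
    refine ne_top_of_le_ne_top hint.lintegral_lt_top.ne
      (setLIntegral_mono' measurableSet_Ioi fun v (hv : 1 < v) => ?_)
    have hv0 : 0 < v := one_pos.trans hv
    refine (mul_le_mul_right (min_le_right _ _) _).trans ?_
    rw [← ENNReal.ofReal_mul (by positivity)]
    refine ENNReal.ofReal_le_ofReal ?_
    calc c * v * (K * v ^ (-alpha)) ≤ c * v * (|K| * v ^ (-alpha)) := by
          gcongr
          exact le_abs_self K
      _ = c * (|K| * v ^ (1 - alpha)) := by
          rw [sub_eq_add_neg, Real.rpow_add hv0, Real.rpow_one]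
          ring

end Radial

/-! ### Equivalent distances -/

section EquivalentDistance

instance (lam : ℝ) : SigmaFinite (homogeneous lam) := by
  unfold homogeneous
  exact inferInstanceAs (SigmaFinite (lam.toNNReal • (volume : Measure Plane)))

instance (σ : ℝ≥0) : IsProbabilityMeasure (shadowLaw σ) := by
  unfold shadowLaw
  infer_instance

theorem fading_pos (x : ℝ) : 0 < fading x := Real.exp_pos _

theorem measurable_fading : Measurable fading := by
  unfold fading
  fun_prop

theorem measurable_equivDist (alpha : ℝ) :
    Measurable fun z : Plane × ℝ => equivDist alpha z.1 z.2 := by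
  unfold equivDist
  exact ((measurable_fading.comp measurable_snd).pow_const _).mul measurable_fst.norm

theorem measurable_equivDist_prodMk {Ω E : Type*} [MeasurableSpace Ω] [MeasurableSpace E]
    (alpha : ℝ) {x : Ω → Plane} {m : Ω → ℝ × E} (hx : Measurable x) (hm : Measurable m) :
    Measurable fun ω => (equivDist alpha (x ω) (m ω).1, (m ω).2) :=
  ((measurable_equivDist alpha).comp (hx.prodMk hm.fst)).prodMk hm.snd

theorem equivDist_nonneg (alpha : ℝ) (x : Plane) (xi : ℝ) : 0 ≤ equivDist alpha x xi :=
  mul_nonneg (Real.rpow_nonneg (fading_pos _).le _) (norm_nonneg _)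

theorem equivDist_le_iff (alpha : ℝ) (x : Plane) (xi v : ℝ) :
    equivDist alpha x xi ≤ v ↔ ‖x‖ ≤ v * Real.exp (kappa * xi / alpha) := by
  unfold equivDist fading
  rw [← Real.exp_mul, show kappa * xi * (-1 / alpha) = -(kappa * xi / alpha) by ring,
    Real.exp_neg, inv_mul_le_iff₀ (Real.exp_pos _), mul_comm]

theorem mul_fading_mul_norm_rpow {alpha : ℝ} (halpha : alpha ≠ 0) (K : ℝ) (x : Plane) (xi : ℝ) :
    K * fading xi * ‖x‖ ^ (-alpha) = K * equivDist alpha x xi ^ (-alpha) := by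
  unfold equivDist
  rw [Real.mul_rpow (Real.rpow_nonneg (fading_pos _).le _) (norm_nonneg _),
    ← Real.rpow_mul (fading_pos _).le, show -1 / alpha * -alpha = 1 by field_simp, Real.rpow_one]
  ring

theorem fadingFactor_pos (σ : ℝ≥0) (alpha : ℝ) : 0 < fadingFactor σ alpha := Real.exp_pos _

theorem lintegral_exp_sq_shadowLaw (σ : ℝ≥0) (alpha : ℝ) :
    ∫⁻ xi, ENNReal.ofReal (Real.exp (kappa * xi / alpha) ^ 2) ∂(shadowLaw σ) =
      ENNReal.ofReal (fadingFactor σ alpha) := by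
  have exp_sq (xi : ℝ) :
      Real.exp (kappa * xi / alpha) ^ 2 = Real.exp (2 * kappa / alpha * xi) := by
    rw [← Real.exp_nat_mul]
    congr 1
    push_cast
    ring
  have hmgf := congrFun (mgf_id_gaussianReal (μ := 0) (v := σ ^ 2)) (2 * kappa / alpha)
  simp only [mgf, id] at hmgf
  simp_rw [exp_sq]
  unfold shadowLaw
  rw [← ofReal_integral_eq_lintegral_ofReal (integrable_exp_mul_gaussianReal _)
    (.of_forall fun _ => (Real.exp_pos _).le), hmgf]
  unfold fadingFactor
  congr 2
  push_cast
  ring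

theorem homogeneous_equivDist_le {lam : ℝ} (hlam : 0 ≤ lam) (alpha xi : ℝ) {v : ℝ} (hv : 0 ≤ v) :
    homogeneous lam {x | equivDist alpha x xi ≤ v} =
      ENNReal.ofReal (lam * v ^ 2 * Real.pi) *
        ENNReal.ofReal (Real.exp (kappa * xi / alpha) ^ 2) := by
  have eq_closedBall : {x | equivDist alpha x xi ≤ v} =
      Metric.closedBall (0 : Plane) (v * Real.exp (kappa * xi / alpha)) := by
    ext x
    simp [equivDist_le_iff]
  rw [eq_closedBall, homogeneous, Measure.smul_apply,
    InnerProductSpace.volume_closedBall_of_dim_even (k := 1) (by simp), smul_eq_mul,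
    finrank_euclideanSpace, ← ENNReal.ofReal_pow (by positivity),
    ← ENNReal.ofReal_mul (by positivity), ← ENNReal.ofReal_mul (by positivity),
    ← ENNReal.ofReal_mul (by positivity)]
  congr 1
  simp only [Fintype.card_fin, pow_one, Nat.factorial_one, Nat.cast_one, div_one]
  ring

theorem ext_of_Iic_of_lt_top {m₁ m₂ : Measure ℝ} (hfin : ∀ v, m₁ (Iic v) < ∞)
    (h : ∀ v, m₁ (Iic v) = m₂ (Iic v)) : m₁ = m₂ := by
  refine Measure.ext_of_Ioc' _ _
    (fun a b _ => ((measure_mono Ioc_subset_Iic_self).trans_lt (hfin b)).ne) fun a b hab => ?_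
  rw [← Iic_sdiff_Iic, measure_sdiff (Iic_subset_Iic.2 hab.le) nullMeasurableSet_Iic (hfin a).ne,
    measure_sdiff (Iic_subset_Iic.2 hab.le) nullMeasurableSet_Iic (h a ▸ (hfin a).ne), h, h]

theorem map_equivDist {lam : ℝ} (hlam : 0 ≤ lam) (σ : ℝ≥0) (alpha : ℝ) :
    ((homogeneous lam).prod (shadowLaw σ)).map (fun z => equivDist alpha z.1 z.2) =
      radial (2 * Real.pi * lam * fadingFactor σ alpha) := by
  have := fadingFactor_pos σ alpha
  have hm := measurable_equivDist alpha
  refine (ext_of_Iic_of_lt_top (radial_Iic_lt_top (by positivity)) fun v => ?_).symm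
  rw [Measure.map_apply hm measurableSet_Iic]
  rcases lt_or_ge v 0 with hv | hv
  · have empty : (fun z : Plane × ℝ => equivDist alpha z.1 z.2) ⁻¹' Iic v = ∅ :=
      eq_empty_of_forall_notMem fun z hz => (hv.trans_le (equivDist_nonneg alpha z.1 z.2)).not_ge hz
    rw [radial_Iic_of_nonpos _ hv.le, empty, measure_empty]
  · rw [radial_Iic (by positivity) hv, Measure.prod_apply_symm (hm measurableSet_Iic)]
    calc ENNReal.ofReal (2 * Real.pi * lam * fadingFactor σ alpha * v ^ 2 / 2)
        = ENNReal.ofReal (lam * v ^ 2 * Real.pi) * ENNReal.ofReal (fadingFactor σ alpha) := by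
          rw [← ENNReal.ofReal_mul (by positivity)]
          congr 1
          ring
      _ = ∫⁻ xi, homogeneous lam {x | equivDist alpha x xi ≤ v} ∂(shadowLaw σ) := by
          simp_rw [homogeneous_equivDist_le hlam alpha _ hv]
          rw [lintegral_const_mul _ (by fun_prop), lintegral_exp_sq_shadowLaw]

variable {Ω F : Type*} [MeasurableSpace Ω] [MeasurableSpace F] {X : ℕ → Ω → Plane}
  {μ : Measure Ω} {lam : ℝ} {σ : ℝ≥0} [IsProbabilityMeasure μ]

theorem IsMarkedPoisson.hasPoissonFunctional_equivDist {M : ℕ → Ω → ℝ} (hlam : 0 ≤ lam)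
    (h : IsMarkedPoisson X M (homogeneous lam) (shadowLaw σ) μ) (alpha : ℝ) :
    HasPoissonFunctional (fun i ω => equivDist alpha (X i ω) (M i ω))
      (radial (2 * Real.pi * lam * fadingFactor σ alpha)) μ := by
  rw [← map_equivDist hlam]
  exact h.hasPoissonFunctional.map (measurable_equivDist alpha)

theorem IsMarkedPoisson.hasPoissonFunctional_equivDist_mark {M : ℕ → Ω → ℝ × F}
    {κ : Measure F} [IsProbabilityMeasure κ] (hlam : 0 ≤ lam)
    (h : IsMarkedPoisson X M (homogeneous lam) ((shadowLaw σ).prod κ) μ) (alpha : ℝ) :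
    HasPoissonFunctional (fun i ω => (equivDist alpha (X i ω) (M i ω).1, (M i ω).2))
      ((radial (2 * Real.pi * lam * fadingFactor σ alpha)).prod κ) μ := by
  have hm := measurable_equivDist alpha
  have map_eq := Measure.map_prod_map ((homogeneous lam).prod (shadowLaw σ)) κ hm measurable_id
  rw [map_equivDist hlam, Measure.map_id] at map_eq
  have hassoc := h.hasPoissonFunctional.map MeasurableEquiv.prodAssoc.symm.measurable
  rw [((measurePreserving_prodAssoc (homogeneous lam) (shadowLaw σ) κ).symm _).map_eq] at hassoc
  rw [map_eq]
  exact hassoc.map (hm.prodMap measurable_id)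

end EquivalentDistance

/-! ### The strongest point -/

section Strongest

variable {Ω : Type*} [MeasurableSpace Ω]

theorem le_strongest {v : ℕ → ℝ} (hsum : ∑' i, ENNReal.ofReal (v i) ≠ ∞) (hpos : ∃ j, 0 < v j)
    (k : ℕ) : v k ≤ v (strongest v) := by
  obtain ⟨i, hi⟩ := hpos
  have hfin : {k | v i ≤ v k}.Finite :=
    (ENNReal.finite_const_le_of_tsum_ne_top hsum (ENNReal.ofReal_pos.2 hi).ne').subset
      fun k hk => ENNReal.ofReal_le_ofReal hk
  obtain ⟨j, hj, hmax⟩ := exists_max_image _ v hfin ⟨i, le_refl (v i)⟩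
  have exists_max : ∃ j, ∀ k, v k ≤ v j :=
    ⟨j, fun k => (le_total (v i) (v k)).elim (hmax k) fun hk => hk.trans hj⟩
  exact Nat.sInf_mem (s := {j | ∀ k, v k ≤ v j}) exists_max k

theorem dist_strongest_le {K alpha : ℝ} (hK : 0 < K) (halpha : 0 < alpha) {d : ℕ → ℝ}
    (hd : ∀ i, 0 < d i) {b : ℕ → Prop} [DecidablePred b] (hb : ∃ j, b j)
    (hsum : ∑' i, ENNReal.ofReal (if b i then K * d i ^ (-alpha) else 0) ≠ ∞) :
    b (strongest fun i => if b i then K * d i ^ (-alpha) else 0) ∧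
      ∀ i, b i → d (strongest fun i => if b i then K * d i ^ (-alpha) else 0) ≤ d i := by
  have power_pos (i : ℕ) : 0 < K * d i ^ (-alpha) := mul_pos hK (Real.rpow_pos_of_pos (hd i) _)
  obtain ⟨j, hj⟩ := hb
  have hmax := le_strongest hsum ⟨j, by simpa only [if_pos hj] using power_pos j⟩
  set s := strongest fun i => if b i then K * d i ^ (-alpha) else 0
  have hs : b s := by
    by_contra hs
    have := hmax j
    rw [if_pos hj, if_neg hs] at this
    exact this.not_gt (power_pos j)
  refine ⟨hs, fun i hi => ?_⟩
  have := hmax i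
  rwa [if_pos hi, if_pos hs, mul_le_mul_iff_right₀ hK,
    Real.rpow_le_rpow_iff_of_neg (hd i) (hd s) (neg_lt_zero.2 halpha)] at this

theorem measurable_strongest {v : Ω → ℕ → ℝ} (hv : ∀ k, Measurable fun ω => v ω k) :
    Measurable fun ω => strongest (v ω) := by
  classical
  let isMax (ω : Ω) (j : ℕ) : Prop := ∀ k, v ω k ≤ v ω j
  have measurableSet_isMax (j : ℕ) : MeasurableSet {ω | isMax ω j} := by
    simp_rw [isMax, ofPred_forall]
    exact .iInter fun k => measurableSet_le (hv k) (hv j)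
  have measurableSet_noMax : MeasurableSet {ω | ∀ i, ¬ isMax ω i} := by
    simp_rw [ofPred_forall]
    exact .iInter fun i => (measurableSet_isMax i).compl
  have exists_index (ω : Ω) : ∃ j, isMax ω j ∨ ∀ i, ¬ isMax ω i := by
    by_cases h : ∃ j, isMax ω j
    · exact h.imp fun _ => Or.inl
    · exact ⟨0, Or.inr (not_exists.1 h)⟩
  have strongest_eq : (fun ω => strongest (v ω)) = fun ω => Nat.find (exists_index ω) := by
    funext ω
    by_cases h : ∃ j, isMax ω j
    · exact le_antisymm
        (Nat.sInf_le ((Nat.find_spec (exists_index ω)).resolve_right (not_forall_not.2 h)))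
        (Nat.find_min' _ (Or.inl (Nat.sInf_mem h)))
    · rw [(Nat.find_eq_zero _).2 (Or.inr (not_exists.1 h))]
      exact Nat.sInf_eq_zero.2 (Or.inr (eq_empty_of_forall_notMem (not_exists.1 h)))
  rw [strongest_eq]
  exact measurable_find _ fun j => (measurableSet_isMax j).union measurableSet_noMax

theorem measurable_apply_nat {S : Type*} [MeasurableSpace S] {f : ℕ → Ω → S}
    (hf : ∀ k, Measurable (f k)) {n : Ω → ℕ} (hn : Measurable n) : Measurable fun ω => f (n ω) ω :=
  (measurable_from_prod_countable_right (f := fun z : ℕ × Ω => f z.1 z.2) hf).comp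
    (hn.prodMk measurable_id)

end Strongest

/-! ### Rayleigh distributions -/

section Rayleigh

/-- The Rayleigh distribution of density `c r exp (-c r² / 2)`: the law of the smallest point of a
Poisson process of intensity `radial c`. -/
def rayleigh (c : ℝ) : Measure ℝ :=
  (volume.restrict (Ioi 0)).withDensity
    fun r => ENNReal.ofReal (c * r * Real.exp (-(c * r ^ 2 / 2)))

theorem hasDerivAt_neg_exp_neg_sq (c r : ℝ) :
    HasDerivAt (fun r => -Real.exp (-(c * r ^ 2 / 2))) (c * r * Real.exp (-(c * r ^ 2 / 2))) r := by
  have h1 : HasDerivAt (fun r => -(c * r ^ 2 / 2)) (-(c * r)) r := by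
    refine (((hasDerivAt_pow 2 r).const_mul c).div_const 2).neg.congr_deriv ?_
    push_cast
    ring
  refine h1.exp.neg.congr_deriv ?_
  ring

theorem ae_pos_rayleigh (c : ℝ) : ∀ᵐ v ∂(rayleigh c), 0 < v := by
  unfold rayleigh
  exact (withDensity_absolutelyContinuous _ _).ae_le (ae_restrict_mem measurableSet_Ioi)

theorem rayleigh_Iic_of_nonpos (c : ℝ) {a : ℝ} (ha : a ≤ 0) : rayleigh c (Iic a) = 0 := by
  refine measure_mono_null (fun u hu => ?_) (ae_iff.1 (ae_pos_rayleigh c))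
  exact not_lt.2 (le_trans hu ha)

variable {c a : ℝ}

theorem tendsto_exp_neg_sq (hc : 0 < c) :
    Tendsto (fun r : ℝ => Real.exp (-(c * r ^ 2 / 2))) atTop (𝓝 0) := by
  refine Real.tendsto_exp_neg_atTop_nhds_zero.comp ?_
  exact ((tendsto_pow_atTop two_ne_zero).const_mul_atTop hc).atTop_div_const two_pos

theorem integrableOn_mul_exp_neg_sq (hc : 0 < c) (ha : 0 ≤ a) :
    IntegrableOn (fun r => c * r * Real.exp (-(c * r ^ 2 / 2))) (Ioi a) :=
  integrableOn_Ioi_deriv_of_nonneg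
    (hasDerivAt_neg_exp_neg_sq c a).continuousAt.continuousWithinAt
    (fun r _ => hasDerivAt_neg_exp_neg_sq c r)
    (fun r hr => by
      have : 0 ≤ r := ha.trans (le_of_lt hr)
      positivity)
    (by simpa using (tendsto_exp_neg_sq hc).neg)

theorem rayleigh_Ioi (hc : 0 < c) (ha : 0 ≤ a) :
    rayleigh c (Ioi a) = ENNReal.ofReal (Real.exp (-(c * a ^ 2 / 2))) := by
  have hint := integrableOn_mul_exp_neg_sq hc ha
  have integral_eq := integral_Ioi_of_hasDerivAt_of_tendsto
    (hasDerivAt_neg_exp_neg_sq c a).continuousAt.continuousWithinAt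
    (fun r _ => hasDerivAt_neg_exp_neg_sq c r) hint (tendsto_exp_neg_sq hc).neg
  unfold rayleigh
  rw [withDensity_apply _ measurableSet_Ioi, Measure.restrict_restrict measurableSet_Ioi,
    Ioi_inter_Ioi, max_eq_left ha, ← ofReal_integral_eq_lintegral_ofReal hint, integral_eq]
  · congr 1
    ring
  · filter_upwards [ae_restrict_mem measurableSet_Ioi] with r hr
    have : 0 ≤ r := ha.trans (le_of_lt hr)
    change 0 ≤ c * r * Real.exp (-(c * r ^ 2 / 2))
    positivity

theorem isProbabilityMeasure_rayleigh (hc : 0 < c) : IsProbabilityMeasure (rayleigh c) := by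
  constructor
  rw [← Iic_union_Ioi (a := (0 : ℝ)), measure_union (Iic_disjoint_Ioi le_rfl) measurableSet_Ioi,
    rayleigh_Iic_of_nonpos c le_rfl, rayleigh_Ioi hc le_rfl]
  simp

theorem rayleigh_Iio (hc : 0 < c) (ha : 0 ≤ a) :
    rayleigh c (Iio a) = ENNReal.ofReal (1 - Real.exp (-(c * a ^ 2 / 2))) := by
  have := isProbabilityMeasure_rayleigh hc
  have noAtom : rayleigh c {a} = 0 := withDensity_absolutelyContinuous _ _ (measure_singleton a)
  rw [measure_congr (Iio_ae_eq_Iic' noAtom), ← compl_Ioi, prob_compl_eq_one_sub measurableSet_Ioi,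
    rayleigh_Ioi hc ha, ENNReal.ofReal_sub _ (Real.exp_pos _).le, ENNReal.ofReal_one]

theorem eq_rayleigh (hc : 0 < c) {m : Measure ℝ} [IsProbabilityMeasure m]
    (h : ∀ a, 0 ≤ a → m.real (Ioi a) = Real.exp (-(c * a ^ 2 / 2))) : m = rayleigh c := by
  have := isProbabilityMeasure_rayleigh hc
  refine Measure.ext_of_Iic _ _ fun a => ?_
  have Iic_eq (a : ℝ) (ha : 0 ≤ a) : m (Iic a) = rayleigh c (Iic a) := by
    rw [← compl_Ioi, prob_compl_eq_one_sub measurableSet_Ioi,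
      prob_compl_eq_one_sub measurableSet_Ioi, ← ofReal_measureReal, h a ha, rayleigh_Ioi hc ha]
  rcases le_total 0 a with ha | ha
  · exact Iic_eq a ha
  · rw [rayleigh_Iic_of_nonpos c ha, measure_mono_null (Iic_subset_Iic.2 ha)
      ((Iic_eq 0 le_rfl).trans (rayleigh_Iic_of_nonpos c le_rfl))]

theorem map_eq_rayleigh (hc : 0 < c) {Ω : Type*} [MeasurableSpace Ω] {μ : Measure Ω}
    [IsProbabilityMeasure μ] {R : Ω → ℝ} (hR : Measurable R)
    (h : ∀ a, 0 ≤ a → μ.real {ω | a < R ω} = Real.exp (-(c * a ^ 2 / 2))) :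
    μ.map R = rayleigh c := by
  have := Measure.isProbabilityMeasure_map (μ := μ) hR.aemeasurable
  refine eq_rayleigh hc fun a ha => ?_
  rw [map_measureReal_apply hR measurableSet_Ioi]
  exact h a ha

theorem integrable_rayleigh_iff (hc : 0 < c) {f : ℝ → ℂ} :
    Integrable f (rayleigh c) ↔
      IntegrableOn (fun r => ((c * r * Real.exp (-(c * r ^ 2 / 2)) : ℝ) : ℂ) * f r) (Ioi 0) := by
  rw [rayleigh, integrable_withDensity_iff_integrable_smul' (by fun_prop) (by simp)]
  refine integrableOn_congr_fun (fun r (hr : 0 < r) => ?_) measurableSet_Ioi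
  rw [ENNReal.toReal_ofReal (by positivity), Complex.real_smul]

theorem setIntegral_Ioi_rayleigh (hc : 0 < c) (ha : 0 ≤ a) (f : ℝ → ℂ) :
    ∫ r in Ioi a, f r ∂(rayleigh c) =
      ∫ r in Ioi a, ((c * r * Real.exp (-(c * r ^ 2 / 2)) : ℝ) : ℂ) * f r := by
  unfold rayleigh
  rw [setIntegral_withDensity_eq_setIntegral_toReal_smul (by fun_prop) (by simp) _
    measurableSet_Ioi, Measure.restrict_restrict measurableSet_Ioi, Ioi_inter_Ioi, max_eq_left ha]
  refine setIntegral_congr_fun measurableSet_Ioi fun r (hr : a < r) => ?_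
  have : 0 ≤ r := ha.trans hr.le
  rw [ENNReal.toReal_ofReal (by positivity), Complex.real_smul]

end Rayleigh

/-! ### Mode selection -/

section ModeSelection

/-- The rate `2 π λ_B e_B`: the equivalent distances of the base stations form a Poisson process
of intensity `radial p.rateB`. -/
def Params.rateB (p : Params) : ℝ :=
  2 * Real.pi * p.lamB * fadingFactor p.sigmaB p.alphaB

theorem Params.rateB_pos (p : Params) : 0 < p.rateB := by
  have := p.lamB_pos
  have := fadingFactor_pos p.sigmaB p.alphaB
  unfold Params.rateB
  positivity

theorem Params.alphaB_pos (p : Params) : 0 < p.alphaB := two_pos.trans p.two_lt_alphaB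

theorem tMax_pos (p : Params) : 0 < tMax p :=
  Real.rpow_pos_of_pos (div_pos p.beta_pos (mul_pos p.AB_pos p.PB_pos)) _

theorem qCellular_eq (p : Params) : qCellular p = 1 - Real.exp (-(p.rateB * tMax p ^ 2 / 2)) := by
  have ratio_pos := div_pos p.beta_pos (mul_pos p.AB_pos p.PB_pos)
  have tMax_sq : tMax p ^ 2 = (p.AB * p.PB / p.beta) ^ (2 / p.alphaB) := by
    unfold tMax
    rw [← Real.rpow_mul_natCast ratio_pos.le, ← inv_div p.beta, Real.inv_rpow ratio_pos.le,
      ← Real.rpow_neg ratio_pos.le]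
    congr 1
    push_cast
    ring
  unfold qCellular Params.rateB
  rw [tMax_sq]
  ring_nf

theorem qCellular_pos (p : Params) : 0 < qCellular p := by
  have := tMax_pos p
  have := p.rateB_pos
  rw [qCellular_eq, sub_pos, Real.exp_lt_one_iff, neg_lt_zero]
  positivity

theorem qCellular_lt_one (p : Params) : qCellular p < 1 :=
  sub_lt_self _ (Real.exp_pos _)

theorem fCellular_eq (p : Params) (ρ : ℝ) : fCellular p ρ =
    (qCellular p)⁻¹ * (p.rateB * ρ * Real.exp (-(p.rateB * ρ ^ 2 / 2))) := by
  unfold fCellular Params.rateB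
  rw [div_eq_inv_mul]
  congr 4
  ring

theorem beta_lt_mul_rpow_iff (p : Params) {v : ℝ} (hv : 0 < v) :
    p.beta < p.AB * p.PB * v ^ (-p.alphaB) ↔ v < tMax p := by
  have hA := mul_pos p.AB_pos p.PB_pos
  have tMax_rpow : tMax p ^ (-p.alphaB) = p.beta / (p.AB * p.PB) := by
    have halpha := p.alphaB_pos.ne'
    unfold tMax
    rw [← Real.rpow_mul (div_pos p.beta_pos hA).le,
      show -1 / p.alphaB * -p.alphaB = 1 by field_simp, Real.rpow_one]
  rw [← div_lt_iff₀' hA, ← tMax_rpow,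
    Real.rpow_lt_rpow_iff_of_neg (tMax_pos p) hv (neg_lt_zero.2 p.alphaB_pos)]

theorem rxBS_eq {Ω : Type*} (p : Params) (Y : ℕ → Ω → Plane) (xi : ℕ → Ω → ℝ)
    (ω : Ω) : rxBS p Y xi ω =
    fun k => p.AB * p.PB * equivDist p.alphaB (Y k ω) (xi k ω) ^ (-p.alphaB) :=
  funext fun _ => mul_fading_mul_norm_rpow p.alphaB_pos.ne' _ _ _

variable {Ω : Type*} [MeasurableSpace Ω] {μ : Measure Ω} {p : Params} {Y : ℕ → Ω → Plane}
  {xi : ℕ → Ω → ℝ}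

theorem measurable_servingDist
    (hY : IsMarkedPoisson Y xi (homogeneous p.lamB) (shadowLaw p.sigmaB) μ) :
    Measurable (servingDist p Y xi) := by
  have measurable_dist (k : ℕ) : Measurable fun ω => equivDist p.alphaB (Y k ω) (xi k ω) :=
    (measurable_equivDist p.alphaB).comp ((hY.poisson.measurable k).prodMk (hY.measurable_mark k))
  refine measurable_apply_nat measurable_dist (measurable_strongest fun k => ?_)
  simp_rw [rxBS_eq]
  exact ((measurable_dist k).pow_const _).const_mul _

variable [IsProbabilityMeasure μ]

theorem hasPoissonFunctional_baseStations
    (hY : IsMarkedPoisson Y xi (homogeneous p.lamB) (shadowLaw p.sigmaB) μ) :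
    HasPoissonFunctional (fun i ω => equivDist p.alphaB (Y i ω) (xi i ω)) (radial p.rateB) μ :=
  hY.hasPoissonFunctional_equivDist p.lamB_pos.le p.alphaB

theorem ae_servingDist_spec
    (hY : IsMarkedPoisson Y xi (homogeneous p.lamB) (shadowLaw p.sigmaB) μ) :
    ∀ᵐ ω ∂μ, 0 < servingDist p Y xi ω ∧
      (∀ i, servingDist p Y xi ω ≤ equivDist p.alphaB (Y i ω) (xi i ω)) ∧
      (ω ∈ cellularMode p Y xi ↔ servingDist p Y xi ω < tMax p) := by
  have hZ := hasPoissonFunctional_baseStations hY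
  filter_upwards [hZ.ae_forall (ae_pos_radial _),
    hZ.ae_shotNoise_ne_top (f := fun v => p.AB * p.PB * v ^ (-p.alphaB)) (by fun_prop)
      (lintegral_min_one_rpow_radial_ne_top p.rateB_pos.le _ p.two_lt_alphaB)] with ω hpos hsum
  have nearest := dist_strongest_le (b := fun _ => True) (mul_pos p.AB_pos p.PB_pos) p.alphaB_pos
    hpos ⟨0, trivial⟩ (by simpa only [if_true, shotNoise] using hsum)
  simp only [if_true, true_and, forall_const, ← rxBS_eq] at nearest
  have servingDist_pos : 0 < servingDist p Y xi ω := hpos _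
  refine ⟨servingDist_pos, nearest, ?_⟩
  have rxBS_serving : rxBS p Y xi ω (strongest (rxBS p Y xi ω)) =
      p.AB * p.PB * servingDist p Y xi ω ^ (-p.alphaB) := congrFun (rxBS_eq p Y xi ω) _
  rw [← beta_lt_mul_rpow_iff p servingDist_pos, ← rxBS_serving]
  rfl

theorem map_servingDist (hY : IsMarkedPoisson Y xi (homogeneous p.lamB) (shadowLaw p.sigmaB) μ) :
    μ.map (servingDist p Y xi) = rayleigh p.rateB := by
  refine map_eq_rayleigh p.rateB_pos (measurable_servingDist hY) fun a ha => ?_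
  have hfin := (radial_Iic_lt_top p.rateB_pos.le a).ne
  rw [← measureReal_radial_Iic p.rateB_pos.le ha,
    ← (hasPoissonFunctional_baseStations hY).measureReal_void measurableSet_Iic hfin]
  refine measureReal_congr ?_
  filter_upwards [ae_servingDist_spec hY] with ω ⟨_, hle, _⟩
  exact propext ⟨fun h i hi => (h.trans_le (hle i)).not_ge hi, fun h => not_le.1 (h _)⟩

theorem cellularMode_ae_eq (hY : IsMarkedPoisson Y xi (homogeneous p.lamB) (shadowLaw p.sigmaB) μ) :
    cellularMode p Y xi =ᵐ[μ] servingDist p Y xi ⁻¹' Iio (tMax p) := by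
  filter_upwards [ae_servingDist_spec hY] with ω hω
  exact propext hω.2.2

theorem measure_cellularMode
    (hY : IsMarkedPoisson Y xi (homogeneous p.lamB) (shadowLaw p.sigmaB) μ) :
    μ (cellularMode p Y xi) = ENNReal.ofReal (qCellular p) := by
  rw [measure_congr (cellularMode_ae_eq hY), ← Measure.map_apply (measurable_servingDist hY)
    measurableSet_Iio, map_servingDist hY, rayleigh_Iio p.rateB_pos (tMax_pos p).le, qCellular_eq]

theorem lamD2D_eq (hY : IsMarkedPoisson Y xi (homogeneous p.lamB) (shadowLaw p.sigmaB) μ) :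
    lamD2D p Y xi μ = (1 - qCellular p) * p.lamU := by
  unfold lamD2D
  rw [measureReal_def, measure_cellularMode hY, ENNReal.toReal_ofReal (qCellular_pos p).le]

theorem cellularDistLaw_eq
    (hY : IsMarkedPoisson Y xi (homogeneous p.lamB) (shadowLaw p.sigmaB) μ) :
    cellularDistLaw p Y xi μ = (volume.restrict (Ioo 0 (tMax p))).withDensity
      fun ρ => ENNReal.ofReal (fCellular p ρ) := by
  have hq := qCellular_pos p
  unfold cellularDistLaw
  rw [ProbabilityTheory.cond, Measure.map_smul, Measure.restrict_congr_set (cellularMode_ae_eq hY),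
    ← Measure.restrict_map (measurable_servingDist hY) measurableSet_Iio, map_servingDist hY,
    measure_cellularMode hY, rayleigh, restrict_withDensity measurableSet_Iio,
    Measure.restrict_restrict measurableSet_Iio, inter_comm, Ioi_inter_Iio,
    ← withDensity_smul _ (by fun_prop)]
  congr 1
  ext ρ
  rw [fCellular_eq, ENNReal.ofReal_mul (inv_pos.2 hq).le, ENNReal.ofReal_inv_of_pos hq]
  rfl

theorem isProbabilityMeasure_cellularDistLaw
    (hY : IsMarkedPoisson Y xi (homogeneous p.lamB) (shadowLaw p.sigmaB) μ) :
    IsProbabilityMeasure (cellularDistLaw p Y xi μ) := by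
  have : IsProbabilityMeasure (cond μ (cellularMode p Y xi)) :=
    cond_isProbabilityMeasure (by
      rw [measure_cellularMode hY]
      simpa using qCellular_pos p)
  exact Measure.isProbabilityMeasure_map (measurable_servingDist hY).aemeasurable

theorem ae_mem_Ioo_cellularDistLaw
    (hY : IsMarkedPoisson Y xi (homogeneous p.lamB) (shadowLaw p.sigmaB) μ) :
    ∀ᵐ ρ ∂(cellularDistLaw p Y xi μ), ρ ∈ Ioo 0 (tMax p) := by
  rw [cellularDistLaw_eq hY]
  exact (withDensity_absolutelyContinuous _ _).ae_le (ae_restrict_mem measurableSet_Ioo)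

theorem integral_cellularDistLaw
    (hY : IsMarkedPoisson Y xi (homogeneous p.lamB) (shadowLaw p.sigmaB) μ) (g : ℝ → ℂ) :
    ∫ ρ, g ρ ∂(cellularDistLaw p Y xi μ) = ∫ ρ in Ioo 0 (tMax p), g ρ * (fCellular p ρ : ℂ) := by
  rw [cellularDistLaw_eq hY, integral_withDensity_eq_integral_toReal_smul
    (by unfold fCellular; fun_prop) (by simp)]
  refine setIntegral_congr_fun measurableSet_Ioo fun ρ ⟨hρ, _⟩ => ?_
  have fCellular_nonneg : 0 ≤ fCellular p ρ := by
    have := qCellular_pos p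
    have := p.rateB_pos
    rw [fCellular_eq]
    positivity
  rw [ENNReal.toReal_ofReal fCellular_nonneg, Complex.real_smul, mul_comm]

end ModeSelection

/-! ### Interference from the cellular users -/

section CellularInterference

/-- The power received from a cellular user at equivalent distance `z.1` from the origin and `z.2`
from its base station. -/
def cellularPower (p : Params) (z : ℝ × ℝ) : ℝ := txCellular p z.2 * p.AB * z.1 ^ (-p.alphaB)

theorem measurable_cellularPower (p : Params) : Measurable (cellularPower p) := by
  unfold cellularPower txCellular
  fun_prop

theorem txCellular_pos (p : Params) {ρ : ℝ} (hρ : 0 < ρ) : 0 < txCellular p ρ :=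
  mul_pos p.P0_pos (Real.rpow_pos_of_pos (div_pos (Real.rpow_pos_of_pos hρ _) p.AB_pos) _)

theorem txCellular_le_txCellular (p : Params) {ρ t : ℝ} (hρ : 0 < ρ) (ht : ρ ≤ t) :
    txCellular p ρ ≤ txCellular p t := by
  have := p.P0_pos
  have := p.AB_pos
  have := p.alphaB_pos
  have := p.eps_pos
  unfold txCellular
  gcongr

theorem cellularPower_pos (p : Params) {z : ℝ × ℝ} (h1 : 0 < z.1) (h2 : 0 < z.2) :
    0 < cellularPower p z :=
  mul_pos (mul_pos (txCellular_pos p h2) p.AB_pos) (Real.rpow_pos_of_pos h1 _)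

theorem cellularPower_eq (p : Params) (τ : ℝ) {ρ : ℝ} (hρ : 0 < ρ) : cellularPower p (τ, ρ) =
    p.P0 * p.AB ^ (1 - p.eps) * ρ ^ (p.alphaB * p.eps) * τ ^ (-p.alphaB) := by
  unfold cellularPower txCellular
  rw [Real.div_rpow (Real.rpow_pos_of_pos hρ _).le p.AB_pos.le, ← Real.rpow_mul hρ.le,
    Real.rpow_sub p.AB_pos, Real.rpow_one]
  ring

theorem interfC_eq_shotNoise {Ω : Type*} (p : Params) (C : ℕ → Ω → Plane) (M : ℕ → Ω → ℝ × ℝ) :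
    interfC p C M = shotNoise (cellularPower p)
      fun i ω => (equivDist p.alphaB (C i ω) (M i ω).1, (M i ω).2) := by
  funext ω
  exact tsum_congr fun i =>
    congrArg ENNReal.ofReal (mul_fading_mul_norm_rpow p.alphaB_pos.ne' _ _ _)

variable {Ω : Type*} [MeasurableSpace Ω] {μ : Measure Ω} {p : Params} {Y C : ℕ → Ω → Plane}
  {xi : ℕ → Ω → ℝ} {M : ℕ → Ω → ℝ × ℝ}

theorem measurable_interfC (hC : ∀ i, Measurable (C i)) (hM : ∀ i, Measurable (M i)) :
    Measurable (interfC p C M) := by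
  rw [interfC_eq_shotNoise]
  exact measurable_shotNoise (fun i => measurable_equivDist_prodMk _ (hC i) (hM i))
    (measurable_cellularPower p)

variable [IsProbabilityMeasure μ]

theorem ae_pos_mem_Ioo (hY : IsMarkedPoisson Y xi (homogeneous p.lamB) (shadowLaw p.sigmaB) μ) :
    ∀ᵐ z ∂((radial p.rateB).prod (cellularDistLaw p Y xi μ)), 0 < z.1 ∧ z.2 ∈ Ioo 0 (tMax p) := by
  have := isProbabilityMeasure_cellularDistLaw hY
  exact (Measure.quasiMeasurePreserving_fst.ae (ae_pos_radial p.rateB)).and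
    (Measure.quasiMeasurePreserving_snd.ae (ae_mem_Ioo_cellularDistLaw hY))

theorem ae_cellularPower_pos
    (hY : IsMarkedPoisson Y xi (homogeneous p.lamB) (shadowLaw p.sigmaB) μ) :
    ∀ᵐ z ∂((radial p.rateB).prod (cellularDistLaw p Y xi μ)), 0 < cellularPower p z := by
  filter_upwards [ae_pos_mem_Ioo hY] with z hz
  exact cellularPower_pos p hz.1 hz.2.1

theorem lintegral_min_one_cellularPower_ne_top
    (hY : IsMarkedPoisson Y xi (homogeneous p.lamB) (shadowLaw p.sigmaB) μ) :
    ∫⁻ z, min 1 (ENNReal.ofReal (cellularPower p z))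
      ∂((radial p.rateB).prod (cellularDistLaw p Y xi μ)) ≠ ∞ := by
  have := isProbabilityMeasure_cellularDistLaw hY
  refine ne_top_of_le_ne_top (lintegral_min_one_rpow_radial_ne_top p.rateB_pos.le
    (txCellular p (tMax p) * p.AB) p.two_lt_alphaB) ?_
  calc ∫⁻ z, min 1 (ENNReal.ofReal (cellularPower p z))
        ∂((radial p.rateB).prod (cellularDistLaw p Y xi μ))
      ≤ ∫⁻ z, min 1 (ENNReal.ofReal (txCellular p (tMax p) * p.AB * z.1 ^ (-p.alphaB)))
          ∂((radial p.rateB).prod (cellularDistLaw p Y xi μ)) := by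
        refine lintegral_mono_ae ?_
        filter_upwards [ae_pos_mem_Ioo hY] with z ⟨h1, h2⟩
        have := txCellular_le_txCellular p h2.1 h2.2.le
        have := p.AB_pos
        unfold cellularPower
        gcongr
    _ = _ := by
        rw [lintegral_prod _ (by fun_prop)]
        simp

variable
  (hY : IsMarkedPoisson Y xi (homogeneous p.lamB) (shadowLaw p.sigmaB) μ)
  (hC : IsMarkedPoisson C M (homogeneous p.lamB)
    ((shadowLaw p.sigmaB).prod (cellularDistLaw p Y xi μ)) μ)

include hY hC

theorem hasPoissonFunctional_cellular :
    HasPoissonFunctional (fun i ω => (equivDist p.alphaB (C i ω) (M i ω).1, (M i ω).2))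
      ((radial p.rateB).prod (cellularDistLaw p Y xi μ)) μ :=
  have := isProbabilityMeasure_cellularDistLaw hY
  hC.hasPoissonFunctional_equivDist_mark p.lamB_pos.le p.alphaB

theorem ae_interfC_ne_zero_and_ne_top : ∀ᵐ ω ∂μ, interfC p C M ω ≠ 0 ∧ interfC p C M ω ≠ ∞ := by
  have hZ := hasPoissonFunctional_cellular hY hC
  filter_upwards [hZ.ae_forall (ae_cellularPower_pos hY),
    hZ.ae_shotNoise_ne_top (measurable_cellularPower p) (lintegral_min_one_cellularPower_ne_top hY)]
    with ω hpos hfin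
  rw [interfC_eq_shotNoise]
  exact ⟨fun h => (hpos 0).not_ge (ENNReal.ofReal_eq_zero.1 (ENNReal.tsum_eq_zero.1 h 0)), hfin⟩

theorem integral_exp_interfC (w r : ℝ) :
    ∫ ω, Complex.exp (-(Complex.I * (w / signal p r : ℝ) * ((interfC p C M ω).toReal : ℝ))) ∂μ =
      charC p w r := by
  have := isProbabilityMeasure_cellularDistLaw hY
  have hm := measurable_cellularPower p
  have nonneg := (ae_cellularPower_pos hY).mono fun z hz => hz.le
  have hint := lintegral_min_one_cellularPower_ne_top hY
  set s : ℝ := w / signal p r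
  rw [interfC_eq_shotNoise,
    (hasPoissonFunctional_cellular hY hC).integral_exp_shotNoise hm nonneg hint s,
    integral_prod _ (integrable_one_sub_exp hm nonneg hint s), integral_radial p.rateB_pos.le,
    charC, ← neg_mul]
  congr 2
  refine setIntegral_congr_fun measurableSet_Ioi fun τ _ => ?_
  congr 1
  have integrable_exp : Integrable
      (fun ρ => Complex.exp (-(Complex.I * s * (cellularPower p (τ, ρ) : ℝ))))
      (cellularDistLaw p Y xi μ) :=
    have hτ : Measurable fun ρ => cellularPower p (τ, ρ) := hm.comp measurable_prodMk_left
    .of_bound (Measurable.aestronglyMeasurable (by fun_prop)) 1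
      (.of_forall fun ρ => (norm_exp_neg_I_mul_mul s _).le)
  rw [integral_sub (integrable_const _) integrable_exp, integral_const, probReal_univ, one_smul,
    integral_cellularDistLaw hY]
  congr 1
  refine setIntegral_congr_fun measurableSet_Ioo fun ρ hρ => ?_
  simp only [cellularPower_eq p τ hρ.1, s]
  push_cast
  ring_nf

end CellularInterference

/-! ### D2D links -/

section DeviceLinks

instance : IsProbabilityMeasure fairCoin := by
  unfold fairCoin
  infer_instance

theorem fairCoin_singleton (b : Bool) : fairCoin {b} = 2⁻¹ := by
  unfold fairCoin
  rw [PMF.toMeasure_apply_singleton _ _ (measurableSet_singleton b)]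
  simp

theorem integral_fairCoin (f : Bool → ℂ) : ∫ b, f b ∂fairCoin = (f true + f false) / 2 := by
  unfold fairCoin
  rw [PMF.integral_eq_sum, Fintype.sum_bool]
  simp only [PMF.uniformOfFintype_apply, Fintype.card_bool, Complex.real_smul]
  norm_num
  ring

/-- The rate `π (1 - q) λ_u e_D`. The equivalent distances of the D2D users form a Poisson process
of intensity `radial (2 * p.rateD)`, half of which are transmitters. -/
def Params.rateD (p : Params) : ℝ :=
  Real.pi * (1 - qCellular p) * p.lamU * fadingFactor p.sigmaD p.alphaD

theorem Params.rateD_pos (p : Params) : 0 < p.rateD := by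
  have := p.lamU_pos
  have := sub_pos.2 (qCellular_lt_one p)
  have := fadingFactor_pos p.sigmaD p.alphaD
  unfold Params.rateD
  positivity

theorem Params.alphaD_pos (p : Params) : 0 < p.alphaD := two_pos.trans p.two_lt_alphaD

theorem signal_pos (p : Params) {r : ℝ} (hr : 0 < r) : 0 < signal p r :=
  mul_pos (mul_pos p.Pd_pos p.AD_pos) (Real.rpow_pos_of_pos hr _)

@[fun_prop]
theorem measurable_signal (p : Params) : Measurable (signal p) := by
  unfold signal
  fun_prop

/-- The power received from a D2D user at equivalent distance `z.1`, which is a transmitter if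
`z.2` holds. -/
def devicePower (p : Params) (z : ℝ × Bool) : ℝ := if z.2 then signal p z.1 else 0

theorem measurable_devicePower (p : Params) : Measurable (devicePower p) :=
  Measurable.ite (measurable_snd (measurableSet_singleton true))
    ((measurable_signal p).comp measurable_fst) measurable_const

theorem devicePower_nonneg (p : Params) {z : ℝ × Bool} (hz : 0 < z.1) : 0 ≤ devicePower p z := by
  unfold devicePower
  split_ifs
  exacts [(signal_pos p hz).le, le_rfl]

theorem ae_devicePower_nonneg (p : Params) (c : ℝ) :
    ∀ᵐ z ∂((radial c).prod fairCoin), 0 ≤ devicePower p z :=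
  (Measure.quasiMeasurePreserving_fst.ae (ae_pos_radial c)).mono fun _ => devicePower_nonneg p

theorem lintegral_min_one_devicePower_ne_top (p : Params) {c : ℝ} (hc : 0 ≤ c) :
    ∫⁻ z, min 1 (ENNReal.ofReal (devicePower p z)) ∂((radial c).prod fairCoin) ≠ ∞ := by
  refine ne_top_of_le_ne_top
    (lintegral_min_one_rpow_radial_ne_top hc (p.Pd * p.AD) p.two_lt_alphaD) ?_
  calc ∫⁻ z, min 1 (ENNReal.ofReal (devicePower p z)) ∂((radial c).prod fairCoin)
      ≤ ∫⁻ z, min 1 (ENNReal.ofReal (signal p z.1)) ∂((radial c).prod fairCoin) := by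
        refine lintegral_mono fun z => ?_
        unfold devicePower
        split_ifs
        · exact le_rfl
        · simp
    _ = ∫⁻ v, min 1 (ENNReal.ofReal (signal p v)) ∂(radial c) := by
        rw [lintegral_prod _ (by fun_prop)]
        simp only [lintegral_const, measure_univ, mul_one]

theorem integrableOn_one_sub_exp_signal (p : Params) (w : ℝ) :
    IntegrableOn (fun v : ℝ => (1 - Complex.exp (-(Complex.I * w * (signal p v : ℝ)))) * (v : ℂ))
      (Ioi 0) :=
  integrableOn_of_integrable_radial one_pos <| integrable_one_sub_exp (measurable_signal p)
    ((ae_pos_radial 1).mono fun _ hv => (signal_pos p hv).le)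
    (lintegral_min_one_rpow_radial_ne_top zero_le_one _ p.two_lt_alphaD) w

/-- The transmitters at equivalent distance at most `a`. -/
def nearTransmitters (a : ℝ) : Set (ℝ × Bool) := Iic a ×ˢ {true}

theorem measurableSet_nearTransmitters (a : ℝ) : MeasurableSet (nearTransmitters a) :=
  measurableSet_Iic.prod (measurableSet_singleton _)

theorem prod_nearTransmitters {c a : ℝ} (hc : 0 ≤ c) (ha : 0 ≤ a) :
    ((radial (2 * c)).prod fairCoin) (nearTransmitters a) = ENNReal.ofReal (c * a ^ 2 / 2) := by
  unfold nearTransmitters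
  rw [Measure.prod_prod, fairCoin_singleton, radial_Iic (by positivity) ha,
    ← ENNReal.ofReal_ofNat 2, ← ENNReal.ofReal_inv_of_pos two_pos,
    ← ENNReal.ofReal_mul (by positivity)]
  congr 1
  ring

/-- The exponent of the characteristic function of the power received from the transmitters at
equivalent distance more than `a`, up to the factor `-p.rateD`. -/
def deviceExponent (p : Params) (w a : ℝ) : ℂ :=
  ∫ v in Ioi a, (1 - Complex.exp (-(Complex.I * w * (signal p v : ℝ)))) * (v : ℂ)

/-- The characteristic function of the total power received from the transmitters, restricted to
the event that there is none within equivalent distance `a`. -/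
def deviceChar (p : Params) (w a : ℝ) : ℂ :=
  Complex.exp (-(p.rateD * (a ^ 2 / 2 + deviceExponent p w a)))

theorem setIntegral_compl_nearTransmitters (p : Params) (w : ℝ) {c a : ℝ} (hc : 0 ≤ c)
    (ha : 0 ≤ a) :
    ∫ z in (nearTransmitters a)ᶜ, (1 - Complex.exp (-(Complex.I * w * (devicePower p z : ℝ))))
      ∂((radial (2 * c)).prod fairCoin) = c * deviceExponent p w a := by
  have hA := (measurableSet_nearTransmitters a).compl
  have hint := (integrable_one_sub_exp (measurable_devicePower p) (ae_devicePower_nonneg p (2 * c))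
    (lintegral_min_one_devicePower_ne_top p (by positivity)) w).indicator hA
  have integral_coin (v : ℝ) : (∫ b, (nearTransmitters a)ᶜ.indicator
      (fun z => 1 - Complex.exp (-(Complex.I * w * (devicePower p z : ℝ)))) (v, b) ∂fairCoin) * v =
      (Ioi a).indicator (fun v : ℝ =>
        2⁻¹ * ((1 - Complex.exp (-(Complex.I * w * (signal p v : ℝ)))) * (v : ℂ))) v := by
    rw [integral_fairCoin]
    by_cases hv : a < v
    · simp [indicator, nearTransmitters, devicePower, hv]
      ring
    · simp [indicator, nearTransmitters, devicePower, hv, not_lt.1 hv]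
  rw [← integral_indicator hA, integral_prod _ hint, integral_radial (by positivity)]
  simp_rw [integral_coin]
  rw [setIntegral_indicator measurableSet_Ioi, Ioi_inter_Ioi, max_eq_right ha, integral_const_mul,
    deviceExponent]
  push_cast
  ring

theorem rxD2D_eq {Ω : Type*} (p : Params) (D : ℕ → Ω → Plane) (N : ℕ → Ω → ℝ × Bool) (ω : Ω) :
    rxD2D p D N ω = fun j => devicePower p (equivDist p.alphaD (D j ω) (N j ω).1, (N j ω).2) := by
  funext j
  unfold rxD2D
  rw [mul_fading_mul_norm_rpow p.alphaD_pos.ne']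
  rfl

/-- The total power received from the D2D transmitters, the serving one included. -/
def totalD {Ω : Type*} (p : Params) (D : ℕ → Ω → Plane) (N : ℕ → Ω → ℝ × Bool) (ω : Ω) : ℝ≥0∞ :=
  ∑' j, ENNReal.ofReal (rxD2D p D N ω j)

theorem totalD_eq_shotNoise {Ω : Type*} (p : Params) (D : ℕ → Ω → Plane) (N : ℕ → Ω → ℝ × Bool) :
    totalD p D N = shotNoise (devicePower p)
      fun i ω => (equivDist p.alphaD (D i ω) (N i ω).1, (N i ω).2) := by
  funext ω
  unfold totalD
  rw [rxD2D_eq]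
  rfl

theorem totalD_eq_add_interfD {Ω : Type*} (p : Params) (D : ℕ → Ω → Plane) (N : ℕ → Ω → ℝ × Bool)
    (ω : Ω) :
    totalD p D N ω = ENNReal.ofReal (rxD2D p D N ω (serving p D N ω)) + interfD p D N ω := by
  unfold totalD interfD
  rw [ENNReal.tsum_eq_add_tsum_ite (serving p D N ω)]
  congr! with j

theorem measurable_totalD {Ω : Type*} [MeasurableSpace Ω] (p : Params) {D : ℕ → Ω → Plane}
    {N : ℕ → Ω → ℝ × Bool} (hD : ∀ i, Measurable (D i)) (hN : ∀ i, Measurable (N i)) :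
    Measurable (totalD p D N) := by
  rw [totalD_eq_shotNoise]
  exact measurable_shotNoise (fun i => measurable_equivDist_prodMk _ (hD i) (hN i))
    (measurable_devicePower p)

theorem measurable_linkDist {Ω : Type*} [MeasurableSpace Ω] (p : Params) {D : ℕ → Ω → Plane}
    {N : ℕ → Ω → ℝ × Bool} (hD : ∀ i, Measurable (D i)) (hN : ∀ i, Measurable (N i)) :
    Measurable (linkDist p D N) := by
  have hZ (i : ℕ) := measurable_equivDist_prodMk p.alphaD (hD i) (hN i)
  refine measurable_apply_nat (fun k => (hZ k).fst) (measurable_strongest fun k => ?_)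
  simp_rw [rxD2D_eq]
  exact (measurable_devicePower p).comp (hZ k)

theorem rxD2D_serving {Ω : Type*} (p : Params) (D : ℕ → Ω → Plane) (N : ℕ → Ω → ℝ × Bool) (ω : Ω)
    (h : (N (serving p D N ω) ω).2 = true) :
    rxD2D p D N ω (serving p D N ω) = signal p (linkDist p D N ω) := by
  simp only [rxD2D_eq, devicePower, h, if_true]
  rfl

variable {Ω : Type*} [MeasurableSpace Ω] {μ : Measure Ω} [IsProbabilityMeasure μ] {p : Params}
  {D : ℕ → Ω → Plane} {N : ℕ → Ω → ℝ × Bool}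
  (hD : IsMarkedPoisson D N (homogeneous ((1 - qCellular p) * p.lamU))
    ((shadowLaw p.sigmaD).prod fairCoin) μ)

include hD

theorem hasPoissonFunctional_devices :
    HasPoissonFunctional (fun i ω => (equivDist p.alphaD (D i ω) (N i ω).1, (N i ω).2))
      ((radial (2 * p.rateD)).prod fairCoin) μ := by
  have rate_eq : 2 * Real.pi * ((1 - qCellular p) * p.lamU) * fadingFactor p.sigmaD p.alphaD =
      2 * p.rateD := by
    unfold Params.rateD
    ring
  rw [← rate_eq]
  exact hD.hasPoissonFunctional_equivDist_mark
    (mul_nonneg (sub_pos.2 (qCellular_lt_one p)).le p.lamU_pos.le) p.alphaD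

theorem measureReal_no_nearTransmitters {a : ℝ} (ha : 0 ≤ a) :
    μ.real {ω | ∀ i, (equivDist p.alphaD (D i ω) (N i ω).1, (N i ω).2) ∉ nearTransmitters a} =
      Real.exp (-(p.rateD * a ^ 2 / 2)) := by
  have hr := p.rateD_pos
  have prod_eq := prod_nearTransmitters hr.le ha
  rw [(hasPoissonFunctional_devices hD).measureReal_void (measurableSet_nearTransmitters a)
    (prod_eq ▸ ENNReal.ofReal_ne_top), measureReal_def, prod_eq,
    ENNReal.toReal_ofReal (by positivity)]

theorem ae_exists_transmitter : ∀ᵐ ω ∂μ, ∃ i, (N i ω).2 = true := by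
  have le_exp (a : ℝ) (ha : 0 ≤ a) : μ.real {ω | ¬ ∃ i, (N i ω).2 = true} ≤
      Real.exp (-(p.rateD * a ^ 2 / 2)) := by
    rw [← measureReal_no_nearTransmitters hD ha]
    exact measureReal_mono fun ω hω i hi => hω ⟨i, hi.2⟩
  refine (measureReal_eq_zero_iff).1 (le_antisymm ?_ measureReal_nonneg)
  exact ge_of_tendsto (tendsto_exp_neg_sq p.rateD_pos) ((eventually_ge_atTop 0).mono le_exp)

theorem ae_linkDist_spec :
    ∀ᵐ ω ∂μ, 0 < linkDist p D N ω ∧ totalD p D N ω ≠ ∞ ∧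
      rxD2D p D N ω (serving p D N ω) = signal p (linkDist p D N ω) ∧
      ∀ a, a < linkDist p D N ω ↔
        ∀ i, (equivDist p.alphaD (D i ω) (N i ω).1, (N i ω).2) ∉ nearTransmitters a := by
  have hr := p.rateD_pos
  have hZ := hasPoissonFunctional_devices hD
  filter_upwards [hZ.ae_forall (Measure.quasiMeasurePreserving_fst.ae (ae_pos_radial _)),
    hZ.ae_shotNoise_ne_top (measurable_devicePower p)
      (lintegral_min_one_devicePower_ne_top p (by positivity)), ae_exists_transmitter hD]
    with ω hpos hsum htrans
  have nearest : (N (serving p D N ω) ω).2 = true ∧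
      ∀ i, (N i ω).2 = true → linkDist p D N ω ≤ equivDist p.alphaD (D i ω) (N i ω).1 := by
    unfold linkDist serving
    rw [rxD2D_eq]
    exact dist_strongest_le (mul_pos p.Pd_pos p.AD_pos) p.alphaD_pos hpos htrans hsum
  rw [← totalD_eq_shotNoise] at hsum
  exact ⟨hpos _, hsum, rxD2D_serving p D N ω nearest.1, fun a =>
    ⟨fun ha i hi => (ha.trans_le (nearest.2 i hi.2)).not_ge hi.1,
      fun h => not_le.1 fun hle => h _ ⟨hle, nearest.1⟩⟩⟩

theorem lt_linkDist_ae_eq (a : ℝ) : {ω | a < linkDist p D N ω} =ᵐ[μ]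
    {ω | ∀ i, (equivDist p.alphaD (D i ω) (N i ω).1, (N i ω).2) ∉ nearTransmitters a} := by
  filter_upwards [ae_linkDist_spec hD] with ω hω
  exact propext (hω.2.2.2 a)

theorem map_linkDist : μ.map (linkDist p D N) = rayleigh p.rateD :=
  map_eq_rayleigh p.rateD_pos (measurable_linkDist p hD.poisson.measurable hD.measurable_mark)
    fun _ ha => (measureReal_congr (lt_linkDist_ae_eq hD _)).trans
      (measureReal_no_nearTransmitters hD ha)

theorem setIntegral_exp_totalD (w : ℝ) {a : ℝ} (ha : 0 ≤ a) :
    ∫ ω in {ω | a < linkDist p D N ω},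
        Complex.exp (-(Complex.I * w * ((totalD p D N ω).toReal : ℝ))) ∂μ =
      deviceChar p w a := by
  have hr := p.rateD_pos
  have prod_eq := prod_nearTransmitters hr.le ha
  rw [setIntegral_congr_set (lt_linkDist_ae_eq hD a), totalD_eq_shotNoise,
    (hasPoissonFunctional_devices hD).setIntegral_void_exp (measurableSet_nearTransmitters a)
      (prod_eq ▸ ENNReal.ofReal_ne_top) (measurable_devicePower p) (ae_devicePower_nonneg p _)
      (lintegral_min_one_devicePower_ne_top p (by positivity)),
    setIntegral_compl_nearTransmitters p w hr.le ha, measureReal_def, prod_eq,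
    ENNReal.toReal_ofReal (by positivity), deviceChar]
  push_cast
  ring_nf

end DeviceLinks

section DeviceChar

theorem continuousAt_signal (p : Params) {r : ℝ} (hr : 0 < r) : ContinuousAt (signal p) r :=
  continuousAt_const.mul (Real.continuousAt_rpow_const _ _ (Or.inl hr.ne'))

theorem one_sub_exp_signal_mul_re (p : Params) (w v : ℝ) :
    ((1 - Complex.exp (-(Complex.I * w * (signal p v : ℝ)))) * (v : ℂ)).re =
      (1 - Real.cos (w * signal p v)) * v := by
  have exp_eq : -(Complex.I * w * (signal p v : ℝ)) =
      ((-(w * signal p v) : ℝ) : ℂ) * Complex.I := by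
    push_cast
    ring
  rw [Complex.re_mul_ofReal, Complex.sub_re, Complex.one_re, exp_eq, Complex.exp_ofReal_mul_I_re,
    Real.cos_neg]

theorem deviceExponent_re (p : Params) (w : ℝ) {a : ℝ} (ha : 0 ≤ a) :
    (deviceExponent p w a).re = ∫ v in Ioi a, (1 - Real.cos (w * signal p v)) * v := by
  rw [deviceExponent, ← RCLike.re_to_complex, ← integral_re
    ((integrableOn_one_sub_exp_signal p w).mono_set (Ioi_subset_Ioi ha))]
  simp only [RCLike.re_to_complex, one_sub_exp_signal_mul_re]

theorem deviceExponent_re_nonneg (p : Params) (w : ℝ) {a : ℝ} (ha : 0 ≤ a) :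
    0 ≤ (deviceExponent p w a).re := by
  rw [deviceExponent_re p w ha]
  exact setIntegral_nonneg measurableSet_Ioi fun v (hv : a < v) =>
    mul_nonneg (sub_nonneg.2 (Real.cos_le_one _)) (ha.trans hv.le)

theorem deviceExponent_eq_sub (p : Params) (w : ℝ) {a r : ℝ} (ha : 0 ≤ a) (hr : 0 ≤ r) :
    deviceExponent p w r = deviceExponent p w a - ∫ v in a..r,
      (1 - Complex.exp (-(Complex.I * w * (signal p v : ℝ)))) * (v : ℂ) := by
  have integrable := integrableOn_one_sub_exp_signal p w
  rw [← intervalIntegral.integral_Ioi_sub_Ioi' (integrable.mono_set (Ioi_subset_Ioi ha))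
    (integrable.mono_set (Ioi_subset_Ioi hr)), deviceExponent, deviceExponent, sub_sub_cancel]

theorem hasDerivAt_deviceExponent (p : Params) (w : ℝ) {r : ℝ} (hr : 0 < r) :
    HasDerivAt (deviceExponent p w)
      (-((1 - Complex.exp (-(Complex.I * w * (signal p r : ℝ)))) * (r : ℂ))) r := by
  have := (measurable_signal p).complex_ofReal
  have hcont : ContinuousAt (fun v : ℝ =>
      (1 - Complex.exp (-(Complex.I * w * (signal p v : ℝ)))) * (v : ℂ)) r := by
    have := continuousAt_signal p hr
    fun_prop
  have deriv_integral := (intervalIntegral.integral_hasDerivAt_right (a := r)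
    IntervalIntegrable.refl
    (Measurable.stronglyMeasurable (by fun_prop)).stronglyMeasurableAtFilter hcont).const_sub
      (deviceExponent p w r)
  refine deriv_integral.congr_of_eventuallyEq ?_
  filter_upwards [Ioi_mem_nhds hr] with v hv
  exact deviceExponent_eq_sub p w hr.le (le_of_lt hv)

theorem continuousWithinAt_deviceExponent (p : Params) (w : ℝ) {a : ℝ} (ha : 0 ≤ a) :
    ContinuousWithinAt (deviceExponent p w) (Ici a) a := by
  have hint : IntegrableOn (fun v : ℝ =>
      (1 - Complex.exp (-(Complex.I * w * (signal p v : ℝ)))) * (v : ℂ)) (uIcc a (a + 1)) := by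
    rw [uIcc_of_le (by simp), integrableOn_Icc_iff_integrableOn_Ioc]
    exact (integrableOn_one_sub_exp_signal p w).mono_set fun v hv => ha.trans_lt hv.1
  have hcont := intervalIntegral.continuousOn_primitive_interval hint a left_mem_uIcc
  rw [uIcc_of_le (by simp)] at hcont
  refine (continuousWithinAt_const.sub (hcont.mono_of_mem_nhdsWithin
    (Icc_mem_nhdsGE (by simp)))).congr (fun r hr => deviceExponent_eq_sub p w ha (ha.trans hr))
      (deviceExponent_eq_sub p w ha ha)

theorem norm_deviceChar (p : Params) (w a : ℝ) :
    ‖deviceChar p w a‖ = Real.exp (-(p.rateD * (a ^ 2 / 2 + (deviceExponent p w a).re))) := by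
  have : (a ^ 2 / 2 : ℂ) = ((a ^ 2 / 2 : ℝ) : ℂ) := by push_cast; rfl
  rw [deviceChar, Complex.norm_exp, this, Complex.neg_re, Complex.re_ofReal_mul, Complex.add_re,
    Complex.ofReal_re]

theorem norm_deviceChar_le (p : Params) (w : ℝ) {a : ℝ} (ha : 0 ≤ a) :
    ‖deviceChar p w a‖ ≤ Real.exp (-(p.rateD * a ^ 2 / 2)) := by
  have re_nonneg := mul_nonneg p.rateD_pos.le (deviceExponent_re_nonneg p w ha)
  rw [norm_deviceChar]
  exact Real.exp_le_exp.2 (by linarith)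

theorem hasDerivAt_deviceChar (p : Params) (w : ℝ) {r : ℝ} (hr : 0 < r) :
    HasDerivAt (deviceChar p w) (-(Complex.exp (-(Complex.I * w * (signal p r : ℝ))) *
      ((p.rateD * r : ℝ) : ℂ) * deviceChar p w r)) r := by
  have hasDerivAt_sq : HasDerivAt (fun r : ℝ => (r : ℂ) ^ 2 / 2) (r : ℂ) r :=
    ((hasDerivAt_pow 2 (r : ℂ)).comp_ofReal.div_const 2).congr_deriv (by push_cast; ring)
  refine ((hasDerivAt_sq.add (hasDerivAt_deviceExponent p w hr)).const_mul
    (p.rateD : ℂ)).neg.cexp.congr_deriv ?_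
  simp only [deviceChar, Pi.add_apply, Pi.neg_apply]
  push_cast
  ring

theorem integrableOn_deviceChar (p : Params) (w : ℝ) {a : ℝ} (ha : 0 ≤ a) :
    IntegrableOn (fun r : ℝ => Complex.exp (-(Complex.I * w * (signal p r : ℝ))) *
      ((p.rateD * r : ℝ) : ℂ) * deviceChar p w r) (Ioi a) := by
  have hr := p.rateD_pos
  refine Integrable.mono' (integrableOn_mul_exp_neg_sq hr ha) ?_ ?_
  · refine ContinuousOn.aestronglyMeasurable (fun r (h : a < r) => ?_) measurableSet_Ioi
    have := continuousAt_signal p (ha.trans_lt h)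
    have := (hasDerivAt_deviceChar p w (ha.trans_lt h)).continuousAt
    exact ContinuousAt.continuousWithinAt (by fun_prop)
  · filter_upwards [ae_restrict_mem measurableSet_Ioi] with r (h : a < r)
    have h0 : 0 ≤ r := ha.trans h.le
    rw [norm_mul, norm_mul, norm_exp_neg_I_mul_mul, one_mul, Complex.norm_real,
      Real.norm_of_nonneg (by positivity)]
    exact mul_le_mul_of_nonneg_left (norm_deviceChar_le p w h0) (by positivity)

theorem deviceChar_eq_integral (p : Params) (w : ℝ) {a : ℝ} (ha : 0 ≤ a) :
    deviceChar p w a = ∫ r in Ioi a, Complex.exp (-(Complex.I * w * (signal p r : ℝ))) *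
      ((p.rateD * r : ℝ) : ℂ) * deviceChar p w r := by
  have hcont : ContinuousWithinAt (deviceChar p w) (Ici a) a := by
    have := continuousWithinAt_deviceExponent p w ha
    unfold deviceChar
    fun_prop
  have hlim : Tendsto (deviceChar p w) atTop (𝓝 0) :=
    squeeze_zero_norm' ((eventually_ge_atTop 0).mono fun r h => norm_deviceChar_le p w h)
      (tendsto_exp_neg_sq p.rateD_pos)
  have ftc := integral_Ioi_of_hasDerivAt_of_tendsto hcont
    (fun r h => hasDerivAt_deviceChar p w (ha.trans_lt h)) (integrableOn_deviceChar p w ha).neg hlim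
  rw [integral_neg, zero_sub] at ftc
  exact (neg_injective ftc).symm

end DeviceChar

/-! ### Conditional characteristic functions -/

section CondDistrib

variable {Ω : Type*} [MeasurableSpace Ω] {μ : Measure Ω} [IsFiniteMeasure μ] {R : Ω → ℝ}

theorem ae_eq_of_forall_setIntegral_Ioi_eq {m : Measure ℝ} (hm : ∀ᵐ r ∂m, 0 < r) {f g : ℝ → ℂ}
    (hf : Integrable f m) (hg : Integrable g m)
    (h : ∀ a, 0 ≤ a → ∫ r in Ioi a, f r ∂m = ∫ r in Ioi a, g r ∂m) : f =ᵐ[m] g := by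
  have hIoi (a : ℝ) : ∫ r in Ioi a, f r ∂m = ∫ r in Ioi a, g r ∂m := by
    have hmax : (Ioi a : Set ℝ) =ᵐ[m] Ioi (max a 0) := by
      filter_upwards [hm] with r hr
      exact propext (show a < r ↔ max a 0 < r by simp [hr])
    rw [setIntegral_congr_set hmax, setIntegral_congr_set hmax, h _ (le_max_right a 0)]
  have huniv : (univ : Set ℝ) =ᵐ[m] Ioi 0 := by
    filter_upwards [hm] with r hr
    exact propext (show True ↔ 0 < r by simp [hr])
  refine hf.ae_eq_of_withDensityᵥ_eq hg (VectorMeasure.ext_of_generateFrom (range Ioi) ?_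
    (BorelSpace.measurable_eq.trans (borel_eq_generateFrom_Ioi ℝ)) isPiSystem_Ioi ?_)
  · rintro _ ⟨a, rfl⟩
    rw [withDensityᵥ_apply hf measurableSet_Ioi, withDensityᵥ_apply hg measurableSet_Ioi, hIoi]
  · rw [withDensityᵥ_apply hf .univ, withDensityᵥ_apply hg .univ, setIntegral_congr_set huniv,
      setIntegral_congr_set huniv, hIoi]

theorem setIntegral_integral_condDistrib {Z : Ω → ℝ} (hR : Measurable R) (hZ : Measurable Z)
    {f : ℝ → ℂ} (hf : StronglyMeasurable f) (hint : Integrable (fun ω => f (Z ω)) μ) {A : Set ℝ}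
    (hA : MeasurableSet A) :
    ∫ r in A, ∫ z, f z ∂condDistrib Z R μ r ∂(μ.map R) = ∫ ω in R ⁻¹' A, f (Z ω) ∂μ := by
  calc ∫ r in A, ∫ z, f z ∂condDistrib Z R μ r ∂(μ.map R)
      = ∫ ω in R ⁻¹' A, ∫ z, f z ∂condDistrib Z R μ (R ω) ∂μ :=
        setIntegral_map hA
          (hf.comp_measurable measurable_snd).integral_condDistrib.aestronglyMeasurable
          hR.aemeasurable
    _ = ∫ ω in R ⁻¹' A, (μ[fun ω => f (Z ω) | MeasurableSpace.comap R inferInstance]) ω ∂μ :=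
        setIntegral_congr_ae (hR hA)
          ((condExp_ae_eq_integral_condDistrib hR hZ.aemeasurable hf hint).mono
            fun _ h _ => h.symm)
    _ = ∫ ω in R ⁻¹' A, f (Z ω) ∂μ := setIntegral_condExp hR.comap_le hint ⟨A, hA, rfl⟩

theorem continuous_integral_exp_neg_I_mul_mul (ν : Measure Ω) [IsFiniteMeasure ν] {Z : Ω → ℝ}
    (hZ : Measurable Z) : Continuous fun w : ℝ => ∫ ω, Complex.exp (-(Complex.I * w * Z ω)) ∂ν :=
  continuous_of_dominated (bound := fun _ => 1)
    (fun _ => Measurable.aestronglyMeasurable (by fun_prop))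
    (fun _ => .of_forall fun _ => (norm_exp_neg_I_mul_mul _ _).le) (integrable_const _)
    (.of_forall fun _ => by fun_prop)

theorem ae_forall_integral_exp_condDistrib {Z : Ω → ℝ} (hR : Measurable R) (hZ : Measurable Z)
    (hR0 : ∀ᵐ r ∂μ.map R, 0 < r) {K : ℝ → ℝ → ℂ} (hKc : ∀ r, 0 < r → Continuous fun w => K w r)
    (hKi : ∀ w, Integrable (K w) (μ.map R))
    (hK : ∀ w a : ℝ, 0 ≤ a → ∫ ω in R ⁻¹' Ioi a, Complex.exp (-(Complex.I * w * Z ω)) ∂μ =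
      ∫ r in Ioi a, K w r ∂(μ.map R)) :
    ∀ᵐ r ∂μ.map R, ∀ w : ℝ,
      ∫ z, Complex.exp (-(Complex.I * w * z)) ∂condDistrib Z R μ r = K w r := by
  have hfixed (w : ℝ) : ∀ᵐ r ∂μ.map R,
      ∫ z, Complex.exp (-(Complex.I * w * z)) ∂condDistrib Z R μ r = K w r := by
    have hf : StronglyMeasurable fun z : ℝ => Complex.exp (-(Complex.I * w * z)) :=
      Measurable.stronglyMeasurable (by fun_prop)
    have hint : Integrable (fun ω => Complex.exp (-(Complex.I * w * Z ω))) μ :=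
      .of_bound (hf.comp_measurable hZ).aestronglyMeasurable 1
        (.of_forall fun _ => (norm_exp_neg_I_mul_mul _ _).le)
    have hprod : StronglyMeasurable fun x : ℝ × ℝ => Complex.exp (-(Complex.I * w * x.2)) :=
      hf.comp_measurable measurable_snd
    refine ae_eq_of_forall_setIntegral_Ioi_eq hR0 (.of_bound
      hprod.integral_condDistrib.aestronglyMeasurable 1 (.of_forall fun r => ?_)) (hKi w)
      fun a ha => ?_
    · exact (norm_integral_le_of_norm_le_const
        (.of_forall fun z => (norm_exp_neg_I_mul_mul w z).le)).trans (by simp)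
    · rw [setIntegral_integral_condDistrib hR hZ hf hint measurableSet_Ioi, hK w a ha]
  filter_upwards [hR0, ae_all_iff.2 fun q : ℚ => hfixed q] with r hr hq
  exact congrFun (Rat.denseRange_cast.equalizer
    (continuous_integral_exp_neg_I_mul_mul _ measurable_id) (hKc r hr) (funext hq))

end CondDistrib

/-! ### The total received power given the link distance -/

section TotalPower

variable {Ω : Type*} [MeasurableSpace Ω] {μ : Measure Ω} [IsProbabilityMeasure μ] {p : Params}
  {Y : ℕ → Ω → Plane} {xi : ℕ → Ω → ℝ} {C : ℕ → Ω → Plane} {M : ℕ → Ω → ℝ × ℝ}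
  {D : ℕ → Ω → Plane} {N : ℕ → Ω → ℝ × Bool}

/-- The total power at the typical receiver, signal and noise included. Unlike the interference,
it does not single out the serving transmitter. -/
def totalPower (p : Params) {Ω : Type*} (C : ℕ → Ω → Plane) (M : ℕ → Ω → ℝ × ℝ)
    (D : ℕ → Ω → Plane) (N : ℕ → Ω → ℝ × Bool) (ω : Ω) : ℝ :=
  (totalD p D N ω).toReal + (interfC p C M ω).toReal + p.eta

theorem measurable_totalPower (hC : ∀ i, Measurable (C i)) (hM : ∀ i, Measurable (M i))
    (hD : ∀ i, Measurable (D i)) (hN : ∀ i, Measurable (N i)) :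
    Measurable (totalPower p C M D N) :=
  ((measurable_totalD p hD hN).ennreal_toReal.add
    (measurable_interfC hC hM).ennreal_toReal).add_const _

omit [IsProbabilityMeasure μ] in
theorem indepFun_linkDist_totalD_interfC
    (hCD : IndepFun (fun ω i => (C i ω, M i ω)) (fun ω j => (D j ω, N j ω)) μ) :
    IndepFun (fun ω => (linkDist p D N ω, totalD p D N ω)) (interfC p C M) μ := by
  have hD : Measurable fun s : ℕ → Plane × ℝ × Bool =>
      (linkDist p (fun j s => (s j).1) (fun j s => (s j).2) s,
        totalD p (fun j s => (s j).1) (fun j s => (s j).2) s) :=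
    (measurable_linkDist p (fun _ => by fun_prop) (fun _ => by fun_prop)).prodMk
      (measurable_totalD p (fun _ => by fun_prop) (fun _ => by fun_prop))
  have hC : Measurable fun s : ℕ → Plane × ℝ × ℝ =>
      interfC p (fun j s => (s j).1) (fun j s => (s j).2) s :=
    measurable_interfC (fun _ => by fun_prop) (fun _ => by fun_prop)
  exact hCD.symm.comp hD hC

theorem setIntegral_exp_totalPower
    (hC : ∀ i, Measurable (C i)) (hM : ∀ i, Measurable (M i))
    (hD : IsMarkedPoisson D N (homogeneous ((1 - qCellular p) * p.lamU))
      ((shadowLaw p.sigmaD).prod fairCoin) μ)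
    (hCD : IndepFun (fun ω i => (C i ω, M i ω)) (fun ω j => (D j ω, N j ω)) μ) (w : ℝ) {a : ℝ}
    (ha : 0 ≤ a) :
    ∫ ω in linkDist p D N ⁻¹' Ioi a, Complex.exp (-(Complex.I * w * totalPower p C M D N ω)) ∂μ =
      deviceChar p w a *
        (∫ ω, Complex.exp (-(Complex.I * w * (interfC p C M ω).toReal)) ∂μ) *
          Complex.exp (-(Complex.I * w * p.eta)) := by
  have hR := measurable_linkDist p hD.poisson.measurable hD.measurable_mark
  have hT := measurable_totalD p hD.poisson.measurable hD.measurable_mark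
  let φ : ℝ × ℝ≥0∞ → ℂ :=
    (Ioi a ×ˢ univ).indicator fun x => Complex.exp (-(Complex.I * w * x.2.toReal))
  let ψ : ℝ≥0∞ → ℂ := fun x => Complex.exp (-(Complex.I * w * x.toReal))
  have hφ : Measurable φ := Measurable.indicator (by fun_prop) (measurableSet_Ioi.prod .univ)
  have hψ : Measurable ψ := by fun_prop
  have hdevice : ∫ ω, φ (linkDist p D N ω, totalD p D N ω) ∂μ = deviceChar p w a := by
    rw [← setIntegral_exp_totalD hD w ha,
      ← integral_indicator (measurableSet_lt measurable_const hR)]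
    simp only [φ, indicator, mem_prod, mem_Ioi, mem_univ, and_true, mem_ofPred_eq]
  have hindep :=
    ((indepFun_linkDist_totalD_interfC hCD).comp hφ hψ).integral_fun_mul_eq_mul_integral
      (hφ.comp (hR.prodMk hT)).aestronglyMeasurable
      (hψ.comp (measurable_interfC hC hM)).aestronglyMeasurable
  rw [← hdevice, ← integral_indicator (hR measurableSet_Ioi)]
  refine Eq.trans ?_ (congrArg (· * Complex.exp (-(Complex.I * w * p.eta))) hindep)
  rw [← integral_mul_const]
  refine integral_congr_ae (.of_forall fun ω => ?_)
  by_cases h : a < linkDist p D N ω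
  · simp only [φ, ψ, totalPower, Function.comp_apply, indicator, mem_preimage, mem_prod, mem_Ioi,
      mem_univ, h, and_true, if_true, ← Complex.exp_add, Complex.ofReal_add]
    ring_nf
  · simp only [φ, Function.comp_apply, indicator, mem_preimage, mem_prod, mem_Ioi, h, false_and,
      if_false, zero_mul]

theorem charD_mul_signal (p : Params) (w : ℝ) {r : ℝ} (hr : 0 < r) :
    charD p (w * signal p r) r = deviceChar p w r * Complex.exp (p.rateD * r ^ 2 / 2) := by
  have := Real.rpow_pos_of_pos hr (-p.alphaD)
  have hexponent : deviceExponent p w r = ∫ L in Ioi r, (1 - Complex.exp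
      (-(Complex.I * (w * signal p r : ℝ) * (L ^ (-p.alphaD) / r ^ (-p.alphaD) : ℝ)))) * L := by
    refine setIntegral_congr_fun measurableSet_Ioi fun L _ => ?_
    have : w * signal p L = w * signal p r * (L ^ (-p.alphaD) / r ^ (-p.alphaD)) := by
      unfold signal
      field_simp
    simp only [mul_assoc, ← Complex.ofReal_mul, this]
  rw [charD, ← hexponent, deviceChar, ← Complex.exp_add, Params.rateD]
  congr 1
  push_cast
  ring

/-- The conditional characteristic function of the total power at a link of equivalent
distance `r`. -/
def totalPowerChar (p : Params) (w r : ℝ) : ℂ :=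
  Complex.exp (-(Complex.I * w * signal p r)) * charInvSinr p (w * signal p r) r

variable (hY : IsMarkedPoisson Y xi (homogeneous p.lamB) (shadowLaw p.sigmaB) μ)
  (hC : IsMarkedPoisson C M (homogeneous p.lamB)
    ((shadowLaw p.sigmaB).prod (cellularDistLaw p Y xi μ)) μ)
  (hD : IsMarkedPoisson D N (homogeneous ((1 - qCellular p) * p.lamU))
    ((shadowLaw p.sigmaD).prod fairCoin) μ)
  (hCD : IndepFun (fun ω i => (C i ω, M i ω)) (fun ω j => (D j ω, N j ω)) μ)

include hY hC in
theorem norm_charInvSinr_le_norm_charD (w r : ℝ) : ‖charInvSinr p w r‖ ≤ ‖charD p w r‖ := by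
  have norm_charC_le_one : ‖charC p w r‖ ≤ 1 := by
    rw [← integral_exp_interfC hY hC]
    exact (norm_integral_le_of_norm_le_const
      (.of_forall fun ω => (norm_exp_neg_I_mul_mul _ _).le)).trans (by simp)
  rw [charInvSinr, norm_mul, norm_mul, norm_exp_neg_I_mul_mul, mul_one]
  exact mul_le_of_le_one_left (norm_nonneg _) norm_charC_le_one

include hY hC hD in
theorem continuous_charInvSinr {r : ℝ} (hr : 0 < r) : Continuous fun w => charInvSinr p w r := by
  have hs := (signal_pos p hr).ne'
  have charC_eq (w : ℝ) := (integral_exp_interfC hY hC w r).symm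
  have charD_eq (w : ℝ) : charD p w r =
      (∫ ω in {ω | r < linkDist p D N ω}, Complex.exp (-(Complex.I * (w / signal p r : ℝ) *
        ((totalD p D N ω).toReal : ℝ))) ∂μ) * Complex.exp (p.rateD * r ^ 2 / 2) := by
    rw [setIntegral_exp_totalD hD _ hr.le, ← charD_mul_signal p _ hr, div_mul_cancel₀ w hs]
  have hinterf := continuous_integral_exp_neg_I_mul_mul μ
    (measurable_interfC hC.poisson.measurable hC.measurable_mark (p := p)).ennreal_toReal
  have htotal := continuous_integral_exp_neg_I_mul_mul (μ.restrict {ω | r < linkDist p D N ω})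
    (measurable_totalD p hD.poisson.measurable hD.measurable_mark).ennreal_toReal
  have hdiv : Continuous fun w : ℝ => w / signal p r := continuous_id.div_const _
  simp only [charInvSinr, charC_eq, charD_eq]
  exact ((hinterf.comp hdiv).mul ((htotal.comp hdiv).mul_const _)).mul (by fun_prop)

include hY hC in
theorem totalPowerChar_eq (w : ℝ) {r : ℝ} (hr : 0 < r) :
    totalPowerChar p w r = Complex.exp (-(Complex.I * w * signal p r)) * deviceChar p w r *
      Complex.exp (p.rateD * r ^ 2 / 2) *
        ((∫ ω, Complex.exp (-(Complex.I * w * (interfC p C M ω).toReal)) ∂μ) *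
          Complex.exp (-(Complex.I * w * p.eta))) := by
  have hs := (signal_pos p hr).ne'
  have hsC : (signal p r : ℂ) ≠ 0 := by exact_mod_cast hs
  have charC_eq := (integral_exp_interfC hY hC (w * signal p r) r).symm
  rw [mul_div_cancel_right₀ w hs] at charC_eq
  have noise_eq : Complex.I * (w * signal p r : ℝ) * (p.eta / signal p r : ℝ) =
      Complex.I * w * p.eta := by
    push_cast
    field_simp
  rw [totalPowerChar, charInvSinr, charD_mul_signal p w hr, charC_eq, noise_eq]
  ring

include hY hC in
theorem integrable_totalPowerChar (w : ℝ) :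
    Integrable (totalPowerChar p w) (rayleigh p.rateD) := by
  have := isProbabilityMeasure_rayleigh p.rateD_pos
  have hcont : ContinuousOn (fun r => Complex.exp (-(Complex.I * w * signal p r)) *
      deviceChar p w r * Complex.exp (p.rateD * r ^ 2 / 2) *
        ((∫ ω, Complex.exp (-(Complex.I * w * (interfC p C M ω).toReal)) ∂μ) *
          Complex.exp (-(Complex.I * w * p.eta)))) (Ioi 0) := fun r hr => by
    have := continuousAt_signal p hr
    have := (hasDerivAt_deviceChar p w hr).continuousAt
    exact ContinuousAt.continuousWithinAt (by fun_prop)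
  refine .of_bound (((hcont.aestronglyMeasurable measurableSet_Ioi).mono_ac
    (withDensity_absolutelyContinuous _ _)).congr ?_) 1 ?_
  · filter_upwards [ae_pos_rayleigh p.rateD] with r hr
    exact (totalPowerChar_eq hY hC w hr).symm
  · filter_upwards [ae_pos_rayleigh p.rateD] with r hr
    have norm_exp_sq : ‖Complex.exp (p.rateD * r ^ 2 / 2)‖ = Real.exp (p.rateD * r ^ 2 / 2) := by
      rw [Complex.norm_exp]
      norm_cast
    calc ‖totalPowerChar p w r‖ = ‖charInvSinr p (w * signal p r) r‖ := by
          rw [totalPowerChar, norm_mul, norm_exp_neg_I_mul_mul, one_mul]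
      _ ≤ ‖charD p (w * signal p r) r‖ := norm_charInvSinr_le_norm_charD hY hC _ r
      _ ≤ Real.exp (-(p.rateD * r ^ 2 / 2)) * Real.exp (p.rateD * r ^ 2 / 2) := by
          rw [charD_mul_signal p w hr, norm_mul, norm_exp_sq]
          gcongr
          exact norm_deviceChar_le p w (le_of_lt hr)
      _ = 1 := by rw [← Real.exp_add, neg_add_cancel, Real.exp_zero]

include hY hC hD hCD in
theorem setIntegral_exp_totalPower_eq_totalPowerChar (w : ℝ) {a : ℝ} (ha : 0 ≤ a) :
    ∫ ω in linkDist p D N ⁻¹' Ioi a, Complex.exp (-(Complex.I * w * totalPower p C M D N ω)) ∂μ =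
      ∫ r in Ioi a, totalPowerChar p w r ∂(rayleigh p.rateD) := by
  rw [setIntegral_exp_totalPower hC.poisson.measurable hC.measurable_mark hD hCD w ha,
    deviceChar_eq_integral p w ha, mul_assoc, ← integral_mul_const,
    setIntegral_Ioi_rayleigh p.rateD_pos ha]
  refine setIntegral_congr_fun measurableSet_Ioi fun r (hr : a < r) => ?_
  have hexp : Complex.exp (-(p.rateD * r ^ 2 / 2)) * Complex.exp (p.rateD * r ^ 2 / 2) = 1 := by
    rw [← Complex.exp_add, neg_add_cancel, Complex.exp_zero]
  rw [totalPowerChar_eq hY hC w (ha.trans_lt hr)]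
  push_cast
  linear_combination (-(Complex.exp (-(Complex.I * w * signal p r)) * (p.rateD * r) *
    deviceChar p w r * ((∫ ω, Complex.exp (-(Complex.I * w * (interfC p C M ω).toReal)) ∂μ) *
      Complex.exp (-(Complex.I * w * p.eta))))) * hexp

include hY hC hD hCD in
theorem ae_forall_integral_exp_condDistrib_totalPower :
    ∀ᵐ r ∂rayleigh p.rateD, ∀ w : ℝ, ∫ z, Complex.exp (-(Complex.I * w * z))
      ∂condDistrib (totalPower p C M D N) (linkDist p D N) μ r = totalPowerChar p w r := by
  have hmap := map_linkDist hD
  have hcont (r : ℝ) (hr : 0 < r) : Continuous fun w => totalPowerChar p w r := by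
    have := continuous_charInvSinr hY hC hD hr
    unfold totalPowerChar
    exact Continuous.mul (by fun_prop) (this.comp (continuous_id.mul continuous_const))
  rw [← hmap]
  refine ae_forall_integral_exp_condDistrib
    (measurable_linkDist p hD.poisson.measurable hD.measurable_mark)
    (measurable_totalPower hC.poisson.measurable hC.measurable_mark hD.poisson.measurable
      hD.measurable_mark) ?_ hcont ?_ ?_ <;> rw [hmap]
  · exact ae_pos_rayleigh p.rateD
  · exact integrable_totalPowerChar hY hC
  · exact fun w a ha => setIntegral_exp_totalPower_eq_totalPowerChar hY hC hD hCD w ha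

end TotalPower

/-! ### The inverse SINR given the link distance -/

theorem condDistrib_comp_prodMk_ae_eq {Ω β γ δ : Type*} [MeasurableSpace Ω] [MeasurableSpace β]
    [MeasurableSpace γ] [StandardBorelSpace γ] [Nonempty γ] [MeasurableSpace δ]
    [StandardBorelSpace δ] [Nonempty δ] {μ : Measure Ω} [IsFiniteMeasure μ] {R : Ω → β} {Z : Ω → γ}
    (hR : Measurable R) (hZ : Measurable Z) {g : β × γ → δ} (hg : Measurable g) :
    ∀ᵐ r ∂μ.map R, condDistrib (fun ω => g (R ω, Z ω)) R μ r =
      (condDistrib Z R μ r).map fun z => g (r, z) := by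
  let κ : Kernel β δ := (Kernel.id ×ₖ condDistrib Z R μ).map g
  have hκ (r : β) : κ r = (condDistrib Z R μ r).map fun z => g (r, z) := by
    rw [Kernel.map_apply _ hg, Kernel.prod_apply, Kernel.id_apply, Measure.dirac_prod,
      Measure.map_map hg measurable_prodMk_left]
    rfl
  have hpair : μ.map (fun ω => (R ω, g (R ω, Z ω))) = μ.map R ⊗ₘ κ := by
    have hfst : Measurable fun x : β × γ => (x.1, g x) := by fun_prop
    rw [show (fun ω => (R ω, g (R ω, Z ω))) = (fun x => (x.1, g x)) ∘ fun ω => (R ω, Z ω) from rfl,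
      ← Measure.map_map hfst (hR.prodMk hZ), ← compProd_map_condDistrib hZ.aemeasurable]
    refine Measure.ext_of_lintegral _ fun f hf => ?_
    rw [lintegral_map hf hfst, Measure.lintegral_compProd (by fun_prop),
      Measure.lintegral_compProd hf]
    refine lintegral_congr fun r => ?_
    rw [hκ, lintegral_map (by fun_prop) (by fun_prop)]
  filter_upwards [condDistrib_ae_eq_of_measure_eq_compProd R (by fun_prop) hpair] with r hr
  rw [hr, hκ]

section InvSinr

variable {Ω : Type*} [MeasurableSpace Ω] {μ : Measure Ω} [IsProbabilityMeasure μ] {p : Params}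
  {Y : ℕ → Ω → Plane} {xi : ℕ → Ω → ℝ} {C : ℕ → Ω → Plane} {M : ℕ → Ω → ℝ × ℝ}
  {D : ℕ → Ω → Plane} {N : ℕ → Ω → ℝ × Bool}

/-- The real-valued inverse of the SINR; its value on the null event `SINR = 0` is the junk
value `0`. -/
def invSinr (p : Params) {Ω : Type*} (C : ℕ → Ω → Plane) (M : ℕ → Ω → ℝ × ℝ)
    (D : ℕ → Ω → Plane) (N : ℕ → Ω → ℝ × Bool) (ω : Ω) : ℝ :=
  (sinr p C M D N ω)⁻¹.toReal

variable (hY : IsMarkedPoisson Y xi (homogeneous p.lamB) (shadowLaw p.sigmaB) μ)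
  (hC : IsMarkedPoisson C M (homogeneous p.lamB)
    ((shadowLaw p.sigmaB).prod (cellularDistLaw p Y xi μ)) μ)
  (hD : IsMarkedPoisson D N (homogeneous ((1 - qCellular p) * p.lamU))
    ((shadowLaw p.sigmaD).prod fairCoin) μ)
  (hCD : IndepFun (fun ω i => (C i ω, M i ω)) (fun ω j => (D j ω, N j ω)) μ)

include hY hC hD

theorem ae_sinr_ne_zero_and_ne_top :
    ∀ᵐ ω ∂μ, sinr p C M D N ω ≠ 0 ∧ sinr p C M D N ω ≠ ∞ := by
  filter_upwards [ae_interfC_ne_zero_and_ne_top hY hC, ae_linkDist_spec hD]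
    with ω ⟨interfC_ne_zero, interfC_ne_top⟩ ⟨hpos, htot, hrx, _⟩
  have interfD_ne_top : interfD p D N ω ≠ ∞ := fun h =>
    htot (by rw [totalD_eq_add_interfD, h, add_top])
  refine ⟨ENNReal.div_ne_zero.2 ⟨?_, by simp [interfC_ne_top, interfD_ne_top]⟩,
    ENNReal.div_ne_top ENNReal.ofReal_ne_top (by simp [interfC_ne_zero])⟩
  simpa [hrx] using signal_pos p hpos

theorem invSinr_ae_eq :
    invSinr p C M D N =ᵐ[μ] fun ω => totalPower p C M D N ω / signal p (linkDist p D N ω) - 1 := by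
  filter_upwards [ae_interfC_ne_zero_and_ne_top hY hC, ae_linkDist_spec hD]
    with ω ⟨interfC_ne_zero, interfC_ne_top⟩ ⟨hpos, htot, hrx, _⟩
  have hS := signal_pos p hpos
  have interfD_ne_top : interfD p D N ω ≠ ∞ := fun h =>
    htot (by rw [totalD_eq_add_interfD, h, add_top])
  have hden : interfC p C M ω + interfD p D N ω + ENNReal.ofReal p.eta ≠ ∞ := by
    simp [interfC_ne_top, interfD_ne_top]
  have hden0 : interfC p C M ω + interfD p D N ω + ENNReal.ofReal p.eta ≠ 0 := by
    simp [interfC_ne_zero]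
  rw [invSinr, sinr, ENNReal.inv_div (.inl hden) (.inl hden0), ENNReal.toReal_div, totalPower,
    totalD_eq_add_interfD, hrx,
    ENNReal.toReal_add (ENNReal.add_ne_top.2 ⟨interfC_ne_top, interfD_ne_top⟩)
      ENNReal.ofReal_ne_top,
    ENNReal.toReal_add interfC_ne_top interfD_ne_top, ENNReal.toReal_ofReal p.eta_nonneg,
    ENNReal.toReal_add ENNReal.ofReal_ne_top interfD_ne_top, ENNReal.toReal_ofReal hS.le]
  field_simp
  ring

theorem aemeasurable_invSinr : AEMeasurable (invSinr p C M D N) μ := by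
  have hR := measurable_linkDist p hD.poisson.measurable hD.measurable_mark
  have hZ := measurable_totalPower (p := p) hC.poisson.measurable hC.measurable_mark
    hD.poisson.measurable hD.measurable_mark
  exact Measurable.aemeasurable (by fun_prop) |>.congr (invSinr_ae_eq hY hC hD).symm

include hCD

theorem ae_forall_integral_exp_condDistrib_invSinr :
    ∀ᵐ r ∂rayleigh p.rateD, ∀ w : ℝ, ∫ x, Complex.exp (-(Complex.I * w * x))
      ∂condDistrib (invSinr p C M D N) (linkDist p D N) μ r = charInvSinr p w r := by
  have hmap := condDistrib_comp_prodMk_ae_eq (μ := μ)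
    (measurable_linkDist p hD.poisson.measurable hD.measurable_mark)
    (measurable_totalPower (p := p) hC.poisson.measurable hC.measurable_mark hD.poisson.measurable
      hD.measurable_mark)
    (g := fun x => x.2 / signal p x.1 - 1) (by fun_prop)
  rw [map_linkDist hD] at hmap
  filter_upwards [ae_pos_rayleigh p.rateD, hmap,
    ae_forall_integral_exp_condDistrib_totalPower hY hC hD hCD] with r hr hlaw hchar w
  have hs : (signal p r : ℂ) ≠ 0 := by exact_mod_cast (signal_pos p hr).ne'
  have hshift (z : ℝ) : Complex.exp (-(Complex.I * w * (z / signal p r - 1 : ℝ))) =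
      Complex.exp (Complex.I * w) * Complex.exp (-(Complex.I * (w / signal p r : ℝ) * z)) := by
    rw [← Complex.exp_add]
    push_cast
    ring_nf
  rw [condDistrib_congr_left (invSinr_ae_eq hY hC hD), hlaw, integral_map
    (by fun_prop) (Measurable.aestronglyMeasurable (by fun_prop)), integral_congr_ae
    (.of_forall hshift), integral_const_mul, hchar, totalPowerChar,
    div_mul_cancel₀ w (signal_pos p hr).ne', ← mul_assoc, ← Complex.exp_add]
  push_cast
  rw [mul_div_assoc', div_mul_cancel₀ _ hs, add_neg_cancel, Complex.exp_zero, one_mul]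

theorem condExp_exp_invSinr (w : ℝ) :
    μ[fun ω => Complex.exp (-(Complex.I * w * (invSinr p C M D N ω : ℝ))) |
        MeasurableSpace.comap (linkDist p D N) inferInstance]
      =ᵐ[μ] fun ω => charInvSinr p w (linkDist p D N ω) := by
  have hR := measurable_linkDist p hD.poisson.measurable hD.measurable_mark
  have hX := aemeasurable_invSinr hY hC hD
  have hf : StronglyMeasurable fun x : ℝ => Complex.exp (-(Complex.I * w * x)) :=
    Measurable.stronglyMeasurable (by fun_prop)
  have hint : Integrable (fun ω => Complex.exp (-(Complex.I * w * invSinr p C M D N ω))) μ :=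
    .of_bound (by fun_prop) 1 (.of_forall fun _ => (norm_exp_neg_I_mul_mul _ _).le)
  have hchar := ae_forall_integral_exp_condDistrib_invSinr hY hC hD hCD
  rw [← map_linkDist hD] at hchar
  exact (condExp_ae_eq_integral_condDistrib hR hX hf hint).trans
    ((ae_of_ae_map hR.aemeasurable hchar).mono fun ω h => h w)

end InvSinr

/-! ### Inversion of a characteristic function that is not integrable -/

/-- The Fourier kernel of the interval from `0` to `x`, with the junk value `0` at `w = 0`. -/
def intervalKernel (x w : ℝ) : ℂ :=
  (Complex.exp (Complex.I * w * x) - 1) / (2 * Real.pi * Complex.I * w)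

@[fun_prop]
theorem measurable_intervalKernel (x : ℝ) : Measurable (intervalKernel x) := by
  unfold intervalKernel
  fun_prop

theorem norm_intervalKernel_le (x w : ℝ) : ‖intervalKernel x w‖ ≤ (|x| + 1) / (1 + |w|) := by
  rcases eq_or_ne w 0 with rfl | hw
  · simp only [intervalKernel, Complex.ofReal_zero, mul_zero, div_zero, norm_zero]
    positivity
  have hw0 : 0 < |w| := abs_pos.2 hw
  have exp_eq : Complex.exp (Complex.I * w * x) = Complex.exp (Complex.I * (w * x : ℝ)) := by
    push_cast
    ring_nf
  have le_two : ‖Complex.exp (Complex.I * w * x) - 1‖ ≤ 2 := by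
    refine (norm_sub_le _ _).trans ?_
    rw [exp_eq, Complex.norm_exp_I_mul_ofReal, norm_one]
    norm_num
  have le_mul : ‖Complex.exp (Complex.I * w * x) - 1‖ ≤ |w| * |x| := by
    rw [exp_eq, ← abs_mul]
    exact Real.norm_exp_I_mul_ofReal_sub_one_le
  have norm_den : ‖(2 * Real.pi * Complex.I * w : ℂ)‖ = 2 * Real.pi * |w| := by
    simp [abs_of_pos Real.pi_pos]
  rw [intervalKernel, norm_div, norm_den, div_le_div_iff₀ (by positivity) (by positivity)]
  calc ‖Complex.exp (Complex.I * w * x) - 1‖ * (1 + |w|)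
      = ‖Complex.exp (Complex.I * w * x) - 1‖ + ‖Complex.exp (Complex.I * w * x) - 1‖ * |w| := by
        ring
    _ ≤ |w| * |x| + 2 * |w| := by gcongr
    _ ≤ (|x| + 1) * (2 * |w|) := by nlinarith [abs_nonneg x]
    _ ≤ (|x| + 1) * (2 * Real.pi * |w|) := by
        gcongr
        linarith [Real.pi_gt_three]

theorem intervalKernel_eq_integral {w : ℝ} (hw : w ≠ 0) {x : ℝ} (hx : 0 ≤ x) :
    intervalKernel x w =
      (2 * Real.pi : ℂ)⁻¹ * ∫ u in Ioc 0 x, Complex.exp (Complex.I * w * u) := by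
  have hc : Complex.I * w ≠ 0 := mul_ne_zero Complex.I_ne_zero (by exact_mod_cast hw)
  have hpi : (Real.pi : ℂ) ≠ 0 := by exact_mod_cast Real.pi_ne_zero
  rw [← intervalIntegral.integral_of_le hx, integral_exp_mul_complex hc, intervalKernel,
    Complex.ofReal_zero, mul_zero, Complex.exp_zero]
  field_simp

theorem integrable_intervalKernel_mul {Φ : ℝ → ℂ} (hΦ : AEStronglyMeasurable Φ)
    (hint : Integrable fun w => ‖Φ w‖ / (1 + |w|)) (x : ℝ) :
    Integrable fun w => intervalKernel x w * Φ w := by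
  refine (hint.const_mul (|x| + 1)).mono' (by fun_prop) (.of_forall fun w => ?_)
  calc ‖intervalKernel x w * Φ w‖ ≤ (|x| + 1) / (1 + |w|) * ‖Φ w‖ := by
        rw [norm_mul]
        gcongr
        exact norm_intervalKernel_le x w
    _ = (|x| + 1) * (‖Φ w‖ / (1 + |w|)) := by ring

theorem continuous_integral_intervalKernel_mul {Φ : ℝ → ℂ} (hΦ : AEStronglyMeasurable Φ)
    (hint : Integrable fun w => ‖Φ w‖ / (1 + |w|)) :
    Continuous fun x => ∫ w, intervalKernel x w * Φ w := by
  refine continuous_iff_continuousAt.2 fun x => continuousAt_of_dominated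
    (bound := fun w => (|x| + 2) * (‖Φ w‖ / (1 + |w|)))
    (.of_forall fun y => (integrable_intervalKernel_mul hΦ hint y).1) ?_ (hint.const_mul _)
    (.of_forall fun w => by unfold intervalKernel; fun_prop)
  filter_upwards [continuous_abs.continuousAt.eventually_lt_const (lt_add_one |x|)] with y hy
  refine .of_forall fun w => ?_
  calc ‖intervalKernel y w * Φ w‖ ≤ (|y| + 1) / (1 + |w|) * ‖Φ w‖ := by
        rw [norm_mul]
        gcongr
        exact norm_intervalKernel_le y w
    _ ≤ (|x| + 2) / (1 + |w|) * ‖Φ w‖ := by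
        have : |y| + 1 ≤ |x| + 2 := by linarith
        gcongr
    _ = (|x| + 2) * (‖Φ w‖ / (1 + |w|)) := by ring

theorem charFun_neg_eq_integral (ν : Measure ℝ) (w : ℝ) :
    charFun ν (-w) = ∫ x, Complex.exp (-(Complex.I * w * x)) ∂ν := by
  rw [charFun_apply_real]
  congr 2 with x
  push_cast
  ring_nf

theorem charFun_neg_gaussianReal (y : ℝ) (v : ℝ≥0) (w : ℝ) :
    charFun (gaussianReal y v) (-w) =
      Complex.exp (-(Complex.I * w * y)) * Real.exp (-(v / 2) * w ^ 2) := by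
  rw [charFun_gaussianReal, Complex.ofReal_exp, ← Complex.exp_add]
  push_cast
  ring_nf

theorem norm_charFun_neg_gaussianReal (y : ℝ) (v : ℝ≥0) (w : ℝ) :
    ‖charFun (gaussianReal y v) (-w)‖ = Real.exp (-(v / 2) * w ^ 2) := by
  rw [charFun_neg_gaussianReal, norm_mul, norm_exp_neg_I_mul_mul, one_mul,
    Complex.norm_of_nonneg (Real.exp_pos _).le]

theorem integral_exp_mul_charFun_gaussianReal {v : ℝ≥0} (hv : v ≠ 0) (y u : ℝ) :
    (2 * Real.pi : ℂ)⁻¹ * ∫ w : ℝ, Complex.exp (Complex.I * w * u) *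
      charFun (gaussianReal y v) (-w) = gaussianPDFReal y v u := by
  have : (0 : ℝ) < v := by positivity
  have integrand_eq (w : ℝ) : Complex.exp (Complex.I * w * u) * charFun (gaussianReal y v) (-w) =
      Complex.exp (Complex.I * (u - y : ℝ) * w) * Complex.exp (-((v / 2 : ℝ) : ℂ) * w ^ 2) := by
    rw [charFun_neg_gaussianReal, Complex.ofReal_exp, ← mul_assoc, ← Complex.exp_add]
    push_cast
    ring_nf
  have gaussian_mass : ((Real.pi : ℂ) / ((v / 2 : ℝ) : ℂ)) ^ (1 / 2 : ℂ) =
      (2 * Real.pi / Real.sqrt (2 * Real.pi * v) : ℝ) := by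
    rw [← Complex.ofReal_div, show (1 / 2 : ℂ) = ((1 / 2 : ℝ) : ℂ) by push_cast; rfl,
      ← Complex.ofReal_cpow (by positivity), ← Real.sqrt_eq_rpow,
      show Real.pi / (v / 2) = (2 * Real.pi) ^ 2 / (2 * Real.pi * v) by field_simp,
      Real.sqrt_div (by positivity), Real.sqrt_sq (by positivity)]
  have gaussian_exponent : -((u - y : ℝ) : ℂ) ^ 2 / (4 * ((v / 2 : ℝ) : ℂ)) =
      ((-(u - y) ^ 2 / (2 * v) : ℝ) : ℂ) := by
    push_cast
    ring
  rw [integral_congr_ae (.of_forall integrand_eq),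
    fourierIntegral_gaussian (b := ((v / 2 : ℝ) : ℂ)) (by rw [Complex.ofReal_re]; positivity),
    gaussian_mass, gaussian_exponent, gaussianPDFReal]
  have hpi : (Real.pi : ℂ) ≠ 0 := by exact_mod_cast Real.pi_ne_zero
  push_cast
  field_simp

theorem integrable_uncurry_exp_mul_charFun_gaussianReal {v : ℝ≥0} (hv : v ≠ 0) (x y : ℝ) :
    Integrable (Function.uncurry fun w u : ℝ => Complex.exp (Complex.I * w * u) *
      charFun (gaussianReal y v) (-w)) (volume.prod (volume.restrict (Ioc 0 x))) := by
  have hbound := (integrable_exp_neg_mul_sq (b := v / 2) (by positivity)).mul_prod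
    (integrable_const (μ := volume.restrict (Ioc 0 x)) (1 : ℝ))
  refine hbound.mono' (by unfold Function.uncurry; fun_prop) (.of_forall fun z => le_of_eq ?_)
  have norm_exp : ‖Complex.exp (Complex.I * z.1 * z.2)‖ = 1 := by
    rw [mul_assoc, ← Complex.ofReal_mul, Complex.norm_exp_I_mul_ofReal]
  rw [Function.uncurry_apply_pair, norm_mul, norm_charFun_neg_gaussianReal, norm_exp, one_mul,
    mul_one]

theorem integral_intervalKernel_mul_charFun_gaussianReal {v : ℝ≥0} (hv : v ≠ 0) {x : ℝ}
    (hx : 0 ≤ x) (y : ℝ) :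
    ∫ w, intervalKernel x w * charFun (gaussianReal y v) (-w) =
      (gaussianReal y v).real (Ioc 0 x) := by
  calc ∫ w, intervalKernel x w * charFun (gaussianReal y v) (-w)
      = ∫ w : ℝ, (2 * Real.pi : ℂ)⁻¹ * ∫ u in Ioc 0 x, Complex.exp (Complex.I * w * u) *
          charFun (gaussianReal y v) (-w) := by
        refine integral_congr_ae ?_
        filter_upwards [Measure.ae_ne volume 0] with w hw
        rw [intervalKernel_eq_integral hw hx, integral_mul_const, mul_assoc]
    _ = ∫ u in Ioc 0 x, (2 * Real.pi : ℂ)⁻¹ * ∫ w : ℝ, Complex.exp (Complex.I * w * u) *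
          charFun (gaussianReal y v) (-w) := by
        rw [integral_const_mul, integral_const_mul,
          integral_integral_swap (integrable_uncurry_exp_mul_charFun_gaussianReal hv x y)]
    _ = ∫ u in Ioc 0 x, (gaussianPDFReal y v u : ℂ) := by
        simp only [integral_exp_mul_charFun_gaussianReal hv]
    _ = (gaussianReal y v).real (Ioc 0 x) := by
        rw [integral_complex_ofReal, measureReal_def, gaussianReal_apply_eq_integral _ hv,
          ENNReal.toReal_ofReal (integral_nonneg fun u => gaussianPDFReal_nonneg _ _ _)]

section WeakLimits

variable {E : Type*} [MeasurableSpace E] [TopologicalSpace E] [OpensMeasurableSpace E]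
  [HasOuterApproxClosed E] {ν : ProbabilityMeasure E} {νs : ℕ → ProbabilityMeasure E}
  {A : Set E} {a : ℝ}

theorem measureReal_le_of_tendsto_of_isOpen (hν : Tendsto νs atTop (𝓝 ν)) {U : Set E}
    (hU : IsOpen U) (hUA : U ⊆ A)
    (ha : Tendsto (fun n => (νs n : Measure E).real A) atTop (𝓝 a)) :
    (ν : Measure E).real U ≤ a := by
  have measure_tendsto : Tendsto (fun n => (νs n : Measure E) A) atTop (𝓝 (ENNReal.ofReal a)) := by
    simpa using ENNReal.tendsto_ofReal ha
  refine ENNReal.toReal_le_of_le_ofReal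
    (ge_of_tendsto' ha fun n => measureReal_nonneg) ?_
  calc (ν : Measure E) U ≤ liminf (fun n => (νs n : Measure E) U) atTop :=
        ProbabilityMeasure.le_liminf_measure_open_of_tendsto hν hU
    _ ≤ liminf (fun n => (νs n : Measure E) A) atTop :=
        liminf_le_liminf (.of_forall fun n => measure_mono hUA)
    _ = ENNReal.ofReal a := measure_tendsto.liminf_eq

theorem le_measureReal_of_tendsto_of_isClosed (hν : Tendsto νs atTop (𝓝 ν)) {F : Set E}
    (hF : IsClosed F) (hAF : A ⊆ F)
    (ha : Tendsto (fun n => (νs n : Measure E).real A) atTop (𝓝 a)) :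
    a ≤ (ν : Measure E).real F := by
  have measure_tendsto : Tendsto (fun n => (νs n : Measure E) A) atTop (𝓝 (ENNReal.ofReal a)) := by
    simpa using ENNReal.tendsto_ofReal ha
  refine (ENNReal.ofReal_le_iff_le_toReal (measure_ne_top _ _)).1 ?_
  calc ENNReal.ofReal a = limsup (fun n => (νs n : Measure E) A) atTop :=
        measure_tendsto.limsup_eq.symm
    _ ≤ limsup (fun n => (νs n : Measure E) F) atTop :=
        limsup_le_limsup (.of_forall fun n => measure_mono hAF)
    _ ≤ (ν : Measure E) F := ProbabilityMeasure.limsup_measure_closed_le_of_tendsto hν hF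

end WeakLimits

section Inversion

variable {ν : Measure ℝ} [IsProbabilityMeasure ν]

theorem charFun_neg_conv_gaussianReal (v : ℝ≥0) (w : ℝ) :
    charFun (ν ∗ gaussianReal 0 v) (-w) = ∫ y, charFun (gaussianReal y v) (-w) ∂ν := by
  simp only [charFun_conv, charFun_neg_gaussianReal, integral_mul_const]
  rw [charFun_neg_eq_integral, Complex.ofReal_zero, mul_zero, neg_zero, Complex.exp_zero, one_mul]

theorem conv_gaussianReal_real_apply (v : ℝ≥0) {A : Set ℝ} (hA : MeasurableSet A) :
    (ν ∗ gaussianReal 0 v).real A = ∫ y, (gaussianReal y v).real A ∂ν := by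
  have gaussian_eq (y : ℝ) : (gaussianReal y v).real A =
      ∫ z, A.indicator (1 : ℝ → ℝ) (y + z) ∂(gaussianReal 0 v) := by
    rw [← integral_map (φ := fun z => y + z) (by fun_prop)
      (measurable_one.indicator hA).aestronglyMeasurable, gaussianReal_map_const_add, zero_add,
      integral_indicator_one hA]
  rw [← integral_indicator_one hA, integral_conv ((integrable_const 1).indicator hA)]
  simp only [gaussian_eq]

theorem integral_intervalKernel_mul_charFun_conv_gaussianReal {v : ℝ≥0} (hv : v ≠ 0) {x : ℝ}
    (hx : 0 ≤ x) :
    ∫ w, intervalKernel x w * charFun (ν ∗ gaussianReal 0 v) (-w) =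
      (ν ∗ gaussianReal 0 v).real (Ioc 0 x) := by
  have hint : Integrable (Function.uncurry fun w y =>
      intervalKernel x w * charFun (gaussianReal y v) (-w)) (volume.prod ν) := by
    have hbound := ((integrable_exp_neg_mul_sq (b := v / 2) (by positivity)).const_mul
      (|x| + 1)).mul_prod (integrable_const (μ := ν) (1 : ℝ))
    refine hbound.mono' ?_ (.of_forall fun z => ?_)
    · simp only [charFun_neg_gaussianReal, Function.uncurry_def]
      exact Measurable.aestronglyMeasurable (by fun_prop)
    · rw [Function.uncurry_apply_pair, norm_mul, norm_charFun_neg_gaussianReal, mul_one]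
      gcongr
      exact (norm_intervalKernel_le x z.1).trans
        (div_le_self (by positivity) (by linarith [abs_nonneg z.1]))
  calc ∫ w, intervalKernel x w * charFun (ν ∗ gaussianReal 0 v) (-w)
      = ∫ w, ∫ y, intervalKernel x w * charFun (gaussianReal y v) (-w) ∂ν := by
        simp only [charFun_neg_conv_gaussianReal, integral_const_mul]
    _ = ∫ y, (∫ w, intervalKernel x w * charFun (gaussianReal y v) (-w)) ∂ν :=
        integral_integral_swap hint
    _ = ((∫ y, (gaussianReal y v).real (Ioc 0 x) ∂ν : ℝ) : ℂ) := by
        simp only [integral_intervalKernel_mul_charFun_gaussianReal hv hx, integral_complex_ofReal]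
    _ = (ν ∗ gaussianReal 0 v).real (Ioc 0 x) := by
        rw [conv_gaussianReal_real_apply v measurableSet_Ioc]

variable (ν) in
/-- The law `ν` smoothed by an independent centred Gaussian of variance `1 / (n + 1)`. -/
def gaussianSmoothing (n : ℕ) : ProbabilityMeasure ℝ :=
  ⟨ν ∗ gaussianReal 0 (n + 1 : ℝ≥0)⁻¹, inferInstance⟩

theorem tendsto_gaussianSmoothing : Tendsto (gaussianSmoothing ν) atTop
    (𝓝 (⟨ν, inferInstance⟩ : ProbabilityMeasure ℝ)) := by
  refine ProbabilityMeasure.tendsto_iff_tendsto_charFun.2 fun w => ?_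
  have variance_tendsto : Tendsto (fun n : ℕ => (((n + 1 : ℝ≥0)⁻¹ : ℝ≥0) : ℝ)) atTop (𝓝 0) := by
    simpa [one_div] using tendsto_one_div_add_atTop_nhds_zero_nat (𝕜 := ℝ)
  have charFun_tendsto : Tendsto (fun n : ℕ => charFun (gaussianReal 0 (n + 1 : ℝ≥0)⁻¹) w) atTop
      (𝓝 1) := by
    simp only [charFun_gaussianReal]
    have := (Complex.continuous_ofReal.tendsto 0).comp variance_tendsto
    have h2 := ((this.mul_const ((w : ℂ) ^ 2)).div_const 2).neg.cexp
    simpa using h2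
  simpa [gaussianSmoothing, charFun_conv] using charFun_tendsto.const_mul (charFun ν w)

theorem tendsto_gaussianSmoothing_real_Ioc
    (hint : Integrable fun w => ‖charFun ν (-w)‖ / (1 + |w|)) {x : ℝ} (hx : 0 ≤ x) :
    Tendsto (fun n : ℕ => (((gaussianSmoothing ν n : Measure ℝ).real (Ioc 0 x) : ℝ) : ℂ)) atTop
      (𝓝 (∫ w, intervalKernel x w * charFun ν (-w))) := by
  have hmeas : AEStronglyMeasurable fun w => charFun ν (-w) := by fun_prop
  have hK := integrable_intervalKernel_mul hmeas hint x
  simp only [gaussianSmoothing, ProbabilityMeasure.coe_mk,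
    ← integral_intervalKernel_mul_charFun_conv_gaussianReal (ν := ν)
      (inv_ne_zero (Nat.cast_add_one_ne_zero _)) hx]
  refine tendsto_integral_of_dominated_convergence _ (fun n => ?_) hK.norm (fun n => ?_) ?_
  · fun_prop
  · refine .of_forall fun w => ?_
    rw [charFun_conv, ← mul_assoc, norm_mul]
    exact mul_le_of_le_one_right (norm_nonneg _) (norm_charFun_le_one _)
  · exact .of_forall fun w => (ProbabilityMeasure.tendsto_iff_tendsto_charFun.1
      tendsto_gaussianSmoothing (-w)).const_mul _

theorem integral_intervalKernel_mul_charFun (h0 : ν {0} = 0)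
    (hint : Integrable fun w => ‖charFun ν (-w)‖ / (1 + |w|)) {x : ℝ} (hx : 0 < x) :
    ∫ w, intervalKernel x w * charFun ν (-w) = ν.real (Ioo 0 x) := by
  set G : ℝ → ℂ := fun x => ∫ w, intervalKernel x w * charFun ν (-w)
  have smooth_tendsto {y : ℝ} (hy : 0 < y) := tendsto_gaussianSmoothing_real_Ioc hint hy.le
  have re_tendsto {y : ℝ} (hy : 0 < y) :=
    (Complex.continuous_re.tendsto _).comp (smooth_tendsto hy)
  have im_eq_zero : (G x).im = 0 := by
    refine tendsto_nhds_unique ((Complex.continuous_im.tendsto _).comp (smooth_tendsto hx)) ?_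
    simpa only [Function.comp_def, Complex.ofReal_im] using tendsto_const_nhds
  have lower : ν.real (Ioo 0 x) ≤ (G x).re :=
    measureReal_le_of_tendsto_of_isOpen tendsto_gaussianSmoothing isOpen_Ioo
      Ioo_subset_Ioc_self (re_tendsto hx)
  have upper_left {y : ℝ} (hy : y ∈ Ioo 0 x) : (G y).re ≤ ν.real (Ioo 0 x) := by
    have le_Icc : (G y).re ≤ ν.real (Icc 0 y) :=
      le_measureReal_of_tendsto_of_isClosed tendsto_gaussianSmoothing isClosed_Icc
        Ioc_subset_Icc_self (re_tendsto hy.1)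
    have Icc_subset : Icc 0 y ⊆ {0} ∪ Ioo 0 x := fun z hz => hz.1.eq_or_lt.imp
      (fun h => h.symm) fun h => ⟨h, hz.2.trans_lt hy.2⟩
    refine le_Icc.trans ((measureReal_mono Icc_subset).trans ((measureReal_union_le _ _).trans ?_))
    rw [measureReal_def ν {0}, h0, ENNReal.toReal_zero, zero_add]
  have re_continuous : Continuous fun y => (G y).re :=
    Complex.continuous_re.comp (continuous_integral_intervalKernel_mul (by fun_prop) hint)
  have upper : (G x).re ≤ ν.real (Ioo 0 x) :=
    le_of_tendsto ((re_continuous.tendsto x).mono_left nhdsWithin_le_nhds)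
      (Filter.mem_of_superset (Ioo_mem_nhdsLT hx) fun _ => upper_left)
  exact Complex.ext (upper.antisymm lower) im_eq_zero

end Inversion

/-! ### Decay of the conditional characteristic function -/

theorem signal_mul (p : Params) {a r : ℝ} (ha : 0 ≤ a) (hr : 0 ≤ r) :
    signal p (a * r) = a ^ (-p.alphaD) * signal p r := by
  rw [signal, signal, Real.mul_rpow ha hr]
  ring

theorem signal_le_signal (p : Params) {r r' : ℝ} (hr : 0 < r) (h : r ≤ r') :
    signal p r' ≤ signal p r := by
  have := p.Pd_pos
  have := p.AD_pos
  unfold signal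
  exact mul_le_mul_of_nonneg_left
    (Real.rpow_le_rpow_of_nonpos hr h (neg_nonpos.2 p.alphaD_pos.le)) (by positivity)

/-- The least value of `1 - cos` on `[2 ^ (-α), 1]`, which is the range of the ratio of the signals
at distances `v ∈ [u, 2 u]` and `u`. -/
def Params.cosGap (p : Params) : ℝ := 1 - Real.cos (2 ^ (-p.alphaD))

theorem Params.cosGap_le (p : Params) {x : ℝ} (hx : 2 ^ (-p.alphaD) ≤ |x|) (hx1 : |x| ≤ 1) :
    p.cosGap ≤ 1 - Real.cos x := by
  rw [← Real.cos_abs x]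
  exact sub_le_sub_left (Real.cos_le_cos_of_nonneg_of_le_pi (by positivity)
    (hx1.trans (by linarith [Real.pi_gt_three])) hx) 1

theorem Params.cosGap_pos (p : Params) : 0 < p.cosGap := by
  have rpow_pos : (0 : ℝ) < 2 ^ (-p.alphaD) := by positivity
  have rpow_le_one : (2 : ℝ) ^ (-p.alphaD) ≤ 1 :=
    Real.rpow_le_one_of_one_le_of_nonpos one_le_two (neg_nonpos.2 p.alphaD_pos.le)
  rw [Params.cosGap, sub_pos, ← Real.cos_zero]
  exact Real.cos_lt_cos_of_nonneg_of_le_pi le_rfl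
    (rpow_le_one.trans (by linarith [Real.pi_gt_three])) rpow_pos

theorem integrableOn_one_sub_cos_signal (p : Params) (w : ℝ) :
    IntegrableOn (fun v => (1 - Real.cos (w * signal p v)) * v) (Ioi 0) := by
  simpa only [RCLike.re_to_complex, one_sub_exp_signal_mul_re] using!
    (integrableOn_one_sub_exp_signal p w).re

theorem cosGap_mul_sq_le_deviceExponent_re (p : Params) {w a u : ℝ} (ha : 0 < a) (hau : a ≤ u)
    (hu : |w| * signal p u = 1) : p.cosGap * u ^ 2 ≤ (deviceExponent p w a).re := by
  have hu0 : 0 < u := ha.trans_le hau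
  have integrable := (integrableOn_one_sub_cos_signal p w).mono_set (Ioi_subset_Ioi ha.le)
  have subset : Ioc u (2 * u) ⊆ Ioi a := fun v hv => hau.trans_lt hv.1
  have pointwise (v : ℝ) (hv : v ∈ Ioc u (2 * u)) :
      p.cosGap * u ≤ (1 - Real.cos (w * signal p v)) * v := by
    have hv0 : 0 < v := hu0.trans hv.1
    have abs_eq : |w * signal p v| = |w| * signal p v := by
      rw [abs_mul, abs_of_pos (signal_pos p hv0)]
    have abs_le : |w * signal p v| ≤ 1 := by
      rw [abs_eq, ← hu]
      exact mul_le_mul_of_nonneg_left (signal_le_signal p hu0 hv.1.le) (abs_nonneg w)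
    have le_abs : 2 ^ (-p.alphaD) ≤ |w * signal p v| := by
      calc (2 : ℝ) ^ (-p.alphaD) = |w| * signal p (2 * u) := by
            rw [signal_mul p zero_le_two hu0.le, mul_left_comm, hu, mul_one]
        _ ≤ |w * signal p v| := by
            rw [abs_eq]
            exact mul_le_mul_of_nonneg_left (signal_le_signal p hv0 hv.2) (abs_nonneg w)
    exact mul_le_mul (p.cosGap_le le_abs abs_le) hv.1.le hu0.le
      (sub_nonneg.2 (Real.cos_le_one _))
  rw [deviceExponent_re p w ha.le]
  calc p.cosGap * u ^ 2 = ∫ _ in Ioc u (2 * u), p.cosGap * u := by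
        rw [setIntegral_const, Real.volume_real_Ioc_of_le (by linarith), smul_eq_mul]
        ring
    _ ≤ ∫ v in Ioc u (2 * u), (1 - Real.cos (w * signal p v)) * v :=
        setIntegral_mono_on (integrableOn_const (by simp)) (integrable.mono_set subset)
          measurableSet_Ioc pointwise
    _ ≤ ∫ v in Ioi a, (1 - Real.cos (w * signal p v)) * v := by
        refine setIntegral_mono_set integrable ?_ subset.eventuallyLE
        filter_upwards [ae_restrict_mem measurableSet_Ioi] with v (hv : a < v)
        exact mul_nonneg (sub_nonneg.2 (Real.cos_le_one _)) (ha.le.trans hv.le)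

theorem norm_charD (p : Params) (w : ℝ) {r : ℝ} (hr : 0 < r) :
    ‖charD p w r‖ = Real.exp (-(p.rateD * (deviceExponent p (w / signal p r) r).re)) := by
  have exponent_eq : (p.rateD * r ^ 2 / 2 : ℂ) = ((p.rateD * r ^ 2 / 2 : ℝ) : ℂ) := by
    push_cast
    rfl
  have hw : w / signal p r * signal p r = w := div_mul_cancel₀ w (signal_pos p hr).ne'
  rw [← congrArg (charD p · r) hw, charD_mul_signal p _ hr, norm_mul, norm_deviceChar, exponent_eq,
    Complex.norm_exp_ofReal, ← Real.exp_add]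
  ring_nf

theorem norm_charD_le_one (p : Params) (w : ℝ) {r : ℝ} (hr : 0 < r) : ‖charD p w r‖ ≤ 1 := by
  rw [norm_charD p w hr, Real.exp_le_one_iff, neg_nonpos]
  exact mul_nonneg p.rateD_pos.le (deviceExponent_re_nonneg p _ hr.le)

theorem norm_charD_le_rpow (p : Params) {w r : ℝ} (hr : 0 < r) (hw : 1 ≤ |w|) :
    ‖charD p w r‖ ≤ (p.rateD * p.cosGap * r ^ 2)⁻¹ * |w| ^ (-(2 / p.alphaD)) := by
  have hα := p.alphaD_pos
  have hc : 0 < p.rateD * p.cosGap * r ^ 2 :=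
    mul_pos (mul_pos p.rateD_pos p.cosGap_pos) (by positivity)
  have hw0 : 0 < |w| := one_pos.trans_le hw
  have le_re : p.cosGap * (|w| ^ (1 / p.alphaD) * r) ^ 2 ≤
      (deviceExponent p (w / signal p r) r).re := by
    refine cosGap_mul_sq_le_deviceExponent_re p hr
      (le_mul_of_one_le_left hr.le (Real.one_le_rpow hw (by positivity))) ?_
    rw [signal_mul p (by positivity) hr.le, ← Real.rpow_mul hw0.le, mul_neg,
      one_div_mul_cancel hα.ne', Real.rpow_neg_one, abs_div, abs_of_pos (signal_pos p hr)]
    field_simp [(signal_pos p hr).ne']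
  have rpow_sq : (|w| ^ (1 / p.alphaD)) ^ 2 = |w| ^ (2 / p.alphaD) := by
    rw [← Real.rpow_mul_natCast hw0.le]
    ring_nf
  rw [norm_charD p w hr, Real.exp_neg, Real.rpow_neg hw0.le, ← mul_inv]
  refine inv_anti₀ (by positivity) ?_
  calc p.rateD * p.cosGap * r ^ 2 * |w| ^ (2 / p.alphaD)
      = p.rateD * (p.cosGap * (|w| ^ (1 / p.alphaD) * r) ^ 2) := by
        rw [mul_pow, rpow_sq]
        ring
    _ ≤ p.rateD * (deviceExponent p (w / signal p r) r).re :=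
        mul_le_mul_of_nonneg_left le_re p.rateD_pos.le
    _ ≤ Real.exp (p.rateD * (deviceExponent p (w / signal p r) r).re) := by
        linarith [Real.add_one_le_exp (p.rateD * (deviceExponent p (w / signal p r) r).re)]

theorem integrable_norm_div_one_add_abs {Φ : ℝ → ℂ} (hΦ : AEStronglyMeasurable Φ) {K s : ℝ}
    (hs : 0 < s) (h_near : ∀ w, |w| ≤ 1 → ‖Φ w‖ ≤ K)
    (h_far : ∀ w, 1 < |w| → ‖Φ w‖ ≤ K * |w| ^ (-s)) :
    Integrable fun w => ‖Φ w‖ / (1 + |w|) := by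
  have hK : 0 ≤ K := (norm_nonneg _).trans (h_near 0 (by simp))
  have bound (w : ℝ) : ‖Φ w‖ ≤ K * ((1 + |w|) / 2) ^ (-s) := by
    rcases le_or_gt |w| 1 with hw | hw
    · exact (h_near w hw).trans (le_mul_of_one_le_right hK
        (Real.one_le_rpow_of_pos_of_le_one_of_nonpos (by positivity) (by linarith) (by linarith)))
    · exact (h_far w hw).trans (mul_le_mul_of_nonneg_left
        (Real.rpow_le_rpow_of_nonpos (by positivity) (by linarith) (by linarith)) hK)
  have dominating : Integrable fun w : ℝ => K * 2 ^ s * (1 + ‖w‖) ^ (-(s + 1)) :=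
    (integrable_one_add_norm (by simpa using hs)).const_mul _
  refine dominating.mono' (hΦ.norm.aemeasurable.div (by fun_prop)).aestronglyMeasurable
    (.of_forall fun w => ?_)
  have hpos : 0 < 1 + |w| := by positivity
  rw [Real.norm_of_nonneg (by positivity), Real.norm_eq_abs, div_le_iff₀ hpos]
  calc ‖Φ w‖ ≤ K * ((1 + |w|) / 2) ^ (-s) := bound w
    _ = K * 2 ^ s * (1 + |w|) ^ (-(s + 1)) * (1 + |w|) := by
      rw [Real.div_rpow hpos.le zero_le_two, Real.rpow_neg zero_le_two, neg_add,
        Real.rpow_add hpos, Real.rpow_neg_one]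
      field_simp

theorem inversionIntegrand_eq (p : Params) (T r w : ℝ) :
    inversionIntegrand p T r w = intervalKernel (1 / T) w * charInvSinr p w r := by
  rw [inversionIntegrand, intervalKernel, Complex.ofReal_div, Complex.ofReal_one, mul_one_div]

section Decay

variable {Ω : Type*} [MeasurableSpace Ω] {μ : Measure Ω} [IsProbabilityMeasure μ] {p : Params}
  {Y : ℕ → Ω → Plane} {xi : ℕ → Ω → ℝ} {C : ℕ → Ω → Plane} {M : ℕ → Ω → ℝ × ℝ}
  {D : ℕ → Ω → Plane} {N : ℕ → Ω → ℝ × Bool}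
  (hY : IsMarkedPoisson Y xi (homogeneous p.lamB) (shadowLaw p.sigmaB) μ)
  (hC : IsMarkedPoisson C M (homogeneous p.lamB)
    ((shadowLaw p.sigmaB).prod (cellularDistLaw p Y xi μ)) μ)
  (hD : IsMarkedPoisson D N (homogeneous ((1 - qCellular p) * p.lamU))
    ((shadowLaw p.sigmaD).prod fairCoin) μ)

include hY hC hD

theorem integrable_norm_charInvSinr_div {r : ℝ} (hr : 0 < r) :
    Integrable fun w => ‖charInvSinr p w r‖ / (1 + |w|) := by
  set c := (p.rateD * p.cosGap * r ^ 2)⁻¹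
  refine integrable_norm_div_one_add_abs (K := max 1 c) (s := 2 / p.alphaD)
    (continuous_charInvSinr hY hC hD hr).aestronglyMeasurable (div_pos two_pos p.alphaD_pos)
    (fun w _ => ?_) (fun w hw => ?_)
  · exact (norm_charInvSinr_le_norm_charD hY hC w r).trans
      ((norm_charD_le_one p w hr).trans (le_max_left _ _))
  · refine (norm_charInvSinr_le_norm_charD hY hC w r).trans
      ((norm_charD_le_rpow p hr hw.le).trans ?_)
    gcongr
    exact le_max_right _ _

theorem integrable_inversionIntegrand (T : ℝ) {r : ℝ} (hr : 0 < r) :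
    Integrable (inversionIntegrand p T r) := by
  rw [funext (inversionIntegrand_eq p T r)]
  exact integrable_intervalKernel_mul (continuous_charInvSinr hY hC hD hr).aestronglyMeasurable
    (integrable_norm_charInvSinr_div hY hC hD hr) _

end Decay

/-! ### Coverage -/

section CondDistrib

variable {Ω β γ : Type*} [MeasurableSpace Ω] [MeasurableSpace β] [MeasurableSpace γ]
  [StandardBorelSpace γ] [Nonempty γ] {μ : Measure Ω} [IsFiniteMeasure μ] {R : Ω → β} {X : Ω → γ}

theorem integral_condDistrib_real (hR : AEMeasurable R μ) (hX : AEMeasurable X μ) {S : Set γ}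
    (hS : MeasurableSet S) :
    ∫ r, (condDistrib X R μ r).real S ∂μ.map R = μ.real (X ⁻¹' S) := by
  simp only [measureReal_def]
  rw [integral_toReal (Kernel.measurable_coe _ hS).aemeasurable (.of_forall fun _ =>
    measure_lt_top _ _), ← Measure.bind_apply hS (Kernel.aemeasurable _),
    condDistrib_comp_map hR hX, Measure.map_apply_of_aemeasurable hX hS]

theorem ae_condDistrib_eq_zero (hR : AEMeasurable R μ) (hX : AEMeasurable X μ) {S : Set γ}
    (hS : MeasurableSet S) (h : ∀ᵐ ω ∂μ, X ω ∉ S) :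
    ∀ᵐ r ∂μ.map R, condDistrib X R μ r S = 0 := by
  have hlaw : ∀ᵐ x ∂condDistrib X R μ ∘ₘ μ.map R, x ∉ S := by
    rw [condDistrib_comp_map hR hX]
    exact (ae_map_iff hX hS.compl).2 h
  simpa only [ae_iff, not_not, ofPred_mem_eq] using Measure.ae_ae_of_ae_comp hlaw

end CondDistrib

section Coverage

variable {Ω : Type*} [MeasurableSpace Ω] {μ : Measure Ω} [IsProbabilityMeasure μ] {p : Params}
  {Y : ℕ → Ω → Plane} {xi : ℕ → Ω → ℝ} {C : ℕ → Ω → Plane} {M : ℕ → Ω → ℝ × ℝ}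
  {D : ℕ → Ω → Plane} {N : ℕ → Ω → ℝ × Bool}
  (hY : IsMarkedPoisson Y xi (homogeneous p.lamB) (shadowLaw p.sigmaB) μ)
  (hC : IsMarkedPoisson C M (homogeneous p.lamB)
    ((shadowLaw p.sigmaB).prod (cellularDistLaw p Y xi μ)) μ)
  (hD : IsMarkedPoisson D N (homogeneous ((1 - qCellular p) * p.lamU))
    ((shadowLaw p.sigmaD).prod fairCoin) μ)
  (hCD : IndepFun (fun ω i => (C i ω, M i ω)) (fun ω j => (D j ω, N j ω)) μ)

section LinkDensity

include hD

theorem hasDerivAt_cdf_linkDist {r : ℝ} (hr : 0 < r) :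
    HasDerivAt (fun x => μ.real {ω | linkDist p D N ω ≤ x})
      (p.rateD * r * Real.exp (-(p.rateD * r ^ 2 / 2))) r := by
  have hR := measurable_linkDist p hD.poisson.measurable hD.measurable_mark
  refine ((hasDerivAt_neg_exp_neg_sq p.rateD r).const_add 1).congr_of_eventuallyEq ?_
  filter_upwards [Ioi_mem_nhds hr] with x (hx : 0 < x)
  have compl_eq : {ω | linkDist p D N ω ≤ x} = (linkDist p D N ⁻¹' Ioi x)ᶜ := by
    ext ω
    simp
  rw [compl_eq, probReal_compl_eq_one_sub (hR measurableSet_Ioi), measureReal_def,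
    ← Measure.map_apply hR measurableSet_Ioi, map_linkDist hD, rayleigh_Ioi p.rateD_pos hx.le,
    ENNReal.toReal_ofReal (Real.exp_pos _).le, sub_eq_add_neg]

theorem linkDensity_eq {r : ℝ} (hr : 0 < r) :
    linkDensity p D N μ r = p.rateD * r * Real.exp (-(p.rateD * r ^ 2 / 2)) :=
  (hasDerivAt_cdf_linkDist hD hr).deriv

theorem map_linkDist_eq_withDensity :
    μ.map (linkDist p D N) = (volume.restrict (Ioi (0 : ℝ))).withDensity
      (fun r => ENNReal.ofReal (linkDensity p D N μ r)) := by
  rw [map_linkDist hD]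
  refine withDensity_congr_ae ?_
  filter_upwards [ae_restrict_mem measurableSet_Ioi] with r hr
  rw [linkDensity_eq hD hr]

theorem integrableOn_mul_linkDensity_iff {f : ℝ → ℂ} :
    IntegrableOn (fun r => f r * (linkDensity p D N μ r : ℂ)) (Ioi 0) ↔
      Integrable f (rayleigh p.rateD) := by
  rw [integrable_rayleigh_iff p.rateD_pos]
  refine integrableOn_congr_fun (fun r hr => ?_) measurableSet_Ioi
  rw [linkDensity_eq hD hr, mul_comm]

theorem setIntegral_mul_linkDensity (f : ℝ → ℂ) :
    ∫ r in Ioi 0, f r * (linkDensity p D N μ r : ℂ) = ∫ r, f r ∂rayleigh p.rateD := by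
  rw [← Measure.restrict_eq_self_of_ae_mem (s := Ioi 0) (ae_pos_rayleigh p.rateD),
    setIntegral_Ioi_rayleigh p.rateD_pos le_rfl]
  refine setIntegral_congr_fun measurableSet_Ioi fun r hr => ?_
  rw [linkDensity_eq hD hr, mul_comm]

end LinkDensity

include hY hC hD

theorem lt_sinr_ae_eq {T : ℝ} (hT : 0 < T) :
    {ω | ENNReal.ofReal T < sinr p C M D N ω} =ᵐ[μ] invSinr p C M D N ⁻¹' Ioo 0 (1 / T) := by
  filter_upwards [ae_sinr_ne_zero_and_ne_top hY hC hD] with ω ⟨ne_zero, ne_top⟩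
  have sinr_pos := ENNReal.toReal_pos ne_zero ne_top
  refine propext ?_
  change ENNReal.ofReal T < sinr p C M D N ω ↔
    0 < (sinr p C M D N ω)⁻¹.toReal ∧ (sinr p C M D N ω)⁻¹.toReal < 1 / T
  rw [ENNReal.toReal_inv, and_iff_right (inv_pos.2 sinr_pos), ← one_div,
    one_div_lt_one_div sinr_pos hT, ENNReal.ofReal_lt_iff_lt_toReal hT.le ne_top]

theorem ae_condDistrib_invSinr_zero : ∀ᵐ r ∂rayleigh p.rateD,
    condDistrib (invSinr p C M D N) (linkDist p D N) μ r {0} = 0 := by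
  rw [← map_linkDist hD]
  refine ae_condDistrib_eq_zero
    (measurable_linkDist p hD.poisson.measurable hD.measurable_mark).aemeasurable
    (aemeasurable_invSinr hY hC hD) (measurableSet_singleton 0) ?_
  exact (ae_sinr_ne_zero_and_ne_top hY hC hD).mono fun ω h => ENNReal.toReal_ne_zero.2
    ⟨ENNReal.inv_ne_zero.2 h.2, ENNReal.inv_ne_top.2 h.1⟩

include hCD

theorem integral_inversionIntegrand_ae_eq {T : ℝ} (hT : 0 < T) :
    (fun r => ∫ w, inversionIntegrand p T r w) =ᵐ[rayleigh p.rateD] fun r =>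
      (((condDistrib (invSinr p C M D N) (linkDist p D N) μ r).real (Ioo 0 (1 / T)) : ℝ) : ℂ) := by
  filter_upwards [ae_pos_rayleigh p.rateD, ae_condDistrib_invSinr_zero hY hC hD,
    ae_forall_integral_exp_condDistrib_invSinr hY hC hD hCD] with r hr hzero hchar
  simp only [← charFun_neg_eq_integral] at hchar
  have hint := integrable_norm_charInvSinr_div hY hC hD hr
  simp only [inversionIntegrand_eq, ← hchar] at hint ⊢
  exact integral_intervalKernel_mul_charFun hzero hint (one_div_pos.2 hT)

theorem integrable_integral_inversionIntegrand {T : ℝ} (hT : 0 < T) :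
    Integrable (fun r => ∫ w, inversionIntegrand p T r w) (rayleigh p.rateD) := by
  have := isProbabilityMeasure_rayleigh p.rateD_pos
  refine Integrable.congr ?_ (integral_inversionIntegrand_ae_eq hY hC hD hCD hT).symm
  refine Integrable.ofReal (.of_bound ?_ 1 (.of_forall fun r => ?_))
  · exact (Kernel.measurable_coe _ measurableSet_Ioo).ennreal_toReal.aestronglyMeasurable
  · exact (Real.norm_of_nonneg measureReal_nonneg).trans_le measureReal_le_one

theorem integral_integral_inversionIntegrand {T : ℝ} (hT : 0 < T) :
    ∫ r, (∫ w, inversionIntegrand p T r w) ∂rayleigh p.rateD =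
      (μ.real {ω | ENNReal.ofReal T < sinr p C M D N ω} : ℂ) := by
  rw [integral_congr_ae (integral_inversionIntegrand_ae_eq hY hC hD hCD hT),
    integral_complex_ofReal, measureReal_congr (lt_sinr_ae_eq hY hC hD hT), ← map_linkDist hD,
    integral_condDistrib_real
      (measurable_linkDist p hD.poisson.measurable hD.measurable_mark).aemeasurable
      (aemeasurable_invSinr hY hC hD) measurableSet_Ioo]

end Coverage

end D2D

end

theorem lemma5 {Ω : Type*} [MeasurableSpace Ω] (μ : MeasureTheory.Measure Ω)
    [IsProbabilityMeasure μ] (p : D2D.Params)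
    -- the base stations, with their shadowings towards a typical UE
    (Y : ℕ → Ω → D2D.Plane) (xi : ℕ → Ω → ℝ)
    (hY : D2D.IsMarkedPoisson Y xi (D2D.homogeneous p.lamB) (D2D.shadowLaw p.sigmaB) μ)
    -- the active cellular UEs
    (C : ℕ → Ω → D2D.Plane) (M : ℕ → Ω → ℝ × ℝ)
    (hC : D2D.IsMarkedPoisson C M (D2D.homogeneous p.lamB)
      ((D2D.shadowLaw p.sigmaB).prod (D2D.cellularDistLaw p Y xi μ)) μ)
    -- the D2D UEs
    (D : ℕ → Ω → D2D.Plane) (N : ℕ → Ω → ℝ × Bool)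
    (hD : D2D.IsMarkedPoisson D N (D2D.homogeneous (D2D.lamD2D p Y xi μ))
      ((D2D.shadowLaw p.sigmaD).prod D2D.fairCoin) μ)
    (hCD : IndepFun (fun ω i => (C i ω, M i ω)) (fun ω j => (D j ω, N j ω)) μ) :
    -- the distance of the D2D link has the derivative of its distribution function as density
    (∀ r : ℝ, 0 < r → DifferentiableAt ℝ (fun x => μ.real {ω | D2D.linkDist p D N ω ≤ x}) r) ∧
    μ.map (D2D.linkDist p D N) = (volume.restrict (Ioi (0 : ℝ))).withDensity
      (fun r => ENNReal.ofReal (D2D.linkDensity p D N μ r)) ∧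
    -- the conditional characteristic function of 1 / SINR given the distance of the D2D link
    (∀ w : ℝ,
      μ[fun ω => Complex.exp (-(Complex.I * w * ((D2D.sinr p C M D N ω)⁻¹.toReal : ℝ))) |
        MeasurableSpace.comap (D2D.linkDist p D N) inferInstance]
      =ᵐ[μ] fun ω => D2D.charInvSinr p w (D2D.linkDist p D N ω)) ∧
    -- the coverage probability
    (∀ T : ℝ, 0 < T →
      (∀ r : ℝ, 0 < r → Integrable (D2D.inversionIntegrand p T r)) ∧
      IntegrableOn (fun r : ℝ =>
        (∫ w : ℝ, D2D.inversionIntegrand p T r w) * (D2D.linkDensity p D N μ r : ℂ)) (Ioi 0) ∧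
      ((μ.real {ω | ENNReal.ofReal T < D2D.sinr p C M D N ω} : ℝ) : ℂ) =
        ∫ r in Ioi (0 : ℝ),
          (∫ w : ℝ, D2D.inversionIntegrand p T r w) * (D2D.linkDensity p D N μ r : ℂ)) := by
  rw [D2D.lamD2D_eq hY] at hD
  refine ⟨fun r hr => (D2D.hasDerivAt_cdf_linkDist hD hr).differentiableAt,
    D2D.map_linkDist_eq_withDensity hD, D2D.condExp_exp_invSinr hY hC hD hCD, fun T hT =>
    ⟨fun r hr => D2D.integrable_inversionIntegrand hY hC hD T hr, ?_, ?_⟩⟩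
  · exact (D2D.integrableOn_mul_linkDensity_iff hD).2
      (D2D.integrable_integral_inversionIntegrand hY hC hD hCD hT)
  · rw [D2D.setIntegral_mul_linkDensity hD,
      D2D.integral_integral_inversionIntegrand hY hC hD hCD hT]
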